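/- Let $F$ and $G$ be division rings and let $M$ be an algebraic $F$-$G$-bimodule: $M$ is a left $F$-, right $G$-bimodule that is finite-dimensional over $F$ and over $G$, and there is a field $K$ such that $F$ and $G$ are finite-dimensional $K$-algebras and $K$ operates centrally on $M$ (i.e. $km=mk$ for all $k\in K$, $m\in M$). Put $a=\dim M_G$ and $b=\dim {}_FM$, and let $R_M=\begin{pmatrix}F&M\\0&G\end{pmatrix}$ be the upper triangular matrix ring. For a finite length module $N$ and a simple module $S$ let $m_S(N)$ denote the multiplicity of $S$ as a composition factor of $N$. Then the following are equivalent: 1. any two finite length indecomposable right $R_M$-modules $N,N'$ with $m_S(N)=m_S(N')$ for all simple right $R_M$-modules $S$ are isomorphic (that is, $R_M$ satisfies $\mathfrak X$); 2. $ab\le 3$; 3. $R_M$ is of finite representation type, i.e. up to isomorphism there are only finitely many finitely generated indecomposable right $R_M$-modules. -/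

import Mathlib

universe u v w

/-- The upper triangular matrix ring `(F, M; 0, G)` of an `F`-`G`-bimodule `M`. An element
`⟨f, m, g⟩` is the matrix with diagonal entries `f`, `g` and upper right entry `m`. The right
action of `G` on `M` is a left action of `Gᵐᵒᵖ`. -/
@[ext]
structure TriangularRing (F : Type u) (M : Type v) (G : Type w) where
  left : F
  mid : M
  right : G

namespace TriangularRing

section

variable {F : Type u} {M : Type v} {G : Type w} [Ring F] [Ring G] [AddCommGroup M]

instance : Zero (TriangularRing F M G) := ⟨⟨0, 0, 0⟩⟩

instance : One (TriangularRing F M G) := ⟨⟨1, 0, 1⟩⟩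

instance : Add (TriangularRing F M G) :=
  ⟨fun x y => ⟨x.left + y.left, x.mid + y.mid, x.right + y.right⟩⟩

instance : Neg (TriangularRing F M G) := ⟨fun x => ⟨-x.left, -x.mid, -x.right⟩⟩

/-- Matrix multiplication: `(f, m; 0, g) * (f', m'; 0, g') = (f f', f m' + m g'; 0, g g')`. -/
instance [Module F M] [Module Gᵐᵒᵖ M] : Mul (TriangularRing F M G) :=
  ⟨fun x y => ⟨x.left * y.left, x.left • y.mid + MulOpposite.op y.right • x.mid,
    x.right * y.right⟩⟩

@[simp] theorem zero_left : (0 : TriangularRing F M G).left = 0 := rfl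

@[simp] theorem zero_mid : (0 : TriangularRing F M G).mid = 0 := rfl

@[simp] theorem zero_right : (0 : TriangularRing F M G).right = 0 := rfl

@[simp] theorem one_left : (1 : TriangularRing F M G).left = 1 := rfl

@[simp] theorem one_mid : (1 : TriangularRing F M G).mid = 0 := rfl

@[simp] theorem one_right : (1 : TriangularRing F M G).right = 1 := rfl

@[simp] theorem add_left (x y : TriangularRing F M G) : (x + y).left = x.left + y.left := rfl

@[simp] theorem add_mid (x y : TriangularRing F M G) : (x + y).mid = x.mid + y.mid := rfl

@[simp] theorem add_right (x y : TriangularRing F M G) : (x + y).right = x.right + y.right := rfl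

@[simp] theorem neg_left (x : TriangularRing F M G) : (-x).left = -x.left := rfl

@[simp] theorem neg_mid (x : TriangularRing F M G) : (-x).mid = -x.mid := rfl

@[simp] theorem neg_right (x : TriangularRing F M G) : (-x).right = -x.right := rfl

@[simp] theorem mul_left [Module F M] [Module Gᵐᵒᵖ M] (x y : TriangularRing F M G) :
    (x * y).left = x.left * y.left := rfl

@[simp] theorem mul_mid [Module F M] [Module Gᵐᵒᵖ M] (x y : TriangularRing F M G) :
    (x * y).mid = x.left • y.mid + MulOpposite.op y.right • x.mid := rfl

@[simp] theorem mul_right [Module F M] [Module Gᵐᵒᵖ M] (x y : TriangularRing F M G) :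
    (x * y).right = x.right * y.right := rfl

instance [Module F M] [Module Gᵐᵒᵖ M] [SMulCommClass F Gᵐᵒᵖ M] :
    Ring (TriangularRing F M G) where
  add_assoc x y z := by ext <;> simp [add_assoc]
  zero_add x := by ext <;> simp
  add_zero x := by ext <;> simp
  add_comm x y := by ext <;> simp [add_comm]
  neg_add_cancel x := by ext <;> simp
  left_distrib x y z := by
    ext <;> simp [mul_add, smul_add, add_smul]
    abel
  right_distrib x y z := by
    ext <;> simp [add_mul, smul_add, add_smul]
    abel
  zero_mul x := by ext <;> simp
  mul_zero x := by ext <;> simp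
  mul_assoc x y z := by
    ext <;> simp [mul_assoc, smul_add, mul_smul, add_assoc, smul_comm]
  one_mul x := by ext <;> simp
  mul_one x := by ext <;> simp
  nsmul := nsmulRec
  zsmul := zsmulRec

end

end TriangularRing

/-- `M` is an algebraic `F`-`G`-bimodule with respect to the field `K`: it is finite-dimensional
on both sides, `F` and `G` are finite-dimensional `K`-algebras, and `K` operates centrally on `M`,
that is, `k m = m k`. -/
structure IsAlgebraicBimodule (K F G M : Type*) [Field K] [DivisionRing F] [DivisionRing G]
    [Algebra K F] [Algebra K G] [AddCommGroup M] [Module F M] [Module Gᵐᵒᵖ M] : Prop where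
  finite_F : Module.Finite K F
  finite_G : Module.Finite K G
  finite_left : Module.Finite F M
  finite_right : Module.Finite Gᵐᵒᵖ M
  central : ∀ (k : K) (m : M), algebraMap K F k • m = MulOpposite.op (algebraMap K G k) • m

/-- A module is indecomposable if it is nonzero and is not the internal direct sum of two nonzero
submodules. -/
def IsIndecomposableModule (A N : Type*) [Ring A] [AddCommGroup N] [Module A N] : Prop :=
  Nontrivial N ∧ ∀ p q : Submodule A N, IsCompl p q → p = ⊥ ∨ q = ⊥

/-- The number of factors isomorphic to `S` in a series of submodules. -/
noncomputable def factorCount {A N : Type*} [Ring A] [AddCommGroup N] [Module A N]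
    (s : CompositionSeries (Submodule A N)) (S : Type*) [AddCommGroup S] [Module A S] : ℕ :=
  Nat.card {i : Fin s.length //
    Nonempty (S ≃ₗ[A] (s i.succ ⧸ (s i.castSucc).comap (s i.succ).subtype))}

open Classical in
/-- The multiplicity of `S` as a composition factor of `N`, read off from a composition series
`0 = N_0 ⊂ ⋯ ⊂ N_n = N`; by convention it is `0` if `N` has no composition series. -/
noncomputable def compositionMultiplicity (A S N : Type*) [Ring A] [AddCommGroup S] [Module A S]
    [AddCommGroup N] [Module A N] : ℕ :=
  if h : ∃ s : CompositionSeries (Submodule A N), s.head = ⊥ ∧ s.last = ⊤ then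
    factorCount h.choose S
  else 0

/-- The multiplicity does not depend on the composition series. -/
theorem compositionMultiplicity_eq_factorCount {A S N : Type*} [Ring A] [AddCommGroup S]
    [Module A S] [AddCommGroup N] [Module A N] (s : CompositionSeries (Submodule A N))
    (h0 : s.head = ⊥) (h1 : s.last = ⊤) :
    compositionMultiplicity A S N = factorCount s S := by
  have h : ∃ s : CompositionSeries (Submodule A N), s.head = ⊥ ∧ s.last = ⊤ := ⟨s, h0, h1⟩
  rw [compositionMultiplicity, dif_pos h]
  obtain ⟨e, he⟩ := CompositionSeries.jordan_holder h.choose s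
    (h.choose_spec.1.trans h0.symm) (h.choose_spec.2.trans h1.symm)
  refine Nat.card_congr (e.subtypeEquiv fun i => ?_)
  have f := (he i).linearEquiv
  exact ⟨fun ⟨g⟩ => ⟨g.trans f⟩, fun ⟨g⟩ => ⟨g.trans f.symm⟩⟩

/-- The finite length indecomposable right `R`-modules are completely determined by their
composition factors. Right `R`-modules are modules over `Rᵐᵒᵖ`; every finite length module and every
simple module over `R` is isomorphic to one in the universe of `R`. -/
def SatisfiesX (R : Type u) [Ring R] : Prop :=
  ∀ (N N' : Type u) [AddCommGroup N] [Module Rᵐᵒᵖ N] [AddCommGroup N'] [Module Rᵐᵒᵖ N'],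
    IsFiniteLength Rᵐᵒᵖ N → IsFiniteLength Rᵐᵒᵖ N' →
    IsIndecomposableModule Rᵐᵒᵖ N → IsIndecomposableModule Rᵐᵒᵖ N' →
    (∀ (S : Type u) [AddCommGroup S] [Module Rᵐᵒᵖ S], IsSimpleModule Rᵐᵒᵖ S →
      compositionMultiplicity Rᵐᵒᵖ S N = compositionMultiplicity Rᵐᵒᵖ S N') →
    Nonempty (N ≃ₗ[Rᵐᵒᵖ] N')

/-- Up to isomorphism there are only finitely many finitely generated indecomposable right
`R`-modules: they all occur, up to isomorphism, in a finite list of modules. -/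
def IsFiniteRepresentationType (R : Type u) [Ring R] : Prop :=
  ∃ (n : ℕ) (L : Fin n → ModuleCat.{u} Rᵐᵒᵖ),
    ∀ (N : Type u) [AddCommGroup N] [Module Rᵐᵒᵖ N],
      Module.Finite Rᵐᵒᵖ N → IsIndecomposableModule Rᵐᵒᵖ N →
      ∃ i, Nonempty (N ≃ₗ[Rᵐᵒᵖ] L i)

/-!
Write `f`, `g`, `μ` for the `K`-dimensions of `F`, `G`, `M`, so that `μ = f b = g a`. The Peirce
decomposition turns a right module over the triangular ring into a triple `(V, W, β)`: a right
`F`-space `V`, a right `G`-space `W` and a map `β : V × M → W` that is `F`-balanced and `G`-linear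
(`RepModule`, `peirceEquiv`). The composition factors of the module record precisely the
dimensions of `V` and `W` (`RepModule.finrank_eq_of_multiplicity`). So condition `𝔛` says that
indecomposable triples are determined by their dimensions, and `ab ≤ 3` has to be compared with
this and with finiteness of the number of indecomposable triples.

**The case `ab ≤ 3`.** An indecomposable triple with `V` and `W` nonzero has `β` nondegenerate in
`V` and with image spanning `W`; in particular `M ≠ 0`, so that `a = 1` or `b = 1`. If `M = m₀ G`,
the triple amounts to the `G`-space `Y = W` with the `F`-subspace `Z = β(V, m₀)`; if `M = F m₀`,
it amounts to the `F`-space `Y = V` with the `G`-subspace `Z = ker β(-, m₀)`. In both cases there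
are division algebras `E → D` of index at most three, a `D`-space `Y` and an `E`-subspace `Z`, and
the claim is that an indecomposable pair `(Y, Z)` is determined by its dimensions
(`pairIso_of_finrank_eq`) and has `dim Y ≤ 3`. Since `Hom_E(D, E)` is one-dimensional over `D`,
functionals over `E` lift to functionals over `D`, which shows that a line meeting `Z` in
codimension at most one splits off. This leaves lines (`pairIso_of_finrank_eq_one`) and index
three with all lines meeting `Z` in dimension at most one. In the latter case let `U` be the
kernel of `D ⊗_E Z → Y`. A coordinate functional of a right `E`-basis `c` of `D` maps `U`
injectively to `Z`, because of the condition on lines, and surjectively, because otherwise the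
pair would have the pair `(D, E)` as a quotient, which splits off. A decomposition of `U` would
therefore decompose the pair, so `U` is a line, and the pair is `(D³ / D c, E³)`
(`exists_basis_relationModule_eq`). The bound on the dimensions leaves finitely many
indecomposable modules.

**The case `ab ≥ 4`.** Triples with `V = F^x` and `W = G^y` are given by matrices over the dual
`M* = Hom_G(M, G)`, and isomorphism is equivalence under `GL_x(F) × GL_y(G)`. For `(x, y) = (1,
1)` if `a, b ≥ 2`, `(2, 1)` if `a = 1` and `(1, 2)` if `b = 1`, all matrices with independent
entries are indecomposable, while the group is too small to act with one orbit, or with finitely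
many orbits if `K` is infinite. For infinite `K` this is a dimension argument for images of
bilinear maps (`exists_ne_bilinear`); for finite `K` it is a count. So `𝔛` fails, and for infinite
`K` there are infinitely many indecomposable modules.

For finite `K` and dimensions with `f x² + g y² ≤ μ x y` there are at least `|F|^(x²) |G|^(y²)`
matrices, which bounds `|GL_x(F) × GL_y(G)|`, so the number of isomorphism classes is at least the
minimum of the orders of the automorphism groups. If there were only `n` indecomposable modules,
then for `x`, `y` of order `k` every module would have `2k` isomorphic summands, hence at least
`2^(k²)` automorphisms, whereas the number of isomorphism classes is bounded by a polynomial in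
`k` of degree `n` (`not_isFiniteRepresentationType_of_finite`).
-/

open MulOpposite

set_option linter.unusedSectionVars false

/-! ### Right modules over a triangular ring as triples -/

/-- The structure map of a representation `(V, W)` of the bimodule `M`: a biadditive map
`V × M → W` that is `F`-balanced and right `G`-linear in `M`. It encodes a `G`-linear map
`V ⊗_F M → W`. -/
structure BalancedMap (F G M V W : Type*) [Ring F] [Ring G] [AddCommGroup M] [Module F M]
    [Module Gᵐᵒᵖ M] [AddCommGroup V] [Module Fᵐᵒᵖ V] [AddCommGroup W] [Module Gᵐᵒᵖ W] where
  /-- The underlying biadditive map. -/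
  toFun : V →+ M →+ W
  balanced : ∀ (f : F) (v : V) (m : M), toFun (op f • v) m = toFun v (f • m)
  map_op_smul : ∀ (g : G) (v : V) (m : M), toFun v (op g • m) = op g • toFun v m

section RepModule

variable {F G M V W V' W' : Type*} [Ring F] [Ring G] [AddCommGroup M] [Module F M]
  [Module Gᵐᵒᵖ M] [SMulCommClass F Gᵐᵒᵖ M]
  [AddCommGroup V] [Module Fᵐᵒᵖ V] [AddCommGroup W] [Module Gᵐᵒᵖ W]
  [AddCommGroup V'] [Module Fᵐᵒᵖ V'] [AddCommGroup W'] [Module Gᵐᵒᵖ W']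

/-- The right module `V ⊕ W` over the triangular ring given by a balanced map `β : V × M → W`;
the matrix `(f, m; 0, g)` acts by `(v, w) ↦ (v f, β(v, m) + w g)`. -/
def RepModule (_β : BalancedMap F G M V W) : Type _ := V × W

namespace RepModule

variable (β : BalancedMap F G M V W) (β' : BalancedMap F G M V' W')

instance : AddCommGroup (RepModule β) := inferInstanceAs (AddCommGroup (V × W))

instance : SMul (TriangularRing F M G)ᵐᵒᵖ (RepModule β) :=
  ⟨fun r n => ((op r.unop.left • n.1 : V), (β.toFun n.1 r.unop.mid + op r.unop.right • n.2 : W))⟩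

variable {β}

/-- The element `(v, w)` of the module of a representation. -/
def mk (v : V) (w : W) : RepModule β := (v, w)

/-- The component in `V`. -/
def fst (n : RepModule β) : V := n.1

/-- The component in `W`. -/
def snd (n : RepModule β) : W := n.2

@[simp] theorem fst_mk (v : V) (w : W) : fst (mk v w : RepModule β) = v := rfl
@[simp] theorem snd_mk (v : V) (w : W) : snd (mk v w : RepModule β) = w := rfl
@[simp] theorem fst_add (n n' : RepModule β) : (n + n').fst = n.fst + n'.fst := rfl
@[simp] theorem snd_add (n n' : RepModule β) : (n + n').snd = n.snd + n'.snd := rfl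
@[simp] theorem fst_zero : (0 : RepModule β).fst = 0 := rfl
@[simp] theorem snd_zero : (0 : RepModule β).snd = 0 := rfl
@[simp] theorem fst_smul (r : (TriangularRing F M G)ᵐᵒᵖ) (n : RepModule β) :
    (r • n).fst = op r.unop.left • n.fst := rfl
@[simp] theorem snd_smul (r : (TriangularRing F M G)ᵐᵒᵖ) (n : RepModule β) :
    (r • n).snd = β.toFun n.fst r.unop.mid + op r.unop.right • n.snd := rfl

@[ext] theorem ext {n n' : RepModule β} (h : n.fst = n'.fst) (h' : n.snd = n'.snd) : n = n' :=
  Prod.ext h h'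

variable (β)

instance : Module (TriangularRing F M G)ᵐᵒᵖ (RepModule β) where
  one_smul n := by ext <;> simp
  mul_smul r s n := by
    ext
    · simp [mul_smul]
    · simp [mul_smul, β.balanced, β.map_op_smul, add_assoc]
  smul_zero r := by ext <;> simp
  smul_add r n n' := by
    ext
    · simp
    · simp only [snd_smul, fst_add, map_add, AddMonoidHom.add_apply, snd_add, smul_add]; abel
  add_smul r s n := by
    ext
    · simp [add_smul]
    · simp only [snd_smul, snd_add, unop_add, TriangularRing.add_mid, map_add,
        TriangularRing.add_right, op_add, add_smul]; abel
  zero_smul n := by ext <;> simp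

variable {β}

/-- The submodule given by subspaces `V₁ ≤ V` and `W₁ ≤ W` with `β(V₁, M) ≤ W₁`. -/
def subrep (V₁ : Submodule Fᵐᵒᵖ V) (W₁ : Submodule Gᵐᵒᵖ W) (h : ∀ v ∈ V₁, ∀ m, β.toFun v m ∈ W₁) :
    Submodule (TriangularRing F M G)ᵐᵒᵖ (RepModule β) where
  carrier := {n | n.fst ∈ V₁ ∧ n.snd ∈ W₁}
  zero_mem' := ⟨V₁.zero_mem, W₁.zero_mem⟩
  add_mem' h h' := ⟨V₁.add_mem h.1 h'.1, W₁.add_mem h.2 h'.2⟩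
  smul_mem' _ _ hn := ⟨V₁.smul_mem _ hn.1, W₁.add_mem (h _ hn.1 _) (W₁.smul_mem _ hn.2)⟩

/-- An indecomposable module has no decomposition of the spaces `V` and `W` compatible with `β`. -/
theorem isIndecomposable_split (hN : IsIndecomposableModule (TriangularRing F M G)ᵐᵒᵖ (RepModule β))
    {V₁ V₂ : Submodule Fᵐᵒᵖ V} {W₁ W₂ : Submodule Gᵐᵒᵖ W} (hV : IsCompl V₁ V₂) (hW : IsCompl W₁ W₂)
    (h₁ : ∀ v ∈ V₁, ∀ m, β.toFun v m ∈ W₁) (h₂ : ∀ v ∈ V₂, ∀ m, β.toFun v m ∈ W₂) :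
    (V₁ = ⊥ ∧ W₁ = ⊥) ∨ (V₂ = ⊥ ∧ W₂ = ⊥) := by
  have key : ∀ {V₁ : Submodule Fᵐᵒᵖ V} {W₁ : Submodule Gᵐᵒᵖ W}
      (h₁ : ∀ v ∈ V₁, ∀ m, β.toFun v m ∈ W₁), subrep V₁ W₁ h₁ = ⊥ → V₁ = ⊥ ∧ W₁ = ⊥ := by
    intro V₁ W₁ h₁ h
    rw [Submodule.eq_bot_iff] at h ⊢
    rw [Submodule.eq_bot_iff]
    exact ⟨fun v hv => congrArg fst (h (mk v 0) ⟨hv, W₁.zero_mem⟩),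
      fun w hw => congrArg snd (h (mk 0 w) ⟨V₁.zero_mem, hw⟩)⟩
  have hc : IsCompl (subrep V₁ W₁ h₁) (subrep V₂ W₂ h₂) := by
    refine ⟨Submodule.disjoint_def.2 fun n hn hn' => ?_, codisjoint_iff.2 (eq_top_iff.2 ?_)⟩
    · exact ext (Submodule.disjoint_def.1 hV.disjoint _ hn.1 hn'.1)
        (Submodule.disjoint_def.1 hW.disjoint _ hn.2 hn'.2)
    · rintro n -
      obtain ⟨v, hv, v', hv', h⟩ := Submodule.mem_sup.1
        (hV.sup_eq_top.ge (Submodule.mem_top (x := n.fst)))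
      obtain ⟨w, hw, w', hw', h'⟩ := Submodule.mem_sup.1
        (hW.sup_eq_top.ge (Submodule.mem_top (x := n.snd)))
      exact Submodule.mem_sup.2 ⟨mk v w, ⟨hv, hw⟩, mk v' w', ⟨hv', hw'⟩, ext h h'⟩
  exact (hN.2 _ _ hc).imp (key h₁) (key h₂)

/-- The part in `V` of a submodule. -/
def leftSub (p : Submodule (TriangularRing F M G)ᵐᵒᵖ (RepModule β)) : Submodule Fᵐᵒᵖ V where
  carrier := {v | mk v 0 ∈ p}
  zero_mem' := p.zero_mem
  add_mem' h h' := by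
    have := p.add_mem h h'
    rwa [show (mk _ 0 + mk _ 0 : RepModule β) = mk (_ + _) 0 from ext rfl (by simp)] at this
  smul_mem' f v h := by
    have := p.smul_mem (op ⟨f.unop, 0, 0⟩) h
    rwa [show ((op ⟨f.unop, 0, 0⟩ : (TriangularRing F M G)ᵐᵒᵖ) • mk v 0 : RepModule β) =
      mk (f • v) 0 from ext (by simp) (by simp)] at this

/-- The part in `W` of a submodule. -/
def rightSub (p : Submodule (TriangularRing F M G)ᵐᵒᵖ (RepModule β)) : Submodule Gᵐᵒᵖ W where
  carrier := {w | mk 0 w ∈ p}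
  zero_mem' := p.zero_mem
  add_mem' h h' := by
    have := p.add_mem h h'
    rwa [show (mk 0 _ + mk 0 _ : RepModule β) = mk 0 (_ + _) from ext (by simp) rfl] at this
  smul_mem' f v h := by
    have := p.smul_mem (op ⟨0, 0, f.unop⟩) h
    rwa [show ((op ⟨0, 0, f.unop⟩ : (TriangularRing F M G)ᵐᵒᵖ) • mk 0 v : RepModule β) =
      mk 0 (f • v) from ext (by simp) (by simp)] at this

variable {p q : Submodule (TriangularRing F M G)ᵐᵒᵖ (RepModule β)}

theorem fst_mem {n : RepModule β} (hn : n ∈ p) : n.fst ∈ leftSub p := by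
  have := p.smul_mem (op ⟨1, 0, 0⟩) hn
  rwa [show (_ • n : RepModule β) = mk n.fst 0 from ext (by simp) (by simp)] at this

theorem snd_mem {n : RepModule β} (hn : n ∈ p) : n.snd ∈ rightSub p := by
  have := p.smul_mem (op ⟨0, 0, 1⟩) hn
  rwa [show (_ • n : RepModule β) = mk 0 n.snd from ext (by simp) (by simp)] at this

theorem apply_mem {v : V} (hv : v ∈ leftSub p) (m : M) : β.toFun v m ∈ rightSub p := by
  have := p.smul_mem (op ⟨0, m, 0⟩) hv
  rwa [show (_ • _ : RepModule β) = mk 0 (β.toFun v m) from ext (by simp) (by simp)] at this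

theorem eq_bot_of_parts (h : leftSub p = ⊥) (h' : rightSub p = ⊥) : p = ⊥ := by
  rw [Submodule.eq_bot_iff] at h h' ⊢
  exact fun n hn => ext (h _ (fst_mem hn)) (h' _ (snd_mem hn))

theorem isCompl_leftSub (h : IsCompl p q) : IsCompl (leftSub p) (leftSub q) := by
  refine ⟨Submodule.disjoint_def.2 fun v hv hv' => ?_, codisjoint_iff.2 (eq_top_iff.2 ?_)⟩
  · exact congrArg fst (Submodule.disjoint_def.1 h.disjoint _ hv hv')
  · rintro v -
    obtain ⟨n, hn, n', hn', e⟩ := Submodule.mem_sup.1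
      (h.sup_eq_top.ge (Submodule.mem_top (x := mk v 0)))
    exact Submodule.mem_sup.2 ⟨_, fst_mem hn, _, fst_mem hn', congrArg fst e⟩

theorem isCompl_rightSub (h : IsCompl p q) : IsCompl (rightSub p) (rightSub q) := by
  refine ⟨Submodule.disjoint_def.2 fun v hv hv' => ?_, codisjoint_iff.2 (eq_top_iff.2 ?_)⟩
  · exact congrArg snd (Submodule.disjoint_def.1 h.disjoint _ hv hv')
  · rintro v -
    obtain ⟨n, hn, n', hn', e⟩ := Submodule.mem_sup.1
      (h.sup_eq_top.ge (Submodule.mem_top (x := mk 0 v)))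
    exact Submodule.mem_sup.2 ⟨_, snd_mem hn, _, snd_mem hn', congrArg snd e⟩

/-- An isomorphism of representations induces an isomorphism of modules. -/
def congr (eV : V ≃ₗ[Fᵐᵒᵖ] V') (eW : W ≃ₗ[Gᵐᵒᵖ] W')
    (h : ∀ v m, eW (β.toFun v m) = β'.toFun (eV v) m) :
    RepModule β ≃ₗ[(TriangularRing F M G)ᵐᵒᵖ] RepModule β' where
  toFun n := mk (eV n.fst) (eW n.snd)
  map_add' n n' := by ext <;> simp
  map_smul' r n := by ext <;> simp [h]
  invFun n := mk (eV.symm n.fst) (eW.symm n.snd)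
  left_inv n := by ext <;> simp
  right_inv n := by ext <;> simp

variable {β'}

/-- The `V`-component of a homomorphism. -/
def leftMap (e : RepModule β →ₗ[(TriangularRing F M G)ᵐᵒᵖ] RepModule β') : V →ₗ[Fᵐᵒᵖ] V' where
  toFun v := (e (mk v 0)).fst
  map_add' v v' := by
    rw [show (mk (v + v') 0 : RepModule β) = mk v 0 + mk v' 0 from ext rfl (by simp), map_add,
      fst_add]
  map_smul' f v := by
    rw [show (mk (f • v) 0 : RepModule β) = (op ⟨f.unop, 0, 0⟩ : (TriangularRing F M G)ᵐᵒᵖ) • mk v 0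
      from ext (by simp) (by simp), map_smul]
    simp

/-- The `W`-component of a homomorphism. -/
def rightMap (e : RepModule β →ₗ[(TriangularRing F M G)ᵐᵒᵖ] RepModule β') : W →ₗ[Gᵐᵒᵖ] W' where
  toFun w := (e (mk 0 w)).snd
  map_add' v v' := by
    rw [show (mk 0 (v + v') : RepModule β) = mk 0 v + mk 0 v' from ext (by simp) rfl, map_add,
      snd_add]
  map_smul' f v := by
    rw [show (mk 0 (f • v) : RepModule β) = (op ⟨0, 0, f.unop⟩ : (TriangularRing F M G)ᵐᵒᵖ) • mk 0 v
      from ext (by simp) (by simp), map_smul]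
    simp

theorem map_eq (e : RepModule β →ₗ[(TriangularRing F M G)ᵐᵒᵖ] RepModule β') (n : RepModule β) :
    e n = mk (leftMap e n.fst) (rightMap e n.snd) := by
  ext
  · have h : (mk n.fst 0 : RepModule β) = (op ⟨1, 0, 0⟩ : (TriangularRing F M G)ᵐᵒᵖ) • n :=
      ext (by simp) (by simp)
    simp [leftMap, h]
  · have h : (mk 0 n.snd : RepModule β) = (op ⟨0, 0, 1⟩ : (TriangularRing F M G)ᵐᵒᵖ) • n :=
      ext (by simp) (by simp)
    simp [rightMap, h]

theorem rightMap_apply (e : RepModule β →ₗ[(TriangularRing F M G)ᵐᵒᵖ] RepModule β') (v : V)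
    (m : M) : rightMap e (β.toFun v m) = β'.toFun (leftMap e v) m := by
  have h := e.map_smul (op ⟨0, m, 0⟩ : (TriangularRing F M G)ᵐᵒᵖ) (mk v 0)
  rw [show ((op ⟨0, m, 0⟩ : (TriangularRing F M G)ᵐᵒᵖ) • mk v 0 : RepModule β)
    = mk 0 (β.toFun v m) from ext (by simp) (by simp)] at h
  have := congrArg snd h
  simpa [rightMap, leftMap] using this

/-- A finitely generated module over the triangular ring is finite over both diagonal rings,
provided that `M` is finite over `G`. -/
theorem finite_parts [Module.Finite Gᵐᵒᵖ M]
    (h : Module.Finite (TriangularRing F M G)ᵐᵒᵖ (RepModule β)) :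
    Module.Finite Fᵐᵒᵖ V ∧ Module.Finite Gᵐᵒᵖ W := by
  obtain ⟨s, hs⟩ := h.fg_top
  obtain ⟨t, ht⟩ := (‹Module.Finite Gᵐᵒᵖ M›).fg_top
  let V₁ : Submodule Fᵐᵒᵖ V := Submodule.span _ (fst '' (s : Set (RepModule β)))
  let W₁ : Submodule Gᵐᵒᵖ W := Submodule.span _ (snd '' (s : Set (RepModule β)) ∪
    Set.image2 (fun n m => β.toFun (fst n) m) (s : Set (RepModule β)) (t : Set M))
  -- The span of `s` in `V`, together with the span of `s` and `β(s, t)` in `W`, is a submodule.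
  have hsm : ∀ n ∈ s, ∀ m : M, β.toFun n.fst m ∈ W₁ := by
    intro n hn m
    have hm : m ∈ Submodule.span Gᵐᵒᵖ (t : Set M) := ht.ge Submodule.mem_top
    induction hm using Submodule.span_induction with
    | mem x hx => exact Submodule.subset_span (Or.inr ⟨n, hn, x, hx, rfl⟩)
    | zero => simp
    | add x y _ _ hx hy => rw [map_add]; exact W₁.add_mem hx hy
    | smul g x _ hx =>
      have := β.map_op_smul g.unop n.fst x
      rw [op_unop] at this
      rw [this]; exact W₁.smul_mem _ hx
  have hVW : ∀ v ∈ V₁, ∀ m, β.toFun v m ∈ W₁ := by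
    intro v hv
    induction hv using Submodule.span_induction with
    | mem x hx => obtain ⟨n, hn, rfl⟩ := hx; exact hsm n hn
    | zero => simp
    | add x y _ _ hx hy =>
      intro m; rw [map_add, AddMonoidHom.add_apply]; exact W₁.add_mem (hx m) (hy m)
    | smul f x _ hx =>
      intro m
      have := β.balanced f.unop x m
      rw [op_unop] at this
      rw [this]; exact hx _
  have htop : subrep V₁ W₁ hVW = ⊤ := by
    rw [eq_top_iff, ← hs, Submodule.span_le]
    exact fun n hn => ⟨Submodule.subset_span ⟨n, hn, rfl⟩,
      Submodule.subset_span (Or.inl ⟨n, hn, rfl⟩)⟩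
  have hV : V₁ = ⊤ := eq_top_iff.2 fun v _ =>
    (htop.ge (Submodule.mem_top (x := mk v 0)) : mk v 0 ∈ subrep V₁ W₁ hVW).1
  have hW : W₁ = ⊤ := eq_top_iff.2 fun w _ =>
    (htop.ge (Submodule.mem_top (x := mk 0 w)) : mk 0 w ∈ subrep V₁ W₁ hVW).2
  refine ⟨⟨hV ▸ Submodule.fg_span ((s.finite_toSet).image _)⟩,
    ⟨hW ▸ Submodule.fg_span (((s.finite_toSet).image _).union
      (s.finite_toSet.image2 _ t.finite_toSet))⟩⟩

end RepModule

/-! ### Every module comes from a representation -/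

section OfModule

variable (F G M) (N : Type*) [AddCommGroup N] [Module (TriangularRing F M G)ᵐᵒᵖ N]

/-- The Peirce component `N e₁` of a right module `N`. -/
def peirceLeft : AddSubgroup N where
  carrier := {n | (op ⟨1, 0, 0⟩ : (TriangularRing F M G)ᵐᵒᵖ) • n = n}
  zero_mem' := smul_zero _
  add_mem' {a b} ha hb := by
    rw [Set.mem_ofPred_eq] at *; rw [smul_add, ha, hb]
  neg_mem' {a} ha := by rw [Set.mem_ofPred_eq] at *; rw [smul_neg, ha]

/-- The Peirce component `N e₂` of a right module `N`. -/
def peirceRight : AddSubgroup N where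
  carrier := {n | (op ⟨0, 0, 1⟩ : (TriangularRing F M G)ᵐᵒᵖ) • n = n}
  zero_mem' := smul_zero _
  add_mem' {a b} ha hb := by
    rw [Set.mem_ofPred_eq] at *; rw [smul_add, ha, hb]
  neg_mem' {a} ha := by rw [Set.mem_ofPred_eq] at *; rw [smul_neg, ha]

variable {F G M N}

theorem mem_peirceLeft {n : N} : n ∈ peirceLeft F G M N ↔
    (op ⟨1, 0, 0⟩ : (TriangularRing F M G)ᵐᵒᵖ) • n = n := Iff.rfl

theorem mem_peirceRight {n : N} : n ∈ peirceRight F G M N ↔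
    (op ⟨0, 0, 1⟩ : (TriangularRing F M G)ᵐᵒᵖ) • n = n := Iff.rfl

instance : Module Fᵐᵒᵖ (peirceLeft F G M N) where
  smul f n := ⟨(op ⟨f.unop, 0, 0⟩ : (TriangularRing F M G)ᵐᵒᵖ) • (n : N), by
    rw [mem_peirceLeft, ← mul_smul]; congr 1; apply unop_injective; ext <;> simp⟩
  one_smul n := Subtype.ext n.2
  mul_smul f f' n := Subtype.ext (by
    change (op _ : (TriangularRing F M G)ᵐᵒᵖ) • (n : N) = op _ • op _ • (n : N)
    rw [← mul_smul]; congr 1; apply unop_injective; ext <;> simp)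
  smul_zero f := Subtype.ext (smul_zero _)
  smul_add f n n' := Subtype.ext (smul_add _ _ _)
  add_smul f f' n := Subtype.ext (by
    change (op _ : (TriangularRing F M G)ᵐᵒᵖ) • (n : N) = op _ • (n : N) + op _ • (n : N)
    rw [← add_smul]; congr 1; apply unop_injective; ext <;> simp)
  zero_smul n := Subtype.ext (by
    change (op _ : (TriangularRing F M G)ᵐᵒᵖ) • (n : N) = 0
    rw [← zero_smul (TriangularRing F M G)ᵐᵒᵖ (n : N)]; rfl)

instance : Module Gᵐᵒᵖ (peirceRight F G M N) where
  smul g n := ⟨(op ⟨0, 0, g.unop⟩ : (TriangularRing F M G)ᵐᵒᵖ) • (n : N), by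
    rw [mem_peirceRight, ← mul_smul]; congr 1; apply unop_injective; ext <;> simp⟩
  one_smul n := Subtype.ext n.2
  mul_smul f f' n := Subtype.ext (by
    change (op _ : (TriangularRing F M G)ᵐᵒᵖ) • (n : N) = op _ • op _ • (n : N)
    rw [← mul_smul]; congr 1; apply unop_injective; ext <;> simp)
  smul_zero f := Subtype.ext (smul_zero _)
  smul_add f n n' := Subtype.ext (smul_add _ _ _)
  add_smul f f' n := Subtype.ext (by
    change (op _ : (TriangularRing F M G)ᵐᵒᵖ) • (n : N) = op _ • (n : N) + op _ • (n : N)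
    rw [← add_smul]; congr 1; apply unop_injective; ext <;> simp)
  zero_smul n := Subtype.ext (by
    change (op _ : (TriangularRing F M G)ᵐᵒᵖ) • (n : N) = 0
    rw [← zero_smul (TriangularRing F M G)ᵐᵒᵖ (n : N)]; rfl)

variable (F G M N)

/-- The action of the upper right entries `M`, as a balanced map `N e₁ × M → N e₂`. -/
def peirceMap : BalancedMap F G M (peirceLeft F G M N) (peirceRight F G M N) where
  toFun := AddMonoidHom.mk' (fun v => AddMonoidHom.mk'
      (fun m => ⟨(op ⟨0, m, 0⟩ : (TriangularRing F M G)ᵐᵒᵖ) • (v : N), by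
        rw [mem_peirceRight, ← mul_smul]; congr 1; apply unop_injective; ext <;> simp⟩)
      fun m m' => Subtype.ext (by
        change (op _ : (TriangularRing F M G)ᵐᵒᵖ) • (v : N) = op _ • (v : N) + op _ • (v : N)
        rw [← add_smul]; congr 1; apply unop_injective; ext <;> simp))
    fun v v' => by ext m; exact smul_add _ _ _
  balanced f v m := Subtype.ext (by
    change (op _ : (TriangularRing F M G)ᵐᵒᵖ) • (op _ : (TriangularRing F M G)ᵐᵒᵖ) • (v : N)
      = op _ • (v : N)
    rw [← mul_smul]; congr 1; apply unop_injective; ext <;> simp)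
  map_op_smul g v m := Subtype.ext (by
    change (op _ : (TriangularRing F M G)ᵐᵒᵖ) • (v : N)
      = (op _ : (TriangularRing F M G)ᵐᵒᵖ) • op _ • (v : N)
    rw [← mul_smul]; congr 1; apply unop_injective; ext <;> simp)

/-- The Peirce decomposition identifies a module with the module of its representation. -/
def peirceEquiv : N ≃ₗ[(TriangularRing F M G)ᵐᵒᵖ] RepModule (peirceMap F G M N) := by
  have key : ∀ n : N, (op ⟨1, 0, 0⟩ : (TriangularRing F M G)ᵐᵒᵖ) • n +
      (op ⟨0, 0, 1⟩ : (TriangularRing F M G)ᵐᵒᵖ) • n = n := fun n => by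
    rw [← add_smul]
    conv_rhs => rw [← one_smul (TriangularRing F M G)ᵐᵒᵖ n]
    congr 1; apply unop_injective; ext <;> simp
  refine LinearEquiv.symm
    { toFun n := (n.fst : N) + (n.snd : N)
      map_add' n n' := ?_
      map_smul' r n := ?_
      invFun n := RepModule.mk ⟨(op ⟨1, 0, 0⟩ : (TriangularRing F M G)ᵐᵒᵖ) • n, ?_⟩
        ⟨(op ⟨0, 0, 1⟩ : (TriangularRing F M G)ᵐᵒᵖ) • n, ?_⟩
      left_inv n := ?_
      right_inv n := key n }
  · simp; abel
  · have h1 := mem_peirceLeft.1 n.fst.2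
    have h2 := mem_peirceRight.1 n.snd.2
    change (op _ : (TriangularRing F M G)ᵐᵒᵖ) • (n.fst : N) +
      ((op _ : (TriangularRing F M G)ᵐᵒᵖ) • (n.fst : N) +
       (op _ : (TriangularRing F M G)ᵐᵒᵖ) • (n.snd : N)) = r • _
    rw [smul_add]
    conv_rhs => rw [← h1, ← h2]
    rw [← add_assoc, ← add_smul, ← mul_smul, ← mul_smul]
    congr 2 <;> apply unop_injective <;> ext <;> simp
  · rw [mem_peirceLeft, ← mul_smul]; congr 1; apply unop_injective; ext <;> simp
  · rw [mem_peirceRight, ← mul_smul]; congr 1; apply unop_injective; ext <;> simp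
  · have h1 := mem_peirceLeft.1 n.fst.2
    have h2 := mem_peirceRight.1 n.snd.2
    ext
    · change (op _ : (TriangularRing F M G)ᵐᵒᵖ) • ((n.fst : N) + (n.snd : N)) = _
      rw [smul_add, h1, ← h2, ← mul_smul, add_eq_left]
      convert zero_smul (TriangularRing F M G)ᵐᵒᵖ _
      apply unop_injective; ext <;> simp
    · change (op _ : (TriangularRing F M G)ᵐᵒᵖ) • ((n.fst : N) + (n.snd : N)) = _
      rw [smul_add, h2, ← h1, ← mul_smul, add_eq_right]
      convert zero_smul (TriangularRing F M G)ᵐᵒᵖ _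
      apply unop_injective; ext <;> simp

end OfModule

end RepModule

theorem IsIndecomposableModule.congr {A N N' : Type*} [Ring A] [AddCommGroup N] [Module A N]
    [AddCommGroup N'] [Module A N'] (e : N ≃ₗ[A] N') (h : IsIndecomposableModule A N) :
    IsIndecomposableModule A N' := by
  have := h.1
  refine ⟨e.symm.toEquiv.nontrivial, fun p q hpq => ?_⟩
  let o := Submodule.orderIsoMapComap e
  have := h.2 (o.symm p) (o.symm q) (o.symm.isCompl hpq)
  simpa using this

/-! ### Additivity of composition multiplicities -/

section Multiplicity

variable {A : Type*} [Ring A] {N P S : Type*} [AddCommGroup N] [Module A N] [AddCommGroup P]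
  [Module A P] [AddCommGroup S] [Module A S]

/-- The factor `C / B` of two submodules `B`, `C` (meaningful for `B ≤ C`). -/
abbrev Submodule.factorModule (B C : Submodule A N) : Type _ := C ⧸ B.comap C.subtype

theorem nonempty_factor_equiv_map (f : P →ₗ[A] N) (hf : Function.Injective f)
    (B C : Submodule A P) :
    Nonempty (B.factorModule C ≃ₗ[A] (B.map f).factorModule (C.map f)) := by
  refine ⟨Submodule.Quotient.equiv _ _ (C.equivMapOfInjective f hf) ?_⟩
  ext ⟨x, hx⟩
  simp only [Submodule.mem_map, Submodule.mem_comap, Submodule.subtype_apply]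
  constructor
  · rintro ⟨y, hy, h⟩
    exact ⟨y, hy, by simpa using congrArg Subtype.val h⟩
  · rintro ⟨y, hy, h⟩
    obtain ⟨z, hz, rfl⟩ := hx
    obtain rfl := hf h
    exact ⟨⟨y, hz⟩, hy, by ext; simp⟩

theorem nonempty_factor_equiv_comap (g : N →ₗ[A] P) (hg : Function.Surjective g)
    (B C : Submodule A P) :
    Nonempty (B.factorModule C ≃ₗ[A] (B.comap g).factorModule (C.comap g)) := by
  let h : C.comap g →ₗ[A] B.factorModule C :=
    (B.comap C.subtype).mkQ ∘ₗ g.restrict (p := C.comap g) (q := C) fun x hx => hx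
  have hs : Function.Surjective h := by
    intro x
    obtain ⟨⟨y, hy⟩, rfl⟩ := Submodule.mkQ_surjective _ x
    obtain ⟨z, rfl⟩ := hg y
    exact ⟨⟨z, hy⟩, rfl⟩
  have hk : h.ker = (B.comap g).comap (C.comap g).subtype := by
    ext x
    simp only [h, LinearMap.mem_ker, LinearMap.comp_apply, Submodule.mkQ_apply,
      Submodule.Quotient.mk_eq_zero]
    rfl
  exact ⟨((Submodule.quotEquivOfEq _ _ hk.symm).trans (h.quotKerEquivOfSurjective hs)).symm⟩

/-- Transport of a composition series along a map of submodule lattices that preserves the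
factors. -/
theorem exists_compositionSeries_map (s : CompositionSeries (Submodule A P))
    (φ : Submodule A P → Submodule A N) (hφ : Monotone φ)
    (h : ∀ B C, Nonempty (B.factorModule C ≃ₗ[A] (φ B).factorModule (φ C))) :
    ∃ t : CompositionSeries (Submodule A N), t.head = φ s.head ∧ t.last = φ s.last ∧
      factorCount t S = factorCount s S := by
  refine ⟨⟨s.length, fun i => φ (s i), fun i => ?_⟩, rfl, rfl, ?_⟩
  · have hs : s i.castSucc ⋖ s i.succ := s.step i
    obtain ⟨e⟩ := h (s i.castSucc) (s i.succ)
    have := (covBy_iff_quot_is_simple hs.le).1 hs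
    exact (covBy_iff_quot_is_simple (hφ hs.le)).2 (IsSimpleModule.congr e.symm)
  · refine Nat.card_congr (Equiv.subtypeEquivRight fun i => ?_)
    obtain ⟨e⟩ := h (s i.castSucc) (s i.succ)
    exact ⟨fun ⟨g⟩ => ⟨g.trans e.symm⟩, fun ⟨g⟩ => ⟨g.trans e⟩⟩

theorem factorCount_smash (s t : CompositionSeries (Submodule A N)) (h : s.last = t.head) :
    factorCount (s.smash t h) S = factorCount s S + factorCount t S := by
  classical
  unfold factorCount
  rw [← Nat.card_sum]
  have e1 := (finSumFinEquiv (m := s.length) (n := t.length)).subtypeEquivOfSubtype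
    (p := fun i => Nonempty (S ≃ₗ[A] ((s.smash t h) i.succ ⧸
      ((s.smash t h) i.castSucc).comap ((s.smash t h) i.succ).subtype)))
  refine (Nat.card_congr e1).symm.trans ((Nat.card_congr (Equiv.subtypeSum)).trans ?_)
  refine Nat.card_congr (Equiv.sumCongr (Equiv.subtypeEquivRight fun i => ?_)
    (Equiv.subtypeEquivRight fun i => ?_))
  · rw [finSumFinEquiv_apply_left, RelSeries.smash_castAdd, RelSeries.smash_succ_castAdd]
  · rw [finSumFinEquiv_apply_right, RelSeries.smash_natAdd, RelSeries.smash_succ_natAdd]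

/-- Multiplicities are additive: a composition series of `Q` is followed by the preimage of one of
`N / Q`. -/
theorem compositionMultiplicity_eq_add (hN : IsFiniteLength A N) (Q : Submodule A N) :
    compositionMultiplicity A S N =
      compositionMultiplicity A S Q + compositionMultiplicity A S (N ⧸ Q) := by
  obtain ⟨s, hs, hs'⟩ := isFiniteLength_iff_exists_compositionSeries.1
    (hN.of_injective Q.injective_subtype)
  obtain ⟨t, ht, ht'⟩ := isFiniteLength_iff_exists_compositionSeries.1
    (hN.of_surjective Q.mkQ_surjective)
  obtain ⟨s₁, h1, h2, h3⟩ := exists_compositionSeries_map (S := S) s (Submodule.map Q.subtype)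
    (fun _ _ => Submodule.map_mono) (nonempty_factor_equiv_map _ Q.injective_subtype)
  obtain ⟨t₁, k1, k2, k3⟩ := exists_compositionSeries_map (S := S) t (Submodule.comap Q.mkQ)
    (fun _ _ => Submodule.comap_mono) (nonempty_factor_equiv_comap _ Q.mkQ_surjective)
  have h : s₁.last = t₁.head := by
    rw [h2, k1, hs', ht, Submodule.map_top, Submodule.range_subtype]
    exact (Submodule.ker_mkQ Q).symm
  rw [compositionMultiplicity_eq_factorCount s hs hs',
    compositionMultiplicity_eq_factorCount t ht ht', ← h3, ← k3,
    ← factorCount_smash s₁ t₁ h, compositionMultiplicity_eq_factorCount]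
  · rw [RelSeries.head_smash, h1, hs, Submodule.map_bot]
  · rw [RelSeries.last_smash, k2, ht', Submodule.comap_top]

theorem compositionMultiplicity_congr (hN : IsFiniteLength A N) (e : N ≃ₗ[A] P) :
    compositionMultiplicity A S N = compositionMultiplicity A S P := by
  obtain ⟨s, hs, hs'⟩ := isFiniteLength_iff_exists_compositionSeries.1 hN
  obtain ⟨t, h1, h2, h3⟩ := exists_compositionSeries_map (S := S) s
    (Submodule.map (e : N →ₗ[A] P))
    (fun _ _ => Submodule.map_mono) (nonempty_factor_equiv_map _ e.injective)
  rw [compositionMultiplicity_eq_factorCount s hs hs', ← h3, compositionMultiplicity_eq_factorCount]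
  · rw [h1, hs, Submodule.map_bot]
  · rw [h2, hs', Submodule.map_top, LinearMap.range_eq_top]; exact e.surjective

theorem compositionMultiplicity_eq_zero_of_subsingleton [Subsingleton N] :
    compositionMultiplicity A S N = 0 := by
  rw [compositionMultiplicity_eq_factorCount (RelSeries.singleton _ ⊥) rfl (Subsingleton.elim _ _)]
  unfold factorCount
  have : IsEmpty (Fin (RelSeries.singleton
    {(a, b) : Submodule A N × Submodule A N | JordanHolderLattice.IsMaximal a b} ⊥).length) :=
    Fin.isEmpty'
  exact Nat.card_of_isEmpty

open Classical in
theorem compositionMultiplicity_of_isSimpleModule [hN : IsSimpleModule A N] :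
    compositionMultiplicity A S N = if Nonempty (S ≃ₗ[A] N) then 1 else 0 := by
  have hN' : IsFiniteLength A N := isFiniteLength_iff_isNoetherian_isArtinian.2
    ⟨inferInstance, inferInstance⟩
  let s : CompositionSeries (Submodule A N) := ⟨1, ![⊥, ⊤], fun i => by
    fin_cases i
    exact bot_covBy_top⟩
  rw [compositionMultiplicity_eq_factorCount s rfl rfl]
  have e : N ≃ₗ[A] (⊥ : Submodule A N).factorModule ⊤ :=
    (Submodule.topEquiv.symm).trans (Submodule.quotEquivOfEqBot _ (by simp)).symm
  have key : ∀ i : Fin s.length,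
      Nonempty (S ≃ₗ[A] (s i.succ ⧸ (s i.castSucc).comap (s i.succ).subtype)) ↔
        Nonempty (S ≃ₗ[A] N) := by
    intro i
    change Fin 1 at i
    fin_cases i
    exact ⟨fun ⟨g⟩ => ⟨g.trans e.symm⟩, fun ⟨g⟩ => ⟨g.trans e⟩⟩
  unfold factorCount
  rw [Nat.card_congr (Equiv.subtypeEquivRight key)]
  change Nat.card {i : Fin 1 // Nonempty (S ≃ₗ[A] N)} = _
  split_ifs with h
  · rw [Nat.card_congr (Equiv.subtypeUnivEquiv fun _ => h)]; simp
  · have : IsEmpty {i : Fin 1 // Nonempty (S ≃ₗ[A] N)} := ⟨fun x => h x.2⟩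
    exact Nat.card_of_isEmpty

/-- The multiplicity in a power, by induction along the sequence
`0 → T → T^(n+1) → T^n → 0`. -/
theorem compositionMultiplicity_pi {ι : Type*} [Finite ι] (T : Type*) [AddCommGroup T] [Module A T]
    (hT : IsFiniteLength A T) :
    compositionMultiplicity A S (ι → T) = Nat.card ι * compositionMultiplicity A S T := by
  have hfl : ∀ n : ℕ, IsFiniteLength A (Fin n → T) := by
    intro n
    obtain ⟨_, _⟩ := isFiniteLength_iff_isNoetherian_isArtinian.1 hT
    exact isFiniteLength_iff_isNoetherian_isArtinian.2 ⟨inferInstance, inferInstance⟩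
  have key : ∀ n : ℕ, compositionMultiplicity A S (Fin n → T) =
      n * compositionMultiplicity A S T := by
    intro n
    induction n with
    | zero => rw [compositionMultiplicity_eq_zero_of_subsingleton]; simp
    | succ n ih =>
      let g : (Fin (n + 1) → T) →ₗ[A] (Fin n → T) := LinearMap.funLeft A T Fin.succ
      have hg : Function.Surjective g := fun x =>
        ⟨Fin.cons 0 x, by ext; simp [g, LinearMap.funLeft]⟩
      let k : T ≃ₗ[A] g.ker :=
        { toFun x := ⟨Fin.cons x 0, by ext; simp [g, LinearMap.funLeft]⟩
          map_add' x y := by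
            ext i; refine Fin.cases ?_ (fun i => ?_) i <;> simp
          map_smul' x y := by
            ext i; refine Fin.cases ?_ (fun i => ?_) i <;> simp
          invFun x := x.1 0
          left_inv x := by simp
          right_inv x := by
            ext i
            refine Fin.cases ?_ (fun i => ?_) i
            · simp
            · have := congrFun x.2 i
              simpa [g, LinearMap.funLeft] using this.symm }
      rw [compositionMultiplicity_eq_add (hfl _) g.ker,
        compositionMultiplicity_congr ((hfl _).of_surjective g.ker.mkQ_surjective)
          (g.quotKerEquivOfSurjective hg), ih,
        ← compositionMultiplicity_congr hT k]
      ring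
  rw [← key, compositionMultiplicity_congr _
    (LinearEquiv.funCongrLeft A T (Finite.equivFin ι)).symm]
  obtain ⟨_, _⟩ := isFiniteLength_iff_isNoetherian_isArtinian.1 hT
  exact isFiniteLength_iff_isNoetherian_isArtinian.2 ⟨inferInstance, inferInstance⟩

end Multiplicity

/-! ### The composition factors of the module of a representation -/

section SimpleModules

variable (F G M : Type*) [DivisionRing F] [DivisionRing G] [AddCommGroup M] [Module F M]
  [Module Gᵐᵒᵖ M] [SMulCommClass F Gᵐᵒᵖ M]

/-- The zero balanced map. -/
instance {V W : Type*} [AddCommGroup V] [Module Fᵐᵒᵖ V] [AddCommGroup W] [Module Gᵐᵒᵖ W] :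
    Zero (BalancedMap F G M V W) :=
  ⟨⟨0, fun _ _ _ => rfl, fun _ _ _ => (smul_zero _).symm⟩⟩

@[simp] theorem BalancedMap.zero_apply {V W : Type*} [AddCommGroup V] [Module Fᵐᵒᵖ V]
    [AddCommGroup W] [Module Gᵐᵒᵖ W] (v : V) (m : M) :
    (0 : BalancedMap F G M V W).toFun v m = 0 := rfl

/-- The simple right module over the triangular ring on which only `F` acts. -/
abbrev LeftSimple : Type _ := RepModule (0 : BalancedMap F G M F PUnit.{1})

/-- The simple right module over the triangular ring on which only `G` acts. -/
abbrev RightSimple : Type _ := RepModule (0 : BalancedMap F G M PUnit.{1} G)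

instance : IsSimpleModule (TriangularRing F M G)ᵐᵒᵖ (LeftSimple F G M) := by
  rw [isSimpleModule_iff_toSpanSingleton_surjective]
  refine ⟨⟨RepModule.mk 1 0, 0, fun h => one_ne_zero (congrArg RepModule.fst h)⟩,
    fun x hx y => ⟨op ⟨x.fst⁻¹ * y.fst, 0, 0⟩, ?_⟩⟩
  have hx : x.fst ≠ 0 := fun h => hx (RepModule.ext h rfl)
  exact RepModule.ext (mul_inv_cancel_left₀ hx y.fst) rfl

instance : IsSimpleModule (TriangularRing F M G)ᵐᵒᵖ (RightSimple F G M) := by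
  rw [isSimpleModule_iff_toSpanSingleton_surjective]
  refine ⟨⟨RepModule.mk 0 1, 0, fun h => one_ne_zero (congrArg RepModule.snd h)⟩,
    fun x hx y => ⟨op ⟨0, 0, x.snd⁻¹ * y.snd⟩, ?_⟩⟩
  have hx : x.snd ≠ 0 := fun h => hx (RepModule.ext rfl h)
  exact RepModule.ext rfl (by simp [hx])

theorem isEmpty_leftSimple_equiv_rightSimple :
    IsEmpty (LeftSimple F G M ≃ₗ[(TriangularRing F M G)ᵐᵒᵖ] RightSimple F G M) := by
  refine ⟨fun e => one_ne_zero (α := G) ?_⟩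
  have h := RepModule.map_eq e.symm.toLinearMap (RepModule.mk 0 1)
  rw [RepModule.fst_mk, map_zero] at h
  have h' : e.symm (RepModule.mk 0 1) = 0 := h
  rw [LinearEquiv.map_eq_zero_iff] at h'
  exact congrArg RepModule.snd h'

variable {F G M}
variable {V W : Type*} [AddCommGroup V] [Module Fᵐᵒᵖ V] [AddCommGroup W] [Module Gᵐᵒᵖ W]

/-- The submodule `W` of `V ⊕ W`. -/
def RepModule.rightPart (β : BalancedMap F G M V W) :
    Submodule (TriangularRing F M G)ᵐᵒᵖ (RepModule β) :=
  RepModule.subrep ⊥ ⊤ fun _ _ _ => Submodule.mem_top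

theorem RepModule.nonempty_rightPart_equiv (β : BalancedMap F G M V W)
    [Module.Finite Gᵐᵒᵖ W] :
    Nonempty (RepModule.rightPart β ≃ₗ[(TriangularRing F M G)ᵐᵒᵖ]
      (Fin (Module.finrank Gᵐᵒᵖ W) → RightSimple F G M)) := by
  let b := Module.finBasis Gᵐᵒᵖ W
  let g : RepModule.rightPart β →ₗ[(TriangularRing F M G)ᵐᵒᵖ]
      (Fin (Module.finrank Gᵐᵒᵖ W) → RightSimple F G M) :=
    { toFun x := fun i => RepModule.mk 0 (unop (b.repr x.1.snd i))
      map_add' x y := by ext i; simp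
      map_smul' r x := by
        have hx : x.1.fst = 0 := x.2.1
        ext i
        simp [hx] }
  refine ⟨LinearEquiv.ofBijective g ⟨?_, fun y => ?_⟩⟩
  · rw [injective_iff_map_eq_zero]
    intro x hx
    refine Subtype.ext (RepModule.ext x.2.1 ?_)
    refine (LinearEquiv.map_eq_zero_iff b.repr).1 (Finsupp.ext fun i => ?_)
    exact unop_injective (congrArg RepModule.snd (congrFun hx i))
  · let w := b.equivFun.symm fun i => op (y i).snd
    refine ⟨⟨RepModule.mk 0 w, ⟨Submodule.zero_mem _, trivial⟩⟩, ?_⟩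
    have : ∀ i, b.equivFun w i = op (y i).snd := fun i => by
      simp only [w, LinearEquiv.apply_symm_apply]
    ext i
    · exact congrArg unop (this i)

theorem RepModule.nonempty_quotient_equiv (β : BalancedMap F G M V W)
    [Module.Finite Fᵐᵒᵖ V] :
    Nonempty ((RepModule β ⧸ RepModule.rightPart β) ≃ₗ[(TriangularRing F M G)ᵐᵒᵖ]
      (Fin (Module.finrank Fᵐᵒᵖ V) → LeftSimple F G M)) := by
  let b := Module.finBasis Fᵐᵒᵖ V
  let g : RepModule β →ₗ[(TriangularRing F M G)ᵐᵒᵖ]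
      (Fin (Module.finrank Fᵐᵒᵖ V) → LeftSimple F G M) :=
    { toFun x := fun i => RepModule.mk (unop (b.repr x.fst i)) 0
      map_add' x y := by ext i; simp
      map_smul' r x := by ext i; simp }
  have hg : Function.Surjective g := by
    intro y
    let v := b.equivFun.symm fun i => op (y i).fst
    have : ∀ i, b.equivFun v i = op (y i).fst := fun i => by
      simp only [v, LinearEquiv.apply_symm_apply]
    refine ⟨RepModule.mk v 0, ?_⟩
    ext i
    · exact congrArg unop (this i)
  have hk : RepModule.rightPart β = g.ker := by
    ext x
    constructor
    · rintro ⟨hx, -⟩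
      rw [LinearMap.mem_ker]
      have hx : x.fst = 0 := hx
      ext i; simp [g, hx]
    · intro hx
      refine ⟨(LinearEquiv.map_eq_zero_iff b.repr).1 (Finsupp.ext fun i => ?_), trivial⟩
      exact unop_injective (congrArg RepModule.fst (congrFun hx i))
  exact ⟨(Submodule.quotEquivOfEq _ _ hk).trans (g.quotKerEquivOfSurjective hg)⟩

theorem RepModule.isFiniteLength (β : BalancedMap F G M V W)
    [Module.Finite Fᵐᵒᵖ V] [Module.Finite Gᵐᵒᵖ W] :
    IsFiniteLength (TriangularRing F M G)ᵐᵒᵖ (RepModule β) := by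
  obtain ⟨e⟩ := RepModule.nonempty_rightPart_equiv β
  obtain ⟨e'⟩ := RepModule.nonempty_quotient_equiv β
  rw [isFiniteLength_iff_isNoetherian_isArtinian]
  have := isNoetherian_of_linearEquiv e.symm
  have := isArtinian_of_linearEquiv e.symm
  have := isNoetherian_of_linearEquiv e'.symm
  have := isArtinian_of_linearEquiv e'.symm
  exact ⟨(isNoetherian_iff_submodule_quotient (RepModule.rightPart β)).2 ⟨‹_›, ‹_›⟩,
    (isArtinian_iff_submodule_quotient (RepModule.rightPart β)).2 ⟨‹_›, ‹_›⟩⟩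

/-- The submodule `W` is a power of one simple module, and the quotient `V` a power of the other. -/
theorem RepModule.compositionMultiplicity_eq (β : BalancedMap F G M V W)
    [Module.Finite Fᵐᵒᵖ V] [Module.Finite Gᵐᵒᵖ W] (S : Type*) [AddCommGroup S]
    [Module (TriangularRing F M G)ᵐᵒᵖ S] :
    compositionMultiplicity (TriangularRing F M G)ᵐᵒᵖ S (RepModule β) =
      Module.finrank Gᵐᵒᵖ W *
        compositionMultiplicity (TriangularRing F M G)ᵐᵒᵖ S (RightSimple F G M) +
      Module.finrank Fᵐᵒᵖ V *
        compositionMultiplicity (TriangularRing F M G)ᵐᵒᵖ S (LeftSimple F G M) := by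
  have hN := RepModule.isFiniteLength β
  obtain ⟨e⟩ := RepModule.nonempty_rightPart_equiv β
  obtain ⟨e'⟩ := RepModule.nonempty_quotient_equiv β
  have h1 : IsFiniteLength (TriangularRing F M G)ᵐᵒᵖ (RightSimple F G M) :=
    isFiniteLength_iff_isNoetherian_isArtinian.2 ⟨inferInstance, inferInstance⟩
  have h2 : IsFiniteLength (TriangularRing F M G)ᵐᵒᵖ (LeftSimple F G M) :=
    isFiniteLength_iff_isNoetherian_isArtinian.2 ⟨inferInstance, inferInstance⟩
  rw [compositionMultiplicity_eq_add hN (RepModule.rightPart β),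
    compositionMultiplicity_congr (hN.of_injective (Submodule.injective_subtype _)) e,
    compositionMultiplicity_congr (hN.of_surjective (Submodule.mkQ_surjective _)) e',
    compositionMultiplicity_pi _ h1, compositionMultiplicity_pi _ h2]
  simp

open Classical in
/-- The dimension vector of a representation is read off from the composition factors. -/
theorem RepModule.finrank_eq_of_multiplicity {V' W' : Type*} [AddCommGroup V'] [Module Fᵐᵒᵖ V']
    [AddCommGroup W'] [Module Gᵐᵒᵖ W'] (β : BalancedMap F G M V W) (β' : BalancedMap F G M V' W')
    [Module.Finite Fᵐᵒᵖ V] [Module.Finite Gᵐᵒᵖ W] [Module.Finite Fᵐᵒᵖ V'] [Module.Finite Gᵐᵒᵖ W']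
    {S T : Type*} [AddCommGroup S] [Module (TriangularRing F M G)ᵐᵒᵖ S] [AddCommGroup T]
    [Module (TriangularRing F M G)ᵐᵒᵖ T]
    (e : S ≃ₗ[(TriangularRing F M G)ᵐᵒᵖ] LeftSimple F G M)
    (e' : T ≃ₗ[(TriangularRing F M G)ᵐᵒᵖ] RightSimple F G M)
    (hS : compositionMultiplicity (TriangularRing F M G)ᵐᵒᵖ S (RepModule β) =
      compositionMultiplicity (TriangularRing F M G)ᵐᵒᵖ S (RepModule β'))
    (hT : compositionMultiplicity (TriangularRing F M G)ᵐᵒᵖ T (RepModule β) =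
      compositionMultiplicity (TriangularRing F M G)ᵐᵒᵖ T (RepModule β')) :
    Module.finrank Fᵐᵒᵖ V = Module.finrank Fᵐᵒᵖ V' ∧
      Module.finrank Gᵐᵒᵖ W = Module.finrank Gᵐᵒᵖ W' := by
  have hE := isEmpty_leftSimple_equiv_rightSimple F G M
  have h1 : ¬ Nonempty (S ≃ₗ[(TriangularRing F M G)ᵐᵒᵖ] RightSimple F G M) :=
    fun ⟨g⟩ => hE.false (e.symm.trans g)
  have h2 : ¬ Nonempty (T ≃ₗ[(TriangularRing F M G)ᵐᵒᵖ] LeftSimple F G M) :=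
    fun ⟨g⟩ => hE.false (g.symm.trans e')
  rw [RepModule.compositionMultiplicity_eq β, RepModule.compositionMultiplicity_eq β',
    compositionMultiplicity_of_isSimpleModule, compositionMultiplicity_of_isSimpleModule] at hS hT
  rw [if_neg h1, if_pos ⟨e⟩] at hS
  rw [if_neg h2, if_pos ⟨e'⟩] at hT
  simpa using And.intro hS hT

end SimpleModules

/-! ### Duality for an extension of division algebras -/

theorem LinearMap.exists_comp_eq_of_ker_le {E Z Q T : Type*} [DivisionRing E] [AddCommGroup Z]
    [Module E Z] [AddCommGroup Q] [Module E Q] [AddCommGroup T] [Module E T] (g : Z →ₗ[E] Q)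
    (f : Z →ₗ[E] T) (h : g.ker ≤ f.ker) : ∃ k : Q →ₗ[E] T, k ∘ₗ g = f := by
  obtain ⟨k, hk⟩ := LinearMap.exists_extend
    ((g.ker.liftQ f h) ∘ₗ g.quotKerEquivRange.symm.toLinearMap)
  refine ⟨k, LinearMap.ext fun z => ?_⟩
  have h1 := LinearMap.congr_fun hk ⟨g z, z, rfl⟩
  have h2 : g.quotKerEquivRange.symm ⟨g z, z, rfl⟩ = g.ker.mkQ z := by
    rw [LinearEquiv.symm_apply_eq]; rfl
  simpa [h2] using h1

section Extension

variable {K D E : Type*} [Field K] [DivisionRing D] [DivisionRing E] [Algebra K D] [Algebra K E]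
  [Module E D] [IsScalarTower K E D] [IsScalarTower E D D] [Module.Finite K D] [Module.Finite K E]

/-- Every `E`-linear functional on `D` is a translate of a given nonzero one: `w ↦ ρ(- w)` is an
injection `D → Hom_E(D, E)` of spaces of the same dimension over `K`. -/
theorem exists_forall_eq_apply_mul (K : Type*) {D E : Type*} [Field K] [DivisionRing D]
    [DivisionRing E] [Algebra K D] [Algebra K E] [Module E D] [IsScalarTower K E D]
    [IsScalarTower E D D] [Module.Finite K D] [Module.Finite K E]
    (ρ : D →ₗ[E] E) (hρ : ρ ≠ 0) (ψ : D →ₗ[E] E) :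
    ∃ w : D, ∀ x, ψ x = ρ (x * w) := by
  have := Module.Finite.of_restrictScalars_finite K E D
  let Θ : D →ₗ[K] (D →ₗ[E] E) :=
    { toFun w := { toFun x := ρ (x * w)
                   map_add' x y := by rw [add_mul, map_add]
                   map_smul' e x := by
                    rw [smul_mul_assoc, map_smul]; rfl }
      map_add' v w := by ext x; simp [mul_add]
      map_smul' k w := by
        ext x
        change ρ (x * (k • w)) = k • ρ (x * w)
        rw [mul_smul_comm]
        exact ρ.map_smul_of_tower k (x * w) }
  have hΘ : Function.Injective Θ := by
    rw [injective_iff_map_eq_zero]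
    intro w hw
    by_contra hw0
    apply hρ
    ext x
    have := LinearMap.congr_fun hw (x * w⁻¹)
    simpa [Θ, hw0] using this
  let b := Module.finBasis E D
  have e := (b.constr K (M' := E))
  have : Module.Finite K (D →ₗ[E] E) := Module.Finite.equiv e
  have hd : Module.finrank K D = Module.finrank K (D →ₗ[E] E) := by
    rw [← e.finrank_eq, Module.finrank_pi_fintype, Finset.sum_const, Finset.card_univ,
      Fintype.card_fin, smul_eq_mul, mul_comm, Module.finrank_mul_finrank]
  obtain ⟨w, hw⟩ := (LinearMap.injective_iff_surjective_of_finrank_eq_finrank hd).1 hΘ ψ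
  exact ⟨w, fun x => (LinearMap.congr_fun hw x).symm⟩

/-- Functionals over `E` on a `D`-space are induced by functionals over `D`: restriction of scalars
has the right adjoint `Hom_E(D, -)`, and `Hom_E(D, E)` is one-dimensional over `D`. -/
theorem exists_forall_eq_apply_comp (K : Type*) {D E : Type*} [Field K] [DivisionRing D]
    [DivisionRing E] [Algebra K D] [Algebra K E] [Module E D] [IsScalarTower K E D]
    [IsScalarTower E D D] [Module.Finite K D] [Module.Finite K E]
    {Y : Type*} [AddCommGroup Y] [Module D Y] [Module E Y] [IsScalarTower E D Y]
    [Module.Finite D Y] (ρ : D →ₗ[E] E) (hρ : ρ ≠ 0) (ψ : Y →ₗ[E] E) :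
    ∃ lam : Y →ₗ[D] D, ∀ y, ψ y = ρ (lam y) := by
  let b := Module.finBasis D Y
  have h : ∀ i, ∃ w : D, ∀ x, ψ (x • b i) = ρ (x * w) := fun i =>
    exists_forall_eq_apply_mul K ρ hρ
      { toFun x := ψ (x • b i)
        map_add' x y := by rw [add_smul, map_add]
        map_smul' e x := by rw [smul_assoc, map_smul]; rfl }
  choose w hw using h
  refine ⟨b.constr ℕ w, fun y => ?_⟩
  conv_lhs => rw [← b.sum_repr y]
  rw [map_sum, Module.Basis.constr_apply_fintype, map_sum]
  exact Finset.sum_congr rfl fun i _ => by rw [hw]; simp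

variable (K) in
/-- A basis `c` of `D` as a right `E`-space, together with its coordinate functionals `τ`. The
embedding `E → D` is `e ↦ e • 1`. -/
theorem exists_right_basis {n : ℕ} (hn : Module.finrank K D = n * Module.finrank K E) :
    ∃ (c : Fin n → D) (τ : Fin n → D →ₗ[K] E),
      (∀ x, ∑ j, c j * (τ j x • (1 : D)) = x) ∧ (∀ j x e, τ j (x * (e • (1 : D))) = τ j x * e) ∧
      ∀ j k, τ j (c k) = if k = j then 1 else 0 := by
  let m : Module Eᵐᵒᵖ D :=
    { smul e x := x * (e.unop • (1 : D))
      one_smul x := by change x * ((1 : E) • (1 : D)) = x; simp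
      mul_smul e f x := by
        change x * ((f.unop * e.unop) • (1 : D)) = x * (f.unop • (1 : D)) * (e.unop • (1 : D))
        rw [mul_smul, mul_assoc, smul_one_mul]
      smul_zero e := zero_mul _
      smul_add e x y := add_mul _ _ _
      add_smul e f x := by
        change x * ((e.unop + f.unop) • (1 : D)) = _
        rw [add_smul, mul_add]; rfl
      zero_smul x := by change x * ((0 : E) • (1 : D)) = 0; simp }
  have hsm : ∀ (e : E) (x : D), MulOpposite.op e • x = x * (e • (1 : D)) := fun e x => rfl
  have ht : IsScalarTower K Eᵐᵒᵖ D := ⟨fun k e x => by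
    obtain ⟨e, rfl⟩ := MulOpposite.op_surjective e
    rw [← MulOpposite.op_smul, hsm, hsm, smul_assoc, mul_smul_comm]⟩
  have hf : Module.Finite Eᵐᵒᵖ D := Module.Finite.of_restrictScalars_finite K Eᵐᵒᵖ D
  have hr : Module.finrank Eᵐᵒᵖ D = n := by
    have h1 := Module.finrank_mul_finrank K Eᵐᵒᵖ D
    have h2 : 0 < Module.finrank K E := Module.finrank_pos
    rw [MulOpposite.finrank, hn, mul_comm] at h1
    exact Nat.eq_of_mul_eq_mul_right h2 h1
  let b := Module.finBasisOfFinrankEq Eᵐᵒᵖ D hr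
  refine ⟨b, fun j =>
    { toFun x := (b.repr x j).unop
      map_add' x y := by simp
      map_smul' k x := ?_ }, fun x => ?_, fun j x e => ?_, fun j k => ?_⟩
  · rw [← algebraMap_smul Eᵐᵒᵖ k x, map_smul, Finsupp.smul_apply, algebraMap_smul]
    rfl
  · exact b.sum_repr x
  · change (b.repr (x * (e • (1 : D))) j).unop = _
    rw [← hsm, map_smul]
    rfl
  · change (b.repr (b k) j).unop = _
    rw [b.repr_self, Finsupp.single_apply]
    split_ifs <;> rfl

/-- The functionals `y ↦ τ_l (x y)`, for `x : D`, realize all values on a right basis. -/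
theorem exists_coord_mul_eq {n : ℕ} (hn : Module.finrank K D = n * Module.finrank K E)
    {c : Fin n → D} {τ : Fin n → D →ₗ[K] E}
    (h1 : ∀ x, ∑ j, c j * (τ j x • (1 : D)) = x)
    (h2 : ∀ j x e, τ j (x * (e • (1 : D))) = τ j x * e)
    (h3 : ∀ j k, τ j (c k) = if k = j then 1 else 0) (l : Fin n) (e : Fin n → E) :
    ∃ x : D, ∀ j, τ l (x * c j) = e j := by
  let Θ : D →ₗ[K] (Fin n → E) :=
    { toFun x j := τ l (x * c j)
      map_add' x y := by ext j; simp [add_mul]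
      map_smul' k x := by ext j; simp }
  have hΘ : Function.Injective Θ := by
    rw [injective_iff_map_eq_zero]
    intro x hx
    by_contra hx0
    have key : ∀ y, τ l (x * y) = 0 := by
      intro y
      rw [← h1 y, Finset.mul_sum, map_sum]
      refine Finset.sum_eq_zero fun j _ => ?_
      have : τ l (x * c j) = 0 := congrFun hx j
      rw [← mul_assoc, h2, this, zero_mul]
    have := key (x⁻¹ * c l)
    rw [mul_inv_cancel_left₀ hx0, h3, if_pos rfl] at this
    exact one_ne_zero this
  have hd : Module.finrank K D = Module.finrank K (Fin n → E) := by
    rw [hn, Module.finrank_pi_fintype, Finset.sum_const, Finset.card_univ, Fintype.card_fin,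
      smul_eq_mul]
  obtain ⟨x, hx⟩ := (LinearMap.injective_iff_surjective_of_finrank_eq_finrank hd).1 hΘ e
  exact ⟨x, fun j => congrFun hx j⟩

end Extension

/-! ### Subspaces over `E` in spaces over `D` -/

/-- Indecomposability of a pair consisting of a `D`-space `Y` and an `E`-subspace `Z`: `Y` is
nonzero and the only idempotent `D`-linear endomorphisms of `Y` that preserve `Z` are `0` and
`1`. -/
def IsIndecomposablePair (D : Type*) {E Y : Type*} [DivisionRing D] [DivisionRing E]
    [AddCommGroup Y] [Module D Y] [Module E Y] (Z : Submodule E Y) : Prop :=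
  Nontrivial Y ∧ ∀ π : Y →ₗ[D] Y, (∀ y, π (π y) = π y) → (∀ z ∈ Z, π z ∈ Z) →
    (∀ y, π y = 0) ∨ ∀ y, π y = y

/-- The scalars `d : D` with `d w ∈ Z`. -/
def Submodule.lineTrace (D : Type*) {E Y : Type*} [DivisionRing D] [DivisionRing E] [AddCommGroup Y]
    [Module D Y] [Module E Y] [Module E D] [IsScalarTower E D Y] (Z : Submodule E Y) (w : Y) :
    Submodule E D :=
  Z.comap ({ toFun d := d • w
             map_add' x y := add_smul x y w
             map_smul' e x := smul_assoc e x w } : D →ₗ[E] Y)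

theorem Submodule.mem_lineTrace {D E Y : Type*} [DivisionRing D] [DivisionRing E] [AddCommGroup Y]
    [Module D Y] [Module E Y] [Module E D] [IsScalarTower E D Y] {Z : Submodule E Y} {w : Y}
    {d : D} : d ∈ Z.lineTrace D w ↔ d • w ∈ Z := Iff.rfl

section Pair

variable {K D E : Type*} [Field K] [DivisionRing D] [DivisionRing E] [Algebra K D] [Algebra K E]
  [Module E D] [IsScalarTower K E D] [IsScalarTower E D D] [Module.Finite K D] [Module.Finite K E]
  {Y : Type*} [AddCommGroup Y] [Module D Y] [Module E Y] [IsScalarTower E D Y]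
  [Module.Finite D Y] {Z : Submodule E Y}

/-- A line that is a direct summand of an indecomposable pair is everything. -/
theorem IsIndecomposablePair.finrank_eq_one_of_retraction (hZ : IsIndecomposablePair D Z)
    (lam : Y →ₗ[D] D) (w : Y) (hw : lam w = 1) (h : ∀ z ∈ Z, lam z • w ∈ Z) :
    Module.finrank D Y = 1 := by
  have hw0 : w ≠ 0 := by rintro rfl; simp at hw
  rcases hZ.2 (lam.smulRight w) (fun y => by simp [hw]) (fun z hz => by simpa using h z hz)
    with h | h
  · exact absurd (by simpa [hw] using h w) hw0
  · exact finrank_eq_one w hw0 fun y => ⟨lam y, by simpa using h y⟩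

/-- A pair mapping onto the pair `E ≤ D` has this pair as a direct summand. -/
theorem IsIndecomposablePair.finrank_eq_one_of_quotient (hZ : IsIndecomposablePair D Z)
    (lam : Y →ₗ[D] D) (hlam : lam ≠ 0) (h : ∀ z ∈ Z, ∃ e : E, lam z = e • (1 : D)) :
    Module.finrank D Y = 1 := by
  by_cases h0 : ∀ z ∈ Z, lam z = 0
  · obtain ⟨y, hy⟩ : ∃ y, lam y ≠ 0 := by
      by_contra! hc
      exact hlam (LinearMap.ext hc)
    refine hZ.finrank_eq_one_of_retraction lam ((lam y)⁻¹ • y) (by simp [hy]) fun z hz => ?_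
    rw [h0 z hz, zero_smul]; exact Z.zero_mem
  · push Not at h0
    obtain ⟨z, hz, hz0⟩ := h0
    obtain ⟨e, he⟩ := h z hz
    have he0 : e ≠ 0 := by rintro rfl; simp [he] at hz0
    refine hZ.finrank_eq_one_of_retraction lam (e⁻¹ • z) ?_ fun z' hz' => ?_
    · rw [← smul_one_smul D e⁻¹ z, map_smul, he, smul_eq_mul, smul_one_mul, smul_smul,
        inv_mul_cancel₀ he0, one_smul]
    · obtain ⟨e', he'⟩ := h z' hz'
      rw [he', smul_one_smul]
      exact Z.smul_mem _ (Z.smul_mem _ hz)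

/-- A proper subspace of codimension at most one is the kernel of a functional. -/
theorem exists_forall_mem_iff_eq_zero [Module.Finite E D] {P : Submodule E D} (hP : P ≠ ⊤)
    (h : Module.finrank E D ≤ Module.finrank E P + 1) :
    ∃ ρ : D →ₗ[E] E, ρ ≠ 0 ∧ ∀ d, d ∈ P ↔ ρ d = 0 := by
  obtain ⟨ρ, hρ, hle⟩ := P.exists_le_ker_of_lt_top hP.lt_top
  refine ⟨ρ, hρ, fun d => ?_⟩
  have hlt : Module.finrank E ρ.ker < Module.finrank E D :=
    Submodule.finrank_lt (fun h => hρ (LinearMap.ker_eq_top.1 h))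
  have : P = ρ.ker := Submodule.eq_of_le_of_finrank_le hle (by omega)
  rw [this, LinearMap.mem_ker]

/-- A line meeting `Z` in codimension at most one is a direct summand. -/
theorem IsIndecomposablePair.finrank_eq_one_of_lineTrace (K : Type*) {D E : Type*} [Field K]
    [DivisionRing D] [DivisionRing E] [Algebra K D] [Algebra K E] [Module E D] [IsScalarTower K E D]
    [IsScalarTower E D D] [Module.Finite K D] [Module.Finite K E]
    {Y : Type*} [AddCommGroup Y] [Module D Y] [Module E Y] [IsScalarTower E D Y]
    [Module.Finite D Y] {Z : Submodule E Y} (hZ : IsIndecomposablePair D Z)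
    {w : Y} (hw : w ≠ 0) (h : Module.finrank E D ≤ Module.finrank E (Z.lineTrace D w) + 1) :
    Module.finrank D Y = 1 := by
  have hfin := Module.Finite.of_restrictScalars_finite K E D
  obtain ⟨lam₀, hlam₀⟩ := (LinearMap.toSpanSingleton D Y w).exists_leftInverse_of_injective
    (LinearMap.ker_toSpanSingleton D hw)
  have hw1 : lam₀ w = 1 := by simpa using LinearMap.congr_fun hlam₀ 1
  by_cases htop : Z.lineTrace D w = ⊤
  · exact hZ.finrank_eq_one_of_retraction lam₀ w hw1 fun z _ =>
      htop.ge (Submodule.mem_top (x := lam₀ z))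
  obtain ⟨ρ, hρ, hker⟩ := exists_forall_mem_iff_eq_zero htop h
  -- The functional `ρ ∘ lam₀` on `Z` kills `Z ∩ D w`, hence factors through `Y / D w`; it is then
  -- corrected to zero by a `D`-linear functional vanishing on `w`.
  let lE : Y →ₗ[E] D := lam₀.restrictScalars E
  let ℓ : Submodule E Y := (Submodule.span D {w}).restrictScalars E
  obtain ⟨ψ, hψ⟩ := LinearMap.exists_comp_eq_of_ker_le (ℓ.mkQ ∘ₗ Z.subtype)
    (ρ ∘ₗ lE ∘ₗ Z.subtype) (by
      intro z hz
      have hz : (z : Y) ∈ ℓ := by simpa using hz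
      obtain ⟨d, hd⟩ := Submodule.mem_span_singleton.1 hz
      have hd' : d ∈ Z.lineTrace D w := by rw [Submodule.mem_lineTrace, hd]; exact z.2
      simp only [LinearMap.mem_ker, LinearMap.comp_apply, Submodule.subtype_apply, lE,
        LinearMap.restrictScalars_apply]
      rw [← hd, map_smul, hw1, smul_eq_mul, mul_one]
      exact (hker d).1 hd')
  obtain ⟨lam₁, hlam₁⟩ := exists_forall_eq_apply_comp K ρ hρ (ψ ∘ₗ ℓ.mkQ)
  have hw0 : lam₁ w = 0 := by
    by_contra hne
    apply hρ
    ext x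
    have h1 := hlam₁ ((x * (lam₁ w)⁻¹) • w)
    rw [map_smul lam₁, smul_eq_mul, inv_mul_cancel_right₀ hne] at h1
    have : (x * (lam₁ w)⁻¹) • w ∈ ℓ := Submodule.mem_span_singleton.2 ⟨_, rfl⟩
    rw [LinearMap.zero_apply, ← h1, LinearMap.comp_apply, Submodule.mkQ_apply,
      (Submodule.Quotient.mk_eq_zero ℓ).2 this, map_zero]
  refine hZ.finrank_eq_one_of_retraction (lam₀ - lam₁) w (by simp [hw1, hw0]) fun z hz => ?_
  refine (hker _).2 ?_
  have h1 := LinearMap.congr_fun hψ ⟨z, hz⟩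
  have h2 := hlam₁ z
  simp only [LinearMap.comp_apply, Submodule.subtype_apply] at h1 h2
  rw [LinearMap.sub_apply, map_sub, ← h2, h1]
  exact sub_self _

/-- The pairs `(Y, Z)` and `(Y', Z')` are isomorphic: some `D`-linear isomorphism maps `Z` onto
`Z'`. -/
def PairIso (D : Type*) {E Y Y' : Type*} [DivisionRing D] [DivisionRing E] [AddCommGroup Y]
    [Module D Y] [Module E Y] [AddCommGroup Y'] [Module D Y'] [Module E Y'] (Z : Submodule E Y)
    (Z' : Submodule E Y') : Prop :=
  ∃ e : Y ≃ₗ[D] Y', ∀ y, y ∈ Z ↔ e y ∈ Z'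

/-- Over a one-dimensional space the dimension of `Z` determines the pair. As the index is at most
three, `Z` is zero, a line, a hyperplane or everything; lines are moved to each other by right
multiplication, and so are hyperplanes, by duality. -/
theorem pairIso_of_finrank_eq_one (K : Type*) {D E : Type*} [Field K]
    [DivisionRing D] [DivisionRing E] [Algebra K D] [Algebra K E] [Module E D] [IsScalarTower K E D]
    [IsScalarTower E D D] [Module.Finite K D] [Module.Finite K E]
    {Y Y' : Type*} [AddCommGroup Y] [Module D Y] [Module E Y] [IsScalarTower E D Y]
    [AddCommGroup Y'] [Module D Y'] [Module E Y'] [IsScalarTower E D Y']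
    {Z : Submodule E Y} {Z' : Submodule E Y'}
    (hY : Module.finrank D Y = 1) (hY' : Module.finrank D Y' = 1)
    (hZZ : Module.finrank E Z = Module.finrank E Z')
    (hn : Module.finrank E D ≤ 3) : PairIso D Z Z' := by
  have hfin := Module.Finite.of_restrictScalars_finite K E D
  obtain ⟨w, hw, hspan⟩ := finrank_eq_one_iff'.1 hY
  obtain ⟨w', hw', hspan'⟩ := finrank_eq_one_iff'.1 hY'
  let P := Z.lineTrace D w
  let P' := Z'.lineTrace D w'
  let eY : D ≃ₗ[D] Y := LinearEquiv.ofBijective (LinearMap.toSpanSingleton D Y w)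
    ⟨LinearMap.ker_eq_bot.1 (LinearMap.ker_toSpanSingleton D hw), fun y => by
      simpa using hspan y⟩
  let eY' : D ≃ₗ[D] Y' := LinearEquiv.ofBijective (LinearMap.toSpanSingleton D Y' w')
    ⟨LinearMap.ker_eq_bot.1 (LinearMap.ker_toSpanSingleton D hw'), fun y => by
      simpa using hspan' y⟩
  have heY : ∀ d, eY d = d • w := fun d => rfl
  have heY' : ∀ d, eY' d = d • w' := fun d => rfl
  have hP : Module.finrank E P = Module.finrank E Z :=
    LinearEquiv.finrank_eq (LinearEquiv.ofBijective
      ({ toFun d := ⟨(d : D) • w, d.2⟩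
         map_add' x y := Subtype.ext (add_smul _ _ w)
         map_smul' e x := Subtype.ext (smul_assoc e (x : D) w) } : P →ₗ[E] Z)
      ⟨fun x y h => Subtype.ext (eY.injective (by
          rw [heY, heY]; exact congrArg Subtype.val h)), fun z => by
        obtain ⟨d, hd⟩ := hspan z
        exact ⟨⟨d, by rw [Submodule.mem_lineTrace, hd]; exact z.2⟩, Subtype.ext hd⟩⟩)
  have hP' : Module.finrank E P' = Module.finrank E Z' :=
    LinearEquiv.finrank_eq (LinearEquiv.ofBijective
      ({ toFun d := ⟨(d : D) • w', d.2⟩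
         map_add' x y := Subtype.ext (add_smul _ _ w')
         map_smul' e x := Subtype.ext (smul_assoc e (x : D) w') } : P' →ₗ[E] Z')
      ⟨fun x y h => Subtype.ext (eY'.injective (by
          rw [heY', heY']; exact congrArg Subtype.val h)), fun z => by
        obtain ⟨d, hd⟩ := hspan' z
        exact ⟨⟨d, by rw [Submodule.mem_lineTrace, hd]; exact z.2⟩, Subtype.ext hd⟩⟩)
  have hPP : Module.finrank E P = Module.finrank E P' := by rw [hP, hP', hZZ]
  -- It remains to move the trace `P` of `Z` to `P'` by a right multiplication of `D`.
  suffices hc : ∃ c : D, c ≠ 0 ∧ ∀ d, d ∈ P → d * c ∈ P' by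
    obtain ⟨c, hc0, hc⟩ := hc
    let eP : P →ₗ[E] P' :=
      { toFun d := ⟨d * c, hc _ d.2⟩
        map_add' x y := Subtype.ext (add_mul _ _ _)
        map_smul' e x := Subtype.ext (smul_mul_assoc _ _ _) }
    have hinj : Function.Injective eP := fun x y h =>
      Subtype.ext (mul_right_cancel₀ hc0 (congrArg Subtype.val h))
    have hsurj := (LinearMap.injective_iff_surjective_of_finrank_eq_finrank hPP).1 hinj
    have hiff : ∀ d, d ∈ P ↔ d * c ∈ P' := by
      refine fun d => ⟨hc d, fun h => ?_⟩
      obtain ⟨x, hx⟩ := hsurj ⟨d * c, h⟩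
      have : (x : D) = d := mul_right_cancel₀ hc0 (congrArg Subtype.val hx)
      exact this ▸ x.2
    let eC : D ≃ₗ[D] D := LinearEquiv.ofBijective (LinearMap.toSpanSingleton D D c)
      ⟨LinearMap.ker_eq_bot.1 (LinearMap.ker_toSpanSingleton D hc0), fun y =>
        ⟨y * c⁻¹, by simp [hc0]⟩⟩
    refine ⟨eY.symm.trans (eC.trans eY'), fun y => ?_⟩
    obtain ⟨d, rfl⟩ := eY.surjective y
    have : (eY.symm.trans (eC.trans eY')) (eY d) = (d * c) • w' := by
      change eY' (eC (eY.symm (eY d))) = _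
      rw [LinearEquiv.symm_apply_apply, heY']
      rfl
    rw [this, heY]
    exact hiff d
  have hle := P.finrank_le
  by_cases h0 : Module.finrank E P = 0
  · refine ⟨1, one_ne_zero, fun d hd => ?_⟩
    rw [Submodule.finrank_eq_zero.1 h0] at hd
    rw [(Submodule.mem_bot E).1 hd, zero_mul]; exact P'.zero_mem
  by_cases h1 : Module.finrank E P = 1
  · obtain ⟨p, hp, hps⟩ := finrank_eq_one_iff'.1 h1
    obtain ⟨p', hp', -⟩ := finrank_eq_one_iff'.1 (hPP ▸ h1)
    have hp0 : (p : D) ≠ 0 := fun h => hp (Subtype.ext h)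
    have hp0' : (p' : D) ≠ 0 := fun h => hp' (Subtype.ext h)
    refine ⟨(p : D)⁻¹ * p', mul_ne_zero (inv_ne_zero hp0) hp0', fun d hd => ?_⟩
    obtain ⟨e, he⟩ := hps ⟨d, hd⟩
    have he : e • (p : D) = d := congrArg Subtype.val he
    rw [← he, smul_mul_assoc, mul_inv_cancel_left₀ hp0]
    exact P'.smul_mem _ p'.2
  by_cases htop : P' = ⊤
  · exact ⟨1, one_ne_zero, fun d _ => htop ▸ Submodule.mem_top⟩
  have htop' : P ≠ ⊤ := fun h => htop (Submodule.eq_top_of_finrank_eq (by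
    rw [← hPP, h, finrank_top]))
  obtain ⟨ρ, hρ, hρP⟩ := exists_forall_mem_iff_eq_zero htop' (by omega)
  obtain ⟨ρ', hρ', hρP'⟩ := exists_forall_mem_iff_eq_zero htop (by omega)
  obtain ⟨c, hc⟩ := exists_forall_eq_apply_mul K ρ' hρ' ρ
  refine ⟨c, ?_, fun d hd => ?_⟩
  · rintro rfl
    exact hρ (LinearMap.ext fun x => by simp [hc])
  · rw [hρP', ← hc, ← hρP]; exact hd

end Pair

/-! ### Relations over `D` in a pair of index three -/

section RightBasis

variable {K D E : Type*} [Field K] [DivisionRing D] [DivisionRing E] [Algebra K D] [Algebra K E]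
  [Module E D] [IsScalarTower K E D] [IsScalarTower E D D] [Module.Finite K D] [Module.Finite K E]
  {n : ℕ} {c : Fin n → D} {τ : Fin n → D →ₗ[K] E}

theorem eq_zero_of_forall_coord_mul (h3 : ∀ j k, τ j (c k) = if k = j then 1 else 0) (l : Fin n)
    {y : D} (hy : ∀ x, τ l (x * y) = 0) : y = 0 := by
  by_contra h
  have := hy (c l * y⁻¹)
  rw [inv_mul_cancel_right₀ h, h3, if_pos rfl] at this
  exact one_ne_zero this

/-- Left multiplication on `E` is intertwined by `τ_l` with a left multiplication on `D`. -/
theorem exists_mul_coord (hn : Module.finrank K D = n * Module.finrank K E)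
    (h1 : ∀ x, ∑ j, c j * (τ j x • (1 : D)) = x)
    (h2 : ∀ j x e, τ j (x * (e • (1 : D))) = τ j x * e)
    (h3 : ∀ j k, τ j (c k) = if k = j then 1 else 0) (l : Fin n) (e : E) :
    ∃ s : D, ∀ x, τ l (s * x) = e * τ l x := by
  obtain ⟨s, hs⟩ := exists_coord_mul_eq hn h1 h2 h3 l fun j => e * τ l (c j)
  refine ⟨s, fun x => ?_⟩
  conv_lhs => rw [← h1 x]
  conv_rhs => rw [← h1 x]
  rw [Finset.mul_sum, map_sum, map_sum, Finset.mul_sum]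
  refine Finset.sum_congr rfl fun j _ => ?_
  rw [← mul_assoc, h2, h2, hs, mul_assoc]

theorem coord_eq_of_sum_eq_zero (h2 : ∀ j x e, τ j (x * (e • (1 : D))) = τ j x * e)
    (h3 : ∀ j k, τ j (c k) = if k = j then 1 else 0) {e : Fin n → E}
    (he : ∑ j, c j * (e j • (1 : D)) = 0) (l : Fin n) : e l = 0 := by
  have := congrArg (τ l) he
  rw [map_sum, map_zero] at this
  simpa [h2, h3] using this

end RightBasis

section PlanePair

variable {K D E : Type*} [Field K] [DivisionRing D] [DivisionRing E] [Algebra K D] [Algebra K E]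
  [Module E D] [IsScalarTower K E D] [IsScalarTower E D D] [Module.Finite K D] [Module.Finite K E]
  {Y : Type*} [AddCommGroup Y] [Module D Y] [Module E Y] [IsScalarTower E D Y]
  {Z : Submodule E Y} {c : Fin 3 → D} {τ : Fin 3 → D →ₗ[K] E}

/-- If no line meets `Z` in more than one dimension, then a relation `∑ c_j w_j = 0` between
elements of `Z`, whose coefficients form a right basis of `D`, vanishes termwise as soon as its last
term does. -/
theorem relation_eq_zero (hline : ∀ z ∈ Z, z ≠ 0 → ∀ d : D, d • z ∈ Z → ∃ e : E, d = e • (1 : D))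
    (h2 : ∀ j x e, τ j (x * (e • (1 : D))) = τ j x * e)
    (h3 : ∀ j k, τ j (c k) = if k = j then 1 else 0) {w : Fin 3 → Y} (hw : ∀ j, w j ∈ Z)
    (hrel : ∑ j, c j • w j = 0) (hw2 : w 2 = 0) (j : Fin 3) : w j = 0 := by
  have hc : ∀ j, c j ≠ 0 := fun j h => by
    have := h3 j j
    rw [h, map_zero, if_pos rfl] at this
    exact zero_ne_one this
  rw [Fin.sum_univ_three, hw2, smul_zero, add_zero] at hrel
  have hw1 : w 1 = (-((c 1)⁻¹ * c 0)) • w 0 := by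
    rw [neg_smul, mul_smul, eq_neg_of_add_eq_zero_left hrel, smul_neg, neg_neg,
      inv_smul_smul₀ (hc 1)]
  have hw0 : w 0 = 0 := by
    by_contra hne
    obtain ⟨e, he⟩ := hline _ (hw 0) hne _ (hw1 ▸ hw 1)
    have key : ∑ j, c j * ((![1, e, 0] : Fin 3 → E) j • (1 : D)) = 0 := by
      rw [Fin.sum_univ_three]
      simp [← he, hc 1]
    have := coord_eq_of_sum_eq_zero h2 h3 key 0
    exact one_ne_zero this
  rw [hw0, smul_zero] at hw1
  fin_cases j
  exacts [hw0, hw1, hw2]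

variable {ι : Type*} [Fintype ι] (z : Module.Basis ι E Z)

/-- The relations over `D` between the members of an `E`-basis of `Z`; this is the kernel of
`D ⊗_E Z → Y`. -/
noncomputable def relationModule (D : Type*) {E Y : Type*} [DivisionRing D] [DivisionRing E]
    [AddCommGroup Y] [Module D Y] [Module E Y] {Z : Submodule E Y} {ι : Type*} [Fintype ι]
    (z : Module.Basis ι E Z) : Submodule D (ι → D) :=
  (Fintype.linearCombination D fun i => (z i : Y)).ker

theorem mem_relationModule {d : ι → D} : d ∈ relationModule D z ↔ ∑ i, d i • (z i : Y) = 0 := by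
  rw [relationModule, LinearMap.mem_ker, Fintype.linearCombination_apply]

theorem coe_eq_linearCombination (y : Z) :
    (y : Y) = Fintype.linearCombination D (fun i => (z i : Y)) fun i => z.repr y i • (1 : D) := by
  rw [Fintype.linearCombination_apply]
  simp_rw [smul_one_smul]
  have h := congrArg Z.subtype (z.sum_repr y)
  rw [map_sum] at h
  simpa only [map_smul, Submodule.subtype_apply] using h.symm

/-- The map `D ⊗_E Z → Z` induced by a right `E`-linear functional `t` on `D`, where `D ⊗_E Z` is
written in terms of a basis of `Z`. -/
noncomputable def coordMap (t : D →ₗ[K] E) : (ι → D) →+ Z where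
  toFun d := ∑ i, t (d i) • z i
  map_zero' := by simp
  map_add' d d' := by simp [add_smul, Finset.sum_add_distrib]

theorem coordMap_apply (t : D →ₗ[K] E) (d : ι → D) : coordMap z t d = ∑ i, t (d i) • z i := rfl

theorem coordMap_eq_zero {t : D →ₗ[K] E} {d : ι → D} (h : coordMap z t d = 0) (i : ι) :
    t (d i) = 0 := Fintype.linearIndependent_iff.1 z.linearIndependent _ h i

theorem eq_zero_of_forall_coordMap (h3 : ∀ j k, τ j (c k) = if k = j then 1 else 0) {d : ι → D}
    (h : ∀ x : D, coordMap z (τ 2) (x • d) = 0) : d = 0 :=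
  funext fun i => eq_zero_of_forall_coord_mul h3 2 fun x => coordMap_eq_zero z (h x) i

theorem sum_smul_coordMap (h1 : ∀ x, ∑ j, c j * (τ j x • (1 : D)) = x) (d : ι → D) :
    ∑ j, c j • (coordMap z (τ j) d : Y) = ∑ i, d i • (z i : Y) := by
  have : ∀ i, d i • (z i : Y) = ∑ j, c j • (τ j (d i) • (z i : Y)) := fun i => by
    conv_lhs => rw [← h1 (d i), Finset.sum_smul]
    exact Finset.sum_congr rfl fun j _ => by rw [mul_smul, smul_one_smul]
  simp_rw [this, coordMap_apply]
  rw [Finset.sum_comm]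
  refine Finset.sum_congr rfl fun j _ => ?_
  rw [← Finset.smul_sum]
  simp

/-- The last coordinate is injective on relations. -/
theorem coordMap_injOn (hline : ∀ z ∈ Z, z ≠ 0 → ∀ d : D, d • z ∈ Z → ∃ e : E, d = e • (1 : D))
    (h1 : ∀ x, ∑ j, c j * (τ j x • (1 : D)) = x)
    (h2 : ∀ j x e, τ j (x * (e • (1 : D))) = τ j x * e)
    (h3 : ∀ j k, τ j (c k) = if k = j then 1 else 0) {u : ι → D} (hu : u ∈ relationModule D z)
    (h : coordMap z (τ 2) u = 0) : u = 0 := by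
  have hrel : ∑ j, c j • (coordMap z (τ j) u : Y) = 0 := by
    rw [sum_smul_coordMap z h1]; exact (mem_relationModule z).1 hu
  have hw := relation_eq_zero hline h2 h3 (w := fun j => (coordMap z (τ j) u : Y))
    (fun j => (coordMap z (τ j) u).2) hrel (by rw [h]; rfl)
  funext i
  rw [← h1 (u i)]
  refine Finset.sum_eq_zero fun j _ => ?_
  rw [coordMap_eq_zero z (Subtype.ext (hw j)) i, zero_smul, mul_zero]

/-- The last coordinate maps the relations onto `Z`: a functional on `Z` vanishing on the image
would extend to a map onto the pair `(D, E)`, which would split off. -/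
theorem coordMap_surjOn [Module.Finite D Y] (hZ : IsIndecomposablePair D Z)
    (hY : Module.finrank D Y ≠ 1)
    (hn : Module.finrank K D = 3 * Module.finrank K E)
    (h1 : ∀ x, ∑ j, c j * (τ j x • (1 : D)) = x)
    (h2 : ∀ j x e, τ j (x * (e • (1 : D))) = τ j x * e)
    (h3 : ∀ j k, τ j (c k) = if k = j then 1 else 0) (y : Z) :
    ∃ u ∈ relationModule D z, coordMap z (τ 2) u = y := by
  let T : Submodule E Z :=
    { carrier := {y | ∃ u ∈ relationModule D z, coordMap z (τ 2) u = y}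
      zero_mem' := ⟨0, Submodule.zero_mem _, map_zero _⟩
      add_mem' := by
        rintro _ _ ⟨u, hu, rfl⟩ ⟨v, hv, rfl⟩
        exact ⟨u + v, Submodule.add_mem _ hu hv, map_add _ _ _⟩
      smul_mem' := by
        rintro e _ ⟨u, hu, rfl⟩
        obtain ⟨s, hs⟩ := exists_mul_coord hn h1 h2 h3 2 e
        refine ⟨s • u, Submodule.smul_mem _ _ hu, ?_⟩
        simp [coordMap_apply, hs, Finset.smul_sum, mul_smul] }
  change y ∈ T
  by_contra hy
  obtain ⟨μ, hμ, hker⟩ := T.exists_le_ker_of_notMem hy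
  let L : (ι → D) →ₗ[D] D := Fintype.linearCombination D fun i => μ (z i) • (1 : D)
  let Φ : (ι → D) →ₗ[D] Y := Fintype.linearCombination D fun i => (z i : Y)
  have hL : ∀ d, τ 2 (L d) = μ (coordMap z (τ 2) d) := fun d => by
    simp [L, Fintype.linearCombination_apply, coordMap_apply, h2]
  have hLΦ : Φ.ker ≤ L.ker := by
    intro u hu
    refine eq_zero_of_forall_coord_mul h3 2 fun x => ?_
    have : x * L u = L (x • u) := by rw [map_smul, smul_eq_mul]
    rw [this, hL]
    exact hker ⟨x • u, Submodule.smul_mem _ _ hu, rfl⟩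
  obtain ⟨lam, hlam⟩ := LinearMap.exists_comp_eq_of_ker_le Φ L hLΦ
  have hlamZ : ∀ y : Z, lam y = μ y • (1 : D) := by
    intro y
    have hy : (y : Y) = Φ fun i => z.repr y i • (1 : D) := coe_eq_linearCombination z y
    rw [hy, ← LinearMap.comp_apply, hlam]
    conv_rhs => rw [← z.sum_repr y, map_sum, Finset.sum_smul]
    simp [L, Fintype.linearCombination_apply, mul_smul]
  refine hY (hZ.finrank_eq_one_of_quotient lam ?_ fun z hz => ⟨_, hlamZ ⟨z, hz⟩⟩)
  rintro rfl
  have := hlamZ y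
  rw [LinearMap.zero_apply] at this
  exact hμ ((smul_eq_zero.1 this.symm).resolve_right one_ne_zero)

/-- The relations of an indecomposable pair of rank at least two form a line, because an idempotent
`D`-linear endomorphism of the relations induces an idempotent endomorphism of the pair. -/
theorem relationModule_eq_span [Module.Finite D Y] (hZ : IsIndecomposablePair D Z)
    (hY : Module.finrank D Y ≠ 1)
    (hspan : Submodule.span D (Z : Set Y) = ⊤)
    (hline : ∀ z ∈ Z, z ≠ 0 → ∀ d : D, d • z ∈ Z → ∃ e : E, d = e • (1 : D))
    (hn : Module.finrank K D = 3 * Module.finrank K E)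
    (h1 : ∀ x, ∑ j, c j * (τ j x • (1 : D)) = x)
    (h2 : ∀ j x e, τ j (x * (e • (1 : D))) = τ j x * e)
    (h3 : ∀ j k, τ j (c k) = if k = j then 1 else 0) {u : ι → D} (hu : u ∈ relationModule D z)
    (hu0 : u ≠ 0) {v : ι → D} (hv : v ∈ relationModule D z) : ∃ x : D, v = x • u := by
  let U := relationModule D z
  let Φ : (ι → D) →ₗ[D] Y := Fintype.linearCombination D fun i => (z i : Y)
  have hsurj := coordMap_surjOn z hZ hY hn h1 h2 h3
  have hinj : ∀ a ∈ U, ∀ b ∈ U, coordMap z (τ 2) a = coordMap z (τ 2) b → a = b := by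
    intro a ha b hb hab
    refine sub_eq_zero.1 (coordMap_injOn z hline h1 h2 h3 (U.sub_mem ha hb) ?_)
    rw [map_sub, hab, sub_self]
  -- an idempotent endomorphism of the relations with image the line through `u`
  obtain ⟨lam, hlam⟩ := (LinearMap.toSpanSingleton D U ⟨u, hu⟩).exists_leftInverse_of_injective
    (LinearMap.ker_toSpanSingleton D (fun h => hu0 (congrArg Subtype.val h)))
  let π : U →ₗ[D] U := lam.smulRight ⟨u, hu⟩
  have hlamu : lam ⟨u, hu⟩ = 1 := by simpa using LinearMap.congr_fun hlam 1
  have hππ : ∀ a, π (π a) = π a := fun a => by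
    change lam (lam a • (⟨u, hu⟩ : U)) • (⟨u, hu⟩ : U) = lam a • _
    rw [map_smul, hlamu, smul_eq_mul, mul_one]
  choose S hSU hS using hsurj
  have hST : ∀ a (ha : a ∈ U), S (coordMap z (τ 2) a) = a := fun a ha =>
    hinj _ (hSU _) _ ha (hS _)
  let p : Z →ₗ[E] Z :=
    { toFun y := coordMap z (τ 2) (π ⟨S y, hSU y⟩ : ι → D)
      map_add' x y := by
        have : (⟨S (x + y), hSU _⟩ : U) = ⟨S x, hSU _⟩ + ⟨S y, hSU _⟩ :=
          Subtype.ext (hinj _ (hSU _) _ (U.add_mem (hSU x) (hSU y)) (by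
            change _ = coordMap z (τ 2) (S x + S y)
            rw [map_add, hS, hS, hS]))
        rw [this, map_add, Submodule.coe_add, map_add]
      map_smul' e y := by
        obtain ⟨s, hs⟩ := exists_mul_coord hn h1 h2 h3 2 e
        have hsm : ∀ d, coordMap z (τ 2) (s • d) = e • coordMap z (τ 2) d := fun d => by
          simp [coordMap_apply, hs, Finset.smul_sum, mul_smul]
        have : (⟨S (e • y), hSU _⟩ : U) = s • ⟨S y, hSU _⟩ :=
          Subtype.ext (hinj _ (hSU _) _ (U.smul_mem s (hSU y)) (by
            change _ = coordMap z (τ 2) (s • S y)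
            rw [hsm, hS, hS]))
        rw [this, map_smul, Submodule.coe_smul, hsm, RingHom.id_apply] }
  have hp : ∀ a : U, p (coordMap z (τ 2) a) = coordMap z (τ 2) (π a : ι → D) := fun a => by
    have : (⟨S (coordMap z (τ 2) a), hSU _⟩ : U) = a := Subtype.ext (hST _ a.2)
    change coordMap z (τ 2) (π ⟨S _, _⟩ : ι → D) = _
    rw [this]
  -- the endomorphism `1 ⊗ p` of `D ⊗ Z`
  let P : (ι → D) →ₗ[D] (ι → D) :=
    Fintype.linearCombination D fun i k => z.repr (p (z i)) k • (1 : D)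
  have hTP : ∀ d, coordMap z (τ 2) (P d) = p (coordMap z (τ 2) d) := by
    intro d
    have e1 : p (coordMap z (τ 2) d) = ∑ i, τ 2 (d i) • p (z i) := by
      simp [coordMap_apply]
    have e2 : ∀ k, P d k = ∑ i, d i * (z.repr (p (z i)) k • (1 : D)) := fun k => by
      simp [P, Fintype.linearCombination_apply]
    rw [e1, coordMap_apply]
    simp_rw [e2, map_sum, h2, Finset.sum_smul, mul_smul]
    rw [Finset.sum_comm]
    refine Finset.sum_congr rfl fun i _ => ?_
    rw [← Finset.smul_sum, z.sum_repr]
  have hPU : ∀ a : U, P a = π a := by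
    intro a
    refine sub_eq_zero.1 (eq_zero_of_forall_coordMap z h3 fun x => ?_)
    have e1 : x • P (a : ι → D) = P ((x • a : U) : ι → D) := by
      rw [Submodule.coe_smul, map_smul]
    have e2 : x • (π a : ι → D) = (π (x • a) : U) := by rw [map_smul, Submodule.coe_smul]
    rw [smul_sub, map_sub, e1, e2, hTP, hp, sub_self]
  have hΦP : Φ.ker ≤ (Φ ∘ₗ P).ker := by
    intro a ha
    have := hPU ⟨a, ha⟩
    rw [LinearMap.mem_ker, LinearMap.comp_apply, this]
    exact (π ⟨a, ha⟩).2
  obtain ⟨Q, hQ⟩ := LinearMap.exists_comp_eq_of_ker_le Φ (Φ ∘ₗ P) hΦP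
  have hQZ : ∀ y : Z, Q y = p y := by
    intro y
    have hy : ∀ y : Z, (y : Y) = Φ fun i => z.repr y i • (1 : D) := coe_eq_linearCombination z
    have hPy : P (fun i => z.repr y i • (1 : D)) = fun k => z.repr (p y) k • (1 : D) := by
      funext k
      have e1 : p y = ∑ i, z.repr y i • p (z i) := by
        conv_lhs => rw [← z.sum_repr y, map_sum]
        simp
      rw [e1]
      simp [P, Fintype.linearCombination_apply, Finset.sum_smul, mul_smul]
    rw [hy y, ← LinearMap.comp_apply, hQ, LinearMap.comp_apply, hPy, ← hy]
  have hpp : ∀ y, p (p y) = p y := fun y => by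
    have e1 : y = coordMap z (τ 2) (⟨S y, hSU y⟩ : U) := (hS y).symm
    rw [e1, hp, hp, hππ]
  have hQQ : ∀ y, Q (Q y) = Q y := by
    have : Q ∘ₗ Q = Q := LinearMap.ext_on hspan fun y hy => by
      rw [LinearMap.comp_apply, hQZ ⟨y, hy⟩, hQZ, hpp]
    exact fun y => LinearMap.congr_fun this y
  rcases hZ.2 Q hQQ (fun y hy => by rw [hQZ ⟨y, hy⟩]; exact (p ⟨y, hy⟩).2) with h | h
  · -- `Q = 0` forces `u = 0`
    exfalso
    apply hu0
    have e1 : p (coordMap z (τ 2) u) = 0 := Subtype.ext (by rw [← hQZ, h]; rfl)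
    have e2 := hp ⟨u, hu⟩
    have e3 : π ⟨u, hu⟩ = ⟨u, hu⟩ := by simp [π, hlamu]
    rw [e1, e3] at e2
    exact coordMap_injOn z hline h1 h2 h3 hu e2.symm
  · refine ⟨lam ⟨v, hv⟩, ?_⟩
    have e1 : p (coordMap z (τ 2) v) = coordMap z (τ 2) v := Subtype.ext (by rw [← hQZ, h])
    have e2 := hp ⟨v, hv⟩
    rw [e1] at e2
    exact hinj _ hv _ (π ⟨v, hv⟩).2 e2

end PlanePair

/-! ### Indecomposable pairs of index at most three -/

section PlanePair

variable {K D E : Type*} [Field K] [DivisionRing D] [DivisionRing E] [Algebra K D] [Algebra K E]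
  [Module E D] [IsScalarTower K E D] [IsScalarTower E D D] [Module.Finite K D] [Module.Finite K E]
  {Y : Type*} [AddCommGroup Y] [Module D Y] [Module E Y] [IsScalarTower E D Y]
  {Z : Submodule E Y} {c : Fin 3 → D} {τ : Fin 3 → D →ₗ[K] E}

theorem coordMap_smul {ι : Type*} [Fintype ι] (z : Module.Basis ι E Z)
    (h1 : ∀ x, ∑ j, c j * (τ j x • (1 : D)) = x)
    (h2 : ∀ j x e, τ j (x * (e • (1 : D))) = τ j x * e) (l : Fin 3) (x : D) (u : ι → D) :
    coordMap z (τ l) (x • u) = ∑ j, τ l (x * c j) • coordMap z (τ j) u := by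
  have key : ∀ y, τ l (x * y) = ∑ j, τ l (x * c j) * τ j y := fun y => by
    conv_lhs => rw [← h1 y, Finset.mul_sum, map_sum]
    exact Finset.sum_congr rfl fun j _ => by rw [← mul_assoc, h2]
  simp only [coordMap_apply, Pi.smul_apply, smul_eq_mul, Finset.smul_sum, smul_smul]
  rw [Finset.sum_comm]
  exact Finset.sum_congr rfl fun i _ => by rw [key, Finset.sum_smul]

/-- An indecomposable pair `(Y, Z)` with `dim Y ≠ 1` is isomorphic to
`(D³ / D (c₀, c₁, c₂), E³)`. -/
theorem exists_basis_relationModule_eq [Module.Finite D Y] (hZ : IsIndecomposablePair D Z)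
    (hY : Module.finrank D Y ≠ 1)
    (hline : ∀ z ∈ Z, z ≠ 0 → ∀ d : D, d • z ∈ Z → ∃ e : E, d = e • (1 : D))
    (hspan : Submodule.span D (Z : Set Y) = ⊤) (hZ0 : Z ≠ ⊥)
    (hn : Module.finrank K D = 3 * Module.finrank K E)
    (h1 : ∀ x, ∑ j, c j * (τ j x • (1 : D)) = x)
    (h2 : ∀ j x e, τ j (x * (e • (1 : D))) = τ j x * e)
    (h3 : ∀ j k, τ j (c k) = if k = j then 1 else 0) :
    ∃ w : Module.Basis (Fin 3) E Z, relationModule D w = Submodule.span D {c} := by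
  have := Module.Finite.of_restrictScalars_finite K E D
  have : Module.Finite E Y := Module.Finite.trans D Y
  let z := Module.finBasis E Z
  have hsurj := coordMap_surjOn z hZ hY hn h1 h2 h3
  obtain ⟨y, hyZ, hy0⟩ := Submodule.exists_mem_ne_zero_of_ne_bot hZ0
  obtain ⟨u, hu, huy⟩ := hsurj ⟨y, hyZ⟩
  have hu0 : u ≠ 0 := by
    rintro rfl
    rw [map_zero] at huy
    exact hy0 (congrArg Subtype.val huy.symm)
  let w : Fin 3 → Z := fun j => coordMap z (τ j) u
  have hli : LinearIndependent E w := by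
    rw [Fintype.linearIndependent_iff]
    intro e he
    obtain ⟨x, hx⟩ := exists_coord_mul_eq hn h1 h2 h3 2 e
    have h : coordMap z (τ 2) (x • u) = 0 := by
      rw [coordMap_smul z h1 h2, ← he]
      exact Finset.sum_congr rfl fun j _ => by rw [hx]
    have h := coordMap_injOn z hline h1 h2 h3 (Submodule.smul_mem _ x hu) h
    have hx0 : x = 0 := (smul_eq_zero.1 h).resolve_right hu0
    intro j
    rw [← hx, hx0, zero_mul, map_zero]
  have hsp : ⊤ ≤ Submodule.span E (Set.range w) := by
    rintro y -
    obtain ⟨v, hv, rfl⟩ := hsurj y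
    obtain ⟨x, rfl⟩ := relationModule_eq_span z hZ hY hspan hline hn h1 h2 h3 hu hu0 hv
    rw [coordMap_smul z h1 h2]
    exact Submodule.sum_mem _ fun j _ => Submodule.smul_mem _ _ (Submodule.subset_span ⟨j, rfl⟩)
  let b := Module.Basis.mk hli hsp
  have hc : c ∈ relationModule D b := by
    rw [mem_relationModule]
    have := (sum_smul_coordMap z h1 u).trans ((mem_relationModule z).1 hu)
    simpa [b] using this
  have hc0 : c ≠ 0 := by
    rintro rfl
    have := h3 0 0
    rw [Pi.zero_apply, map_zero, if_pos rfl] at this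
    exact zero_ne_one this
  refine ⟨b, le_antisymm (fun v hv => ?_) (by simpa using hc)⟩
  obtain ⟨x, rfl⟩ := relationModule_eq_span b hZ hY hspan hline hn h1 h2 h3 hc hc0 hv
  exact Submodule.mem_span_singleton.2 ⟨x, rfl⟩

variable {Y' : Type*} [AddCommGroup Y'] [Module D Y'] [Module E Y'] [IsScalarTower E D Y']
  {Z' : Submodule E Y'}

theorem linearCombination_surjective {ι : Type*} [Fintype ι] (w : Module.Basis ι E Z)
    (hspan : Submodule.span D (Z : Set Y) = ⊤) :
    Function.Surjective (Fintype.linearCombination D fun i => (w i : Y)) := by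
  rw [← LinearMap.range_eq_top, eq_top_iff, ← hspan, Submodule.span_le]
  exact fun y hy => ⟨_, (coe_eq_linearCombination w ⟨y, hy⟩).symm⟩

/-- A pair with `Z` spanning `Y` is `(D^ι / U, E^ι)`, where `U` is the module of relations. -/
theorem pairIso_of_relationModule_eq {ι : Type*} [Fintype ι] (w : Module.Basis ι E Z)
    (w' : Module.Basis ι E Z') (hspan : Submodule.span D (Z : Set Y) = ⊤)
    (hspan' : Submodule.span D (Z' : Set Y') = ⊤)
    (h : relationModule D w = relationModule D w') : PairIso D Z Z' := by
  let Φ := Fintype.linearCombination D fun i => (w i : Y)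
  let Φ' := Fintype.linearCombination D fun i => (w' i : Y')
  have hΦ := linearCombination_surjective w hspan
  have hΦ' := linearCombination_surjective w' hspan'
  let e : Y ≃ₗ[D] Y' := (Φ.quotKerEquivOfSurjective hΦ).symm.trans
    ((Submodule.quotEquivOfEq _ _ h).trans (Φ'.quotKerEquivOfSurjective hΦ'))
  have he : ∀ d, e (Φ d) = Φ' d := by
    intro d
    have h1 : (Φ.quotKerEquivOfSurjective hΦ).symm (Φ d) = Submodule.Quotient.mk d := by
      rw [LinearEquiv.symm_apply_eq]; rfl
    change (Φ'.quotKerEquivOfSurjective hΦ') (Submodule.quotEquivOfEq _ _ h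
      ((Φ.quotKerEquivOfSurjective hΦ).symm (Φ d))) = _
    rw [h1]; rfl
  have key : ∀ a : ι → E, Φ (fun i => a i • (1 : D)) ∈ Z ∧ Φ' (fun i => a i • (1 : D)) ∈ Z' := by
    intro a
    simp only [Φ, Φ', Fintype.linearCombination_apply, smul_one_smul]
    exact ⟨Z.sum_mem fun i _ => Z.smul_mem _ (w i).2, Z'.sum_mem fun i _ => Z'.smul_mem _ (w' i).2⟩
  refine ⟨e, fun y => ⟨fun hy => ?_, fun hy => ?_⟩⟩
  · have := coe_eq_linearCombination (D := D) w ⟨y, hy⟩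
    change y = Φ _ at this
    rw [this, he]
    exact (key _).2
  · have := coe_eq_linearCombination (D := D) w' ⟨e y, hy⟩
    change e y = Φ' _ at this
    rw [← he, EmbeddingLike.apply_eq_iff_eq] at this
    rw [this]
    exact (key _).1

/-- An indecomposable pair with `dim Y ≠ 1` requires index three, and then no line meets `Z` in more
than one dimension. -/
theorem IsIndecomposablePair.of_finrank_ne_one (K : Type*) {D E : Type*} [Field K]
    [DivisionRing D] [DivisionRing E] [Algebra K D] [Algebra K E] [Module E D] [IsScalarTower K E D]
    [IsScalarTower E D D] [Module.Finite K D] [Module.Finite K E]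
    {Y : Type*} [AddCommGroup Y] [Module D Y] [Module E Y] [IsScalarTower E D Y]
    [Module.Finite D Y] {Z : Submodule E Y} (hZ : IsIndecomposablePair D Z)
    (hY : Module.finrank D Y ≠ 1) (hn : Module.finrank E D ≤ 3) :
    Module.finrank E D = 3 ∧ Z ≠ ⊥ ∧ Submodule.span D (Z : Set Y) = ⊤ ∧
    ∀ z ∈ Z, z ≠ 0 → ∀ d : D, d • z ∈ Z → ∃ e : E, d = e • (1 : D) := by
  have := Module.Finite.of_restrictScalars_finite K E D
  have hspan : Submodule.span D (Z : Set Y) = ⊤ := by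
    by_contra h
    obtain ⟨lam, h0, hle⟩ := (Submodule.span D (Z : Set Y)).exists_le_ker_of_lt_top
      (lt_top_iff_ne_top.2 h)
    refine hY (hZ.finrank_eq_one_of_quotient lam h0 fun z hz => ⟨0, ?_⟩)
    rw [zero_smul]
    exact hle (Submodule.subset_span hz)
  have hZ0 : Z ≠ ⊥ := by
    rintro rfl
    have := hZ.1
    rw [Submodule.bot_coe, Submodule.span_zero_singleton] at hspan
    exact bot_ne_top hspan
  have hlt : ∀ w : Y, w ≠ 0 → Module.finrank E (Z.lineTrace D w) + 1 < Module.finrank E D := by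
    intro w hw
    by_contra! h
    exact hY (hZ.finrank_eq_one_of_lineTrace K hw h)
  have hone : ∀ z (hz : z ∈ Z), (1 : D) ∈ Z.lineTrace D z := fun z hz => by
    rw [Submodule.mem_lineTrace, one_smul]; exact hz
  have hpos : ∀ z ∈ Z, 0 < Module.finrank E (Z.lineTrace D z) := fun z hz =>
    Module.finrank_pos_iff_exists_ne_zero.2
      ⟨⟨1, hone z hz⟩, fun h => one_ne_zero (congrArg Subtype.val h)⟩
  have h3 : Module.finrank E D = 3 := by
    obtain ⟨y, hyZ, hy0⟩ := Submodule.exists_mem_ne_zero_of_ne_bot hZ0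
    have h1 := hlt y hy0
    have h2 := hpos y hyZ
    omega
  refine ⟨h3, hZ0, hspan, fun z hz hz0 d hd => ?_⟩
  have h1 : Module.finrank E (Z.lineTrace D z) = 1 := by
    have h1 := hlt z hz0
    have h2 := hpos z hz
    omega
  obtain ⟨e, he⟩ := (finrank_eq_one_iff_of_nonzero' (⟨1, hone z hz⟩ : Z.lineTrace D z)
    (fun h => one_ne_zero (congrArg Subtype.val h))).1 h1 ⟨d, hd⟩
  exact ⟨e, (congrArg Subtype.val he).symm⟩

/-- An indecomposable pair of index at most three is determined by its dimensions. -/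
theorem pairIso_of_finrank_eq (K : Type*) {D E : Type*} [Field K]
    [DivisionRing D] [DivisionRing E] [Algebra K D] [Algebra K E] [Module E D] [IsScalarTower K E D]
    [IsScalarTower E D D] [Module.Finite K D] [Module.Finite K E]
    {Y Y' : Type*} [AddCommGroup Y] [Module D Y] [Module E Y] [IsScalarTower E D Y]
    [AddCommGroup Y'] [Module D Y'] [Module E Y'] [IsScalarTower E D Y']
    [Module.Finite D Y] [Module.Finite D Y'] {Z : Submodule E Y} {Z' : Submodule E Y'}
    (hn : Module.finrank E D ≤ 3) (hZ : IsIndecomposablePair D Z) (hZ' : IsIndecomposablePair D Z')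
    (hY : Module.finrank D Y = Module.finrank D Y')
    (hZZ : Module.finrank E Z = Module.finrank E Z') : PairIso D Z Z' := by
  by_cases h1 : Module.finrank D Y = 1
  · exact pairIso_of_finrank_eq_one K h1 (hY ▸ h1) hZZ hn
  obtain ⟨h3, hZ0, hspan, hline⟩ := hZ.of_finrank_ne_one K h1 hn
  obtain ⟨-, hZ0', hspan', hline'⟩ := hZ'.of_finrank_ne_one K (hY ▸ h1) hn
  have hK : Module.finrank K D = 3 * Module.finrank K E := by
    rw [← h3, mul_comm, Module.finrank_mul_finrank]
  obtain ⟨c, τ, k1, k2, k3⟩ := exists_right_basis K hK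
  obtain ⟨w, hw⟩ := exists_basis_relationModule_eq hZ h1 hline hspan hZ0 hK k1 k2 k3
  obtain ⟨w', hw'⟩ := exists_basis_relationModule_eq hZ' (hY ▸ h1) hline' hspan' hZ0' hK k1 k2 k3
  exact pairIso_of_relationModule_eq w w' hspan hspan' (hw.trans hw'.symm)

theorem IsIndecomposablePair.finrank_le (K : Type*) {D E : Type*} [Field K]
    [DivisionRing D] [DivisionRing E] [Algebra K D] [Algebra K E] [Module E D] [IsScalarTower K E D]
    [IsScalarTower E D D] [Module.Finite K D] [Module.Finite K E]
    {Y : Type*} [AddCommGroup Y] [Module D Y] [Module E Y] [IsScalarTower E D Y]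
    [Module.Finite D Y] {Z : Submodule E Y} (hn : Module.finrank E D ≤ 3)
    (hZ : IsIndecomposablePair D Z) : Module.finrank D Y ≤ 3 := by
  by_cases h1 : Module.finrank D Y = 1
  · omega
  obtain ⟨h3, hZ0, hspan, hline⟩ := hZ.of_finrank_ne_one K h1 hn
  have hK : Module.finrank K D = 3 * Module.finrank K E := by
    rw [← h3, mul_comm, Module.finrank_mul_finrank]
  obtain ⟨c, τ, k1, k2, k3⟩ := exists_right_basis K hK
  obtain ⟨w, hw⟩ := exists_basis_relationModule_eq hZ h1 hline hspan hZ0 hK k1 k2 k3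
  simpa using LinearMap.finrank_le_finrank_of_surjective (linearCombination_surjective w hspan)

end PlanePair

/-! ### Indecomposable representations of a bimodule that is one-dimensional on one side -/

section Indecomposable

variable {F G M V W V' W' : Type*} [DivisionRing F] [DivisionRing G] [AddCommGroup M] [Module F M]
  [Module Gᵐᵒᵖ M] [SMulCommClass F Gᵐᵒᵖ M]
  [AddCommGroup V] [Module Fᵐᵒᵖ V] [AddCommGroup W] [Module Gᵐᵒᵖ W]
  [AddCommGroup V'] [Module Fᵐᵒᵖ V'] [AddCommGroup W'] [Module Gᵐᵒᵖ W']
  {β : BalancedMap F G M V W} {β' : BalancedMap F G M V' W'}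

theorem BalancedMap.op_smul_apply (β : BalancedMap F G M V W) (f : Fᵐᵒᵖ) (v : V) (m : M) :
    β.toFun (f • v) m = β.toFun v (f.unop • m) := β.balanced f.unop v m

theorem BalancedMap.apply_smul (β : BalancedMap F G M V W) (g : Gᵐᵒᵖ) (v : V) (m : M) :
    β.toFun v (g • m) = g • β.toFun v m := β.map_op_smul g.unop v m

namespace RepModule

/-- The left kernel of `β` is a direct summand. -/
theorem eq_zero_of_indecomposable [Nontrivial W]
    (hN : IsIndecomposableModule (TriangularRing F M G)ᵐᵒᵖ (RepModule β)) {v : V}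
    (hv : ∀ m, β.toFun v m = 0) : v = 0 := by
  let V₁ : Submodule Fᵐᵒᵖ V :=
    { carrier := {v | ∀ m, β.toFun v m = 0}
      zero_mem' := fun m => by simp
      add_mem' := fun {v v'} h h' m => by rw [map_add, AddMonoidHom.add_apply, h m, h' m, add_zero]
      smul_mem' := fun f v h m => by rw [β.op_smul_apply, h] }
  obtain ⟨V₂, hV⟩ := V₁.exists_isCompl
  rcases isIndecomposable_split hN hV (isCompl_bot_top (α := Submodule Gᵐᵒᵖ W))
    (fun v hv m => (Submodule.mem_bot _).2 (hv m)) (fun _ _ _ => trivial) with h | h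
  · exact (Submodule.eq_bot_iff _).1 h.1 v hv
  · exact absurd h.2 top_ne_bot

/-- A complement in `W` of the image of `β` is a direct summand. -/
theorem eq_top_of_indecomposable [Nontrivial V]
    (hN : IsIndecomposableModule (TriangularRing F M G)ᵐᵒᵖ (RepModule β))
    {W₁ : Submodule Gᵐᵒᵖ W} (hW : ∀ v m, β.toFun v m ∈ W₁) : W₁ = ⊤ := by
  obtain ⟨W₂, h⟩ := W₁.exists_isCompl
  rcases isIndecomposable_split hN (isCompl_top_bot (α := Submodule Fᵐᵒᵖ V)) h
    (fun v _ m => hW v m)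
    (fun v hv m => by rw [(Submodule.mem_bot _).1 hv]; simp) with h' | h'
  · exact absurd h'.1 top_ne_bot
  · exact eq_top_of_isCompl_bot (h'.2 ▸ h)

theorem finrank_left_eq_one [Subsingleton W]
    (hN : IsIndecomposableModule (TriangularRing F M G)ᵐᵒᵖ (RepModule β)) :
    Module.finrank Fᵐᵒᵖ V = 1 := by
  have := hN.1
  obtain ⟨n, hn⟩ := exists_ne (0 : RepModule β)
  have hv : n.fst ≠ 0 := fun h => hn (RepModule.ext h (Subsingleton.elim _ _))
  obtain ⟨V₂, h⟩ := (Submodule.span Fᵐᵒᵖ {n.fst}).exists_isCompl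
  have hW : IsCompl (⊥ : Submodule Gᵐᵒᵖ W) ⊥ :=
    ⟨disjoint_bot_left, codisjoint_iff.2 (Subsingleton.elim _ _)⟩
  have hz : ∀ v m, β.toFun v m ∈ (⊥ : Submodule Gᵐᵒᵖ W) := fun _ _ => Subsingleton.elim _ _
  rcases isIndecomposable_split hN h hW (fun v _ => hz v) (fun v _ => hz v) with h' | h'
  · exact absurd (Submodule.span_singleton_eq_bot.1 h'.1) hv
  · have := eq_top_of_isCompl_bot (h'.1 ▸ h)
    rw [← finrank_top, ← this, finrank_span_singleton hv]

theorem finrank_right_eq_one [Subsingleton V]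
    (hN : IsIndecomposableModule (TriangularRing F M G)ᵐᵒᵖ (RepModule β)) :
    Module.finrank Gᵐᵒᵖ W = 1 := by
  have := hN.1
  obtain ⟨n, hn⟩ := exists_ne (0 : RepModule β)
  have hv : n.snd ≠ 0 := fun h => hn (RepModule.ext (Subsingleton.elim _ _) h)
  obtain ⟨W₂, h⟩ := (Submodule.span Gᵐᵒᵖ {n.snd}).exists_isCompl
  have hV : IsCompl (⊥ : Submodule Fᵐᵒᵖ V) ⊥ :=
    ⟨disjoint_bot_left, codisjoint_iff.2 (Subsingleton.elim _ _)⟩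
  have hz : ∀ (W₁ : Submodule Gᵐᵒᵖ W) v m, β.toFun v m ∈ W₁ := fun W₁ v m => by
    rw [Subsingleton.elim v 0, map_zero]; exact W₁.zero_mem
  rcases isIndecomposable_split hN hV h (fun v _ => hz _ v) (fun v _ => hz _ v) with h' | h'
  · exact absurd (Submodule.span_singleton_eq_bot.1 h'.2) hv
  · have := eq_top_of_isCompl_bot (h'.2 ▸ h)
    rw [← finrank_top, ← this, finrank_span_singleton hv]

end RepModule

section RightLine

/-! `M = m₀ G`, and `Fᵐᵒᵖ` acts on `Gᵐᵒᵖ` and on `W` through `f m₀ = m₀ θ(f)`. -/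

variable [Module Fᵐᵒᵖ Gᵐᵒᵖ] [IsScalarTower Fᵐᵒᵖ Gᵐᵒᵖ Gᵐᵒᵖ] [Module Fᵐᵒᵖ W]
  [IsScalarTower Fᵐᵒᵖ Gᵐᵒᵖ W] [Module Fᵐᵒᵖ W'] [IsScalarTower Fᵐᵒᵖ Gᵐᵒᵖ W'] {m₀ : M}

/-- The map `v ↦ β(v, m₀)`, for a right `G`-generator `m₀` of `M`. -/
def BalancedMap.evalRight (β : BalancedMap F G M V W)
    (hm : ∀ f : Fᵐᵒᵖ, f.unop • m₀ = (f • (1 : Gᵐᵒᵖ)) • m₀) : V →ₗ[Fᵐᵒᵖ] W where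
  toFun v := β.toFun v m₀
  map_add' v v' := by rw [map_add, AddMonoidHom.add_apply]
  map_smul' f v := by rw [β.op_smul_apply, hm, β.apply_smul, smul_one_smul, RingHom.id_apply]

variable (hm : ∀ f : Fᵐᵒᵖ, f.unop • m₀ = (f • (1 : Gᵐᵒᵖ)) • m₀) (hgen : ∀ m, ∃ g : Gᵐᵒᵖ, g • m₀ = m)

theorem BalancedMap.apply_mem_of_evalRight (hgen : ∀ m, ∃ g : Gᵐᵒᵖ, g • m₀ = m)
    {W₁ : Submodule Gᵐᵒᵖ W} {v : V}
    (h : β.toFun v m₀ ∈ W₁) (m : M) : β.toFun v m ∈ W₁ := by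
  obtain ⟨g, rfl⟩ := hgen m
  rw [β.apply_smul]
  exact W₁.smul_mem _ h

theorem BalancedMap.evalRight_injective (hgen : ∀ m, ∃ g : Gᵐᵒᵖ, g • m₀ = m) [Nontrivial W]
    (hN : IsIndecomposableModule (TriangularRing F M G)ᵐᵒᵖ (RepModule β)) :
    Function.Injective (β.evalRight hm) := by
  rw [injective_iff_map_eq_zero]
  intro v hv
  exact RepModule.eq_zero_of_indecomposable hN fun m =>
    (Submodule.mem_bot Gᵐᵒᵖ).1 (β.apply_mem_of_evalRight hgen ((Submodule.mem_bot _).2 hv) m)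

/-- An idempotent of `W` preserving `β(V, m₀)` decomposes `W` and, by pullback, `V`. -/
theorem BalancedMap.isIndecomposablePair_range (hgen : ∀ m, ∃ g : Gᵐᵒᵖ, g • m₀ = m) [Nontrivial W]
    (hN : IsIndecomposableModule (TriangularRing F M G)ᵐᵒᵖ (RepModule β)) :
    IsIndecomposablePair Gᵐᵒᵖ (β.evalRight hm).range := by
  refine ⟨inferInstance, fun π hπ hZ => ?_⟩
  have hinj := β.evalRight_injective hm hgen hN
  let V₁ : Submodule Fᵐᵒᵖ V := (π.ker.restrictScalars Fᵐᵒᵖ).comap (β.evalRight hm)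
  let V₂ : Submodule Fᵐᵒᵖ V := (π.range.restrictScalars Fᵐᵒᵖ).comap (β.evalRight hm)
  have hd : ∀ y, y ∈ π.ker → y ∈ π.range → y = 0 := by
    rintro _ h ⟨y, rfl⟩
    rw [LinearMap.mem_ker, hπ] at h
    exact h
  have hW : IsCompl π.ker π.range := by
    refine ⟨Submodule.disjoint_def.2 hd, codisjoint_iff.2 (eq_top_iff.2 fun y _ => ?_)⟩
    exact Submodule.mem_sup.2 ⟨y - π y, by rw [LinearMap.mem_ker, map_sub, hπ, sub_self], π y,
      ⟨y, rfl⟩, sub_add_cancel _ _⟩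
  have hV : IsCompl V₁ V₂ := by
    refine ⟨Submodule.disjoint_def.2 fun v h h' => ?_,
      codisjoint_iff.2 (eq_top_iff.2 fun v _ => ?_)⟩
    · exact hinj ((hd _ h h').trans (map_zero _).symm)
    · obtain ⟨v', hv'⟩ := hZ _ ⟨v, rfl⟩
      refine Submodule.mem_sup.2 ⟨v - v', ?_, v', ⟨_, hv'.symm⟩, sub_add_cancel _ _⟩
      change π (β.evalRight hm (v - v')) = 0
      rw [map_sub, hv', map_sub, hπ, sub_self]
  rcases RepModule.isIndecomposable_split hN hV hW
    (fun v hv => β.apply_mem_of_evalRight hgen hv) (fun v hv => β.apply_mem_of_evalRight hgen hv)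
    with h | h
  · refine Or.inr fun y => (LinearMap.ker_eq_bot.1 h.2) (hπ y)
  · exact Or.inl fun y => (Submodule.eq_bot_iff _).1 h.2 _ ⟨y, rfl⟩

theorem RepModule.nonempty_equiv_of_pairIso_range (hgen : ∀ m, ∃ g : Gᵐᵒᵖ, g • m₀ = m)
    (hinj : Function.Injective (β.evalRight hm)) (hinj' : Function.Injective (β'.evalRight hm))
    (h : PairIso Gᵐᵒᵖ (β.evalRight hm).range (β'.evalRight hm).range) :
    Nonempty (RepModule β ≃ₗ[(TriangularRing F M G)ᵐᵒᵖ] RepModule β') := by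
  obtain ⟨e, he⟩ := h
  let eW := (e.restrictScalars Fᵐᵒᵖ).ofSubmodules (β.evalRight hm).range (β'.evalRight hm).range (by
    ext y
    constructor
    · rintro ⟨x, hx, rfl⟩
      exact (he x).1 hx
    · intro hy
      obtain ⟨x, rfl⟩ := e.surjective y
      exact ⟨x, (he x).2 hy, rfl⟩)
  let eV := (LinearEquiv.ofInjective _ hinj).trans (eW.trans (LinearEquiv.ofInjective _ hinj').symm)
  have key : ∀ v, e (β.toFun v m₀) = β'.toFun (eV v) m₀ := by
    intro v
    have : LinearEquiv.ofInjective _ hinj' (eV v) = eW (LinearEquiv.ofInjective _ hinj v) := by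
      simp only [eV, LinearEquiv.trans_apply, LinearEquiv.apply_symm_apply]
    exact (congrArg Subtype.val this).symm
  refine ⟨RepModule.congr β' eV e fun v m => ?_⟩
  obtain ⟨g, rfl⟩ := hgen m
  rw [β.apply_smul, β'.apply_smul, map_smul, key]

end RightLine

section LeftLine

/-! `M = F m₀`, and `Gᵐᵒᵖ` acts on `Fᵐᵒᵖ` and on `V` through `m₀ g = ρ(g) m₀`. -/

variable [Module Gᵐᵒᵖ Fᵐᵒᵖ] [IsScalarTower Gᵐᵒᵖ Fᵐᵒᵖ Fᵐᵒᵖ] [Module Gᵐᵒᵖ V]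
  [IsScalarTower Gᵐᵒᵖ Fᵐᵒᵖ V] [Module Gᵐᵒᵖ V'] [IsScalarTower Gᵐᵒᵖ Fᵐᵒᵖ V'] {m₀ : M}

/-- The map `v ↦ β(v, m₀)`, for a left `F`-generator `m₀` of `M`. -/
def BalancedMap.evalLeft (β : BalancedMap F G M V W)
    (hm : ∀ g : Gᵐᵒᵖ, g • m₀ = (g • (1 : Fᵐᵒᵖ)).unop • m₀) : V →ₗ[Gᵐᵒᵖ] W where
  toFun v := β.toFun v m₀
  map_add' v v' := by rw [map_add, AddMonoidHom.add_apply]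
  map_smul' g v := by
    rw [← smul_one_smul Fᵐᵒᵖ g v, β.op_smul_apply, ← hm, β.apply_smul, RingHom.id_apply]

variable (hm : ∀ g : Gᵐᵒᵖ, g • m₀ = (g • (1 : Fᵐᵒᵖ)).unop • m₀)

theorem BalancedMap.exists_evalLeft_eq (hgen : ∀ m, ∃ f : F, f • m₀ = m) (v : V) (m : M) :
    ∃ f : Fᵐᵒᵖ, β.toFun v m = β.evalLeft hm (f • v) := by
  obtain ⟨f, rfl⟩ := hgen m
  exact ⟨op f, (β.balanced f v m₀).symm⟩

theorem BalancedMap.evalLeft_surjective (hgen : ∀ m, ∃ f : F, f • m₀ = m) [Nontrivial V]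
    (hN : IsIndecomposableModule (TriangularRing F M G)ᵐᵒᵖ (RepModule β)) :
    Function.Surjective (β.evalLeft hm) := by
  rw [← LinearMap.range_eq_top]
  refine RepModule.eq_top_of_indecomposable hN fun v m => ?_
  obtain ⟨f, hf⟩ := β.exists_evalLeft_eq hm hgen v m
  exact ⟨_, hf.symm⟩

/-- An idempotent of `V` preserving the kernel of `β(-, m₀)` decomposes `V` and, by pushforward,
`W`. -/
theorem BalancedMap.isIndecomposablePair_ker (hgen : ∀ m, ∃ f : F, f • m₀ = m) [Nontrivial V]
    (hN : IsIndecomposableModule (TriangularRing F M G)ᵐᵒᵖ (RepModule β)) :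
    IsIndecomposablePair Fᵐᵒᵖ (β.evalLeft hm).ker := by
  refine ⟨inferInstance, fun π hπ hZ => ?_⟩
  have hsurj := β.evalLeft_surjective hm hgen hN
  let W₁ : Submodule Gᵐᵒᵖ W := (π.ker.restrictScalars Gᵐᵒᵖ).map (β.evalLeft hm)
  let W₂ : Submodule Gᵐᵒᵖ W := (π.range.restrictScalars Gᵐᵒᵖ).map (β.evalLeft hm)
  have hV : IsCompl π.ker π.range := by
    refine ⟨Submodule.disjoint_def.2 ?_, codisjoint_iff.2 (eq_top_iff.2 fun y _ => ?_)⟩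
    · rintro _ h ⟨y, rfl⟩
      rw [LinearMap.mem_ker, hπ] at h
      exact h
    exact Submodule.mem_sup.2 ⟨y - π y, by rw [LinearMap.mem_ker, map_sub, hπ, sub_self], π y,
      ⟨y, rfl⟩, sub_add_cancel _ _⟩
  have hW : IsCompl W₁ W₂ := by
    refine ⟨Submodule.disjoint_def.2 ?_, codisjoint_iff.2 (eq_top_iff.2 fun w _ => ?_)⟩
    · rintro _ ⟨v, hv, rfl⟩ ⟨_, ⟨y, rfl⟩, h⟩
      have hv : π v = 0 := hv
      have h1 : π y - v ∈ (β.evalLeft hm).ker := by rw [LinearMap.mem_ker, map_sub, h, sub_self]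
      have h2 := hZ _ h1
      rw [map_sub, hπ, hv, sub_zero] at h2
      rw [← h]
      exact h2
    · obtain ⟨v, rfl⟩ := hsurj w
      refine Submodule.mem_sup.2 ⟨_, ⟨v - π v, ?_, rfl⟩, _, ⟨π v, ⟨v, rfl⟩, rfl⟩, ?_⟩
      · change π (v - π v) = 0
        rw [map_sub, hπ, sub_self]
      · rw [← map_add, sub_add_cancel]
  have hmem : ∀ (V₁ : Submodule Fᵐᵒᵖ V), ∀ v ∈ V₁, ∀ m,
      β.toFun v m ∈ (V₁.restrictScalars Gᵐᵒᵖ).map (β.evalLeft hm) := by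
    intro V₁ v hv m
    obtain ⟨f, hf⟩ := β.exists_evalLeft_eq hm hgen v m
    exact ⟨_, V₁.smul_mem f hv, hf.symm⟩
  rcases RepModule.isIndecomposable_split hN hV hW (hmem _) (hmem _) with h | h
  · refine Or.inr fun y => (LinearMap.ker_eq_bot.1 h.1) (hπ y)
  · exact Or.inl fun y => (Submodule.eq_bot_iff _).1 h.1 _ ⟨y, rfl⟩

theorem RepModule.nonempty_equiv_of_pairIso_ker (hgen : ∀ m, ∃ f : F, f • m₀ = m)
    (hsurj : Function.Surjective (β.evalLeft hm)) (hsurj' : Function.Surjective (β'.evalLeft hm))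
    (h : PairIso Fᵐᵒᵖ (β.evalLeft hm).ker (β'.evalLeft hm).ker) :
    Nonempty (RepModule β ≃ₗ[(TriangularRing F M G)ᵐᵒᵖ] RepModule β') := by
  obtain ⟨e, he⟩ := h
  let eV := Submodule.Quotient.equiv (β.evalLeft hm).ker (β'.evalLeft hm).ker
    (e.restrictScalars Gᵐᵒᵖ) (by
    ext y
    constructor
    · rintro ⟨x, hx, rfl⟩
      exact (he x).1 hx
    · intro hy
      obtain ⟨x, rfl⟩ := e.surjective y
      exact ⟨x, (he x).2 hy, rfl⟩)
  let eW := ((β.evalLeft hm).quotKerEquivOfSurjective hsurj).symm.trans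
    (eV.trans ((β'.evalLeft hm).quotKerEquivOfSurjective hsurj'))
  have key : ∀ v, eW (β.evalLeft hm v) = β'.evalLeft hm (e v) := by
    intro v
    have h1 : ((β.evalLeft hm).quotKerEquivOfSurjective hsurj).symm (β.evalLeft hm v) =
        Submodule.Quotient.mk v := by
      rw [LinearEquiv.symm_apply_eq]; rfl
    change ((β'.evalLeft hm).quotKerEquivOfSurjective hsurj')
      (eV (((β.evalLeft hm).quotKerEquivOfSurjective hsurj).symm (β.evalLeft hm v))) = _
    rw [h1]; rfl
  refine ⟨RepModule.congr β' e eW fun v m => ?_⟩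
  obtain ⟨f, rfl⟩ := hgen m
  rw [← β.balanced, ← β'.balanced, ← map_smul]
  exact key _

end LeftLine

end Indecomposable

/-! ### Bimodules with `ab ≤ 3` -/

section Algebraic

variable {K F G M : Type*} [Field K] [DivisionRing F] [DivisionRing G]
    [Algebra K F] [Algebra K G] [AddCommGroup M] [Module F M] [Module Gᵐᵒᵖ M]
    [SMulCommClass F Gᵐᵒᵖ M]

/-- Both sides compute `dim_K M`. -/
theorem IsAlgebraicBimodule.finrank_mul_finrank (hM : IsAlgebraicBimodule K F G M) :
    Module.finrank K F * Module.finrank F M = Module.finrank K G * Module.finrank Gᵐᵒᵖ M := by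
  let : Module K M := Module.compHom M (algebraMap K F)
  have : IsScalarTower K F M := ⟨fun k f m => by
    rw [Algebra.smul_def, mul_smul]; rfl⟩
  have : IsScalarTower K Gᵐᵒᵖ M := ⟨fun k g m => by
    have h : k • g = op (algebraMap K G k) * g := by
      rw [Algebra.smul_def]; rfl
    rw [h, mul_smul]; exact (hM.central k _).symm⟩
  rw [Module.finrank_mul_finrank, (MulOpposite.opLinearEquiv K : G ≃ₗ[K] Gᵐᵒᵖ).finrank_eq,
    Module.finrank_mul_finrank]

variable {V W V' W' : Type*}
  [AddCommGroup V] [Module Fᵐᵒᵖ V] [AddCommGroup W] [Module Gᵐᵒᵖ W]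
  [AddCommGroup V'] [Module Fᵐᵒᵖ V'] [AddCommGroup W'] [Module Gᵐᵒᵖ W']
  {β : BalancedMap F G M V W} {β' : BalancedMap F G M V' W'}
  [Module.Finite Fᵐᵒᵖ V] [Module.Finite Gᵐᵒᵖ W] [Module.Finite Fᵐᵒᵖ V'] [Module.Finite Gᵐᵒᵖ W']

/-- If `M = m₀ G`, then `f m₀ = m₀ θ(f)` defines a ring homomorphism `θ`. -/
theorem exists_ringHom_of_right_generator {m₀ : M} (h0 : m₀ ≠ 0)
    (hgen : ∀ m, ∃ g : Gᵐᵒᵖ, g • m₀ = m) :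
    ∃ θ : Fᵐᵒᵖ →+* Gᵐᵒᵖ, ∀ f : Fᵐᵒᵖ, f.unop • m₀ = θ f • m₀ := by
  choose t ht using fun f : Fᵐᵒᵖ => hgen (f.unop • m₀)
  have hinj : ∀ g g' : Gᵐᵒᵖ, g • m₀ = g' • m₀ → g = g' := fun g g' h =>
    smul_left_injective _ h0 h
  exact ⟨{
    toFun := t
    map_one' := hinj _ _ (by rw [ht, unop_one, one_smul, one_smul])
    map_mul' := fun a a' => hinj _ _ (by
      rw [ht, unop_mul, mul_smul, mul_smul, ht, ← ht a, smul_comm])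
    map_zero' := hinj _ _ (by rw [ht, unop_zero, zero_smul, zero_smul])
    map_add' := fun a a' => hinj _ _ (by rw [ht, unop_add, add_smul, add_smul, ht, ht]) },
    fun a => (ht a).symm⟩

/-- If `M = F m₀`, then `m₀ g = ρ(g) m₀` defines a ring homomorphism `ρ`. -/
theorem exists_ringHom_of_left_generator {m₀ : M} (h0 : m₀ ≠ 0)
    (hgen : ∀ m, ∃ f : F, f • m₀ = m) :
    ∃ ρ : Gᵐᵒᵖ →+* Fᵐᵒᵖ, ∀ g : Gᵐᵒᵖ, g • m₀ = (ρ g).unop • m₀ := by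
  have := SMulCommClass.symm F Gᵐᵒᵖ M
  choose t ht using fun g : Gᵐᵒᵖ => hgen (g • m₀)
  have hinj : ∀ f f' : F, f • m₀ = f' • m₀ → f = f' := fun g g' h =>
    smul_left_injective _ h0 h
  exact ⟨{
    toFun := fun g => op (t g)
    map_one' := congrArg op (hinj _ 1 (by rw [ht, one_smul, one_smul]))
    map_mul' := fun a a' => congrArg op (hinj _ (t a' * t a) (by
      rw [ht, mul_smul, mul_smul, ht, ← ht a', smul_comm]))
    map_zero' := congrArg op (hinj _ 0 (by rw [ht, zero_smul, zero_smul]))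
    map_add' := fun a a' => congrArg op
      (hinj _ (t a + t a') (by rw [ht, add_smul, add_smul, ht, ht])) },
    fun a => (ht a).symm⟩

/-- If `M` is one-dimensional over `G` and at most three-dimensional over `F`, then the
indecomposable representations supported at both vertices are bounded and determined by their
dimensions. -/
theorem RepModule.of_finrank_right_eq_one (hM : IsAlgebraicBimodule K F G M)
    (ha : Module.finrank Gᵐᵒᵖ M = 1) (hb : Module.finrank F M ≤ 3) [Nontrivial W] [Nontrivial W']
    (hN : IsIndecomposableModule (TriangularRing F M G)ᵐᵒᵖ (RepModule β))
    (hN' : IsIndecomposableModule (TriangularRing F M G)ᵐᵒᵖ (RepModule β')) :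
    (Module.finrank Fᵐᵒᵖ V ≤ 9 ∧ Module.finrank Gᵐᵒᵖ W ≤ 9) ∧
    (Module.finrank Fᵐᵒᵖ V = Module.finrank Fᵐᵒᵖ V' →
      Module.finrank Gᵐᵒᵖ W = Module.finrank Gᵐᵒᵖ W' →
      Nonempty (RepModule β ≃ₗ[(TriangularRing F M G)ᵐᵒᵖ] RepModule β')) := by
  have := hM.finite_F
  have := hM.finite_G
  have := hM.finite_right
  have : Module.Finite K Fᵐᵒᵖ := Module.Finite.equiv (MulOpposite.opLinearEquiv K : F ≃ₗ[K] Fᵐᵒᵖ)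
  have : Module.Finite K Gᵐᵒᵖ := Module.Finite.equiv (MulOpposite.opLinearEquiv K : G ≃ₗ[K] Gᵐᵒᵖ)
  obtain ⟨m₀, h0, hgen⟩ := finrank_eq_one_iff'.1 ha
  obtain ⟨θ, hθ⟩ := exists_ringHom_of_right_generator (F := F) h0 hgen
  let : Module Fᵐᵒᵖ Gᵐᵒᵖ := Module.compHom _ θ
  let : Module Fᵐᵒᵖ W := Module.compHom _ θ
  let : Module Fᵐᵒᵖ W' := Module.compHom _ θ
  have : IsScalarTower Fᵐᵒᵖ Gᵐᵒᵖ Gᵐᵒᵖ := ⟨fun f x y => mul_assoc (θ f) x y⟩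
  have : IsScalarTower Fᵐᵒᵖ Gᵐᵒᵖ W := ⟨fun f x y => mul_smul (θ f) x y⟩
  have : IsScalarTower Fᵐᵒᵖ Gᵐᵒᵖ W' := ⟨fun f x y => mul_smul (θ f) x y⟩
  have hk : ∀ k : K, θ (op (algebraMap K F k)) = op (algebraMap K G k) := fun k =>
    smul_left_injective _ h0 ((hθ _).symm.trans (hM.central k m₀))
  have : IsScalarTower K Fᵐᵒᵖ Gᵐᵒᵖ := ⟨fun k f x => by
    change θ (k • f) * x = k • (θ f * x)
    have h : k • f = op (algebraMap K F k) * f := by rw [Algebra.smul_def]; rfl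
    have h' : ∀ g : Gᵐᵒᵖ, k • g = op (algebraMap K G k) * g := fun g => by
      rw [Algebra.smul_def]; rfl
    rw [h, map_mul, hk, h', mul_assoc]⟩
  have hm : ∀ f : Fᵐᵒᵖ, f.unop • m₀ = (f • (1 : Gᵐᵒᵖ)) • m₀ := fun f => by
    rw [hθ]; exact congrArg (· • m₀) (mul_one (θ f)).symm
  have hn : Module.finrank Fᵐᵒᵖ Gᵐᵒᵖ ≤ 3 := by
    have h1 := Module.finrank_mul_finrank K Fᵐᵒᵖ Gᵐᵒᵖ
    rw [← (MulOpposite.opLinearEquiv K : F ≃ₗ[K] Fᵐᵒᵖ).finrank_eq,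
      ← (MulOpposite.opLinearEquiv K : G ≃ₗ[K] Gᵐᵒᵖ).finrank_eq] at h1
    have h2 := hM.finrank_mul_finrank
    rw [ha, mul_one, ← h1] at h2
    rwa [← Nat.eq_of_mul_eq_mul_left Module.finrank_pos h2]
  have := Module.Finite.of_restrictScalars_finite K Fᵐᵒᵖ Gᵐᵒᵖ
  have : Module.Finite Fᵐᵒᵖ W := Module.Finite.trans Gᵐᵒᵖ W
  have hinj := β.evalRight_injective hm hgen hN
  have hinj' := β'.evalRight_injective hm hgen hN'
  have hP := β.isIndecomposablePair_range hm hgen hN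
  have hP' := β'.isIndecomposablePair_range hm hgen hN'
  have hr := LinearMap.finrank_range_of_inj hinj
  have hr' := LinearMap.finrank_range_of_inj hinj'
  refine ⟨?_, fun hV hW => RepModule.nonempty_equiv_of_pairIso_range hm hgen hinj hinj'
    (pairIso_of_finrank_eq K hn hP hP' hW (by rw [hr, hr', hV]))⟩
  have h3 := hP.finrank_le K hn
  have h4 := (β.evalRight hm).range.finrank_le
  rw [hr, ← Module.finrank_mul_finrank Fᵐᵒᵖ Gᵐᵒᵖ W] at h4
  exact ⟨h4.trans (Nat.mul_le_mul hn h3), h3.trans (by norm_num)⟩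

/-- If `M` is one-dimensional over `F` and at most three-dimensional over `G`, then the
indecomposable representations supported at both vertices are bounded and determined by their
dimensions. -/
theorem RepModule.of_finrank_left_eq_one (hM : IsAlgebraicBimodule K F G M)
    (hb : Module.finrank F M = 1) (ha : Module.finrank Gᵐᵒᵖ M ≤ 3) [Nontrivial V] [Nontrivial V']
    (hN : IsIndecomposableModule (TriangularRing F M G)ᵐᵒᵖ (RepModule β))
    (hN' : IsIndecomposableModule (TriangularRing F M G)ᵐᵒᵖ (RepModule β')) :
    (Module.finrank Fᵐᵒᵖ V ≤ 9 ∧ Module.finrank Gᵐᵒᵖ W ≤ 9) ∧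
    (Module.finrank Fᵐᵒᵖ V = Module.finrank Fᵐᵒᵖ V' →
      Module.finrank Gᵐᵒᵖ W = Module.finrank Gᵐᵒᵖ W' →
      Nonempty (RepModule β ≃ₗ[(TriangularRing F M G)ᵐᵒᵖ] RepModule β')) := by
  have := hM.finite_F
  have := hM.finite_G
  have := hM.finite_left
  have : Module.Finite K Fᵐᵒᵖ := Module.Finite.equiv (MulOpposite.opLinearEquiv K : F ≃ₗ[K] Fᵐᵒᵖ)
  have : Module.Finite K Gᵐᵒᵖ := Module.Finite.equiv (MulOpposite.opLinearEquiv K : G ≃ₗ[K] Gᵐᵒᵖ)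
  obtain ⟨m₀, h0, hgen⟩ := finrank_eq_one_iff'.1 hb
  obtain ⟨ρ, hρ⟩ := exists_ringHom_of_left_generator (G := G) h0 hgen
  let : Module Gᵐᵒᵖ Fᵐᵒᵖ := Module.compHom _ ρ
  let : Module Gᵐᵒᵖ V := Module.compHom _ ρ
  let : Module Gᵐᵒᵖ V' := Module.compHom _ ρ
  have : IsScalarTower Gᵐᵒᵖ Fᵐᵒᵖ Fᵐᵒᵖ := ⟨fun f x y => mul_assoc (ρ f) x y⟩
  have : IsScalarTower Gᵐᵒᵖ Fᵐᵒᵖ V := ⟨fun f x y => mul_smul (ρ f) x y⟩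
  have : IsScalarTower Gᵐᵒᵖ Fᵐᵒᵖ V' := ⟨fun f x y => mul_smul (ρ f) x y⟩
  have hk : ∀ k : K, ρ (op (algebraMap K G k)) = op (algebraMap K F k) := fun k =>
    unop_injective (smul_left_injective _ h0 ((hρ _).symm.trans (hM.central k m₀).symm))
  have : IsScalarTower K Gᵐᵒᵖ Fᵐᵒᵖ := ⟨fun k f x => by
    change ρ (k • f) * x = k • (ρ f * x)
    have h : k • f = op (algebraMap K G k) * f := by rw [Algebra.smul_def]; rfl
    have h' : ∀ g : Fᵐᵒᵖ, k • g = op (algebraMap K F k) * g := fun g => by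
      rw [Algebra.smul_def]; rfl
    rw [h, map_mul, hk, h', mul_assoc]⟩
  have hm : ∀ g : Gᵐᵒᵖ, g • m₀ = (g • (1 : Fᵐᵒᵖ)).unop • m₀ := fun g => by
    rw [hρ]; exact congrArg (fun x : Fᵐᵒᵖ => x.unop • m₀) (mul_one (ρ g)).symm
  have hn : Module.finrank Gᵐᵒᵖ Fᵐᵒᵖ ≤ 3 := by
    have h1 := Module.finrank_mul_finrank K Gᵐᵒᵖ Fᵐᵒᵖ
    rw [← (MulOpposite.opLinearEquiv K : F ≃ₗ[K] Fᵐᵒᵖ).finrank_eq,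
      ← (MulOpposite.opLinearEquiv K : G ≃ₗ[K] Gᵐᵒᵖ).finrank_eq] at h1
    have h2 := hM.finrank_mul_finrank
    rw [hb, mul_one, ← h1] at h2
    rwa [Nat.eq_of_mul_eq_mul_left Module.finrank_pos h2]
  have := Module.Finite.of_restrictScalars_finite K Gᵐᵒᵖ Fᵐᵒᵖ
  have : Module.Finite Gᵐᵒᵖ V := Module.Finite.trans Fᵐᵒᵖ V
  have : Module.Finite Gᵐᵒᵖ V' := Module.Finite.trans Fᵐᵒᵖ V'
  have hsurj := β.evalLeft_surjective hm hgen hN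
  have hsurj' := β'.evalLeft_surjective hm hgen hN'
  have hP := β.isIndecomposablePair_ker hm hgen hN
  have hP' := β'.isIndecomposablePair_ker hm hgen hN'
  have hr := (β.evalLeft hm).finrank_range_add_finrank_ker
  have hr' := (β'.evalLeft hm).finrank_range_add_finrank_ker
  rw [LinearMap.range_eq_top.2 hsurj, finrank_top, ← Module.finrank_mul_finrank Gᵐᵒᵖ Fᵐᵒᵖ V] at hr
  rw [LinearMap.range_eq_top.2 hsurj', finrank_top, ← Module.finrank_mul_finrank Gᵐᵒᵖ Fᵐᵒᵖ V']
    at hr'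
  refine ⟨?_, fun hV hW => RepModule.nonempty_equiv_of_pairIso_ker hm hgen hsurj hsurj'
    (pairIso_of_finrank_eq K hn hP hP' hV (by rw [hV, hW] at hr; omega))⟩
  have h3 := hP.finrank_le K hn
  have h4 := Nat.mul_le_mul hn h3
  exact ⟨h3.trans (by norm_num), by omega⟩

/-- If `ab ≤ 3`, the indecomposable representations supported at both vertices are bounded and
determined by their dimensions. -/
theorem RepModule.of_finrank_mul_le (hM : IsAlgebraicBimodule K F G M)
    (hab : Module.finrank Gᵐᵒᵖ M * Module.finrank F M ≤ 3) [Nontrivial V] [Nontrivial V']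
    [Nontrivial W] [Nontrivial W']
    (hN : IsIndecomposableModule (TriangularRing F M G)ᵐᵒᵖ (RepModule β))
    (hN' : IsIndecomposableModule (TriangularRing F M G)ᵐᵒᵖ (RepModule β')) :
    (Module.finrank Fᵐᵒᵖ V ≤ 9 ∧ Module.finrank Gᵐᵒᵖ W ≤ 9) ∧
    (Module.finrank Fᵐᵒᵖ V = Module.finrank Fᵐᵒᵖ V' →
      Module.finrank Gᵐᵒᵖ W = Module.finrank Gᵐᵒᵖ W' →
      Nonempty (RepModule β ≃ₗ[(TriangularRing F M G)ᵐᵒᵖ] RepModule β')) := by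
  have := hM.finite_left
  have := hM.finite_right
  have hM0 : Nontrivial M := by
    by_contra h
    rw [not_nontrivial_iff_subsingleton] at h
    obtain ⟨v, hv⟩ := exists_ne (0 : V)
    exact hv (RepModule.eq_zero_of_indecomposable hN fun m => by
      rw [Subsingleton.elim m 0, map_zero])
  have h1 : 0 < Module.finrank Gᵐᵒᵖ M := Module.finrank_pos
  have h2 : 0 < Module.finrank F M := Module.finrank_pos
  obtain ha | ha := Nat.lt_or_ge 1 (Module.finrank Gᵐᵒᵖ M)
  · exact RepModule.of_finrank_left_eq_one hM (by nlinarith) (by nlinarith) hN hN'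
  · exact RepModule.of_finrank_right_eq_one hM (by omega) (by nlinarith) hN hN'

/-- If `ab ≤ 3`, then the indecomposable representations are determined by their dimensions. -/
theorem RepModule.nonempty_equiv_of_finrank_eq (hM : IsAlgebraicBimodule K F G M)
    (hab : Module.finrank Gᵐᵒᵖ M * Module.finrank F M ≤ 3)
    (hN : IsIndecomposableModule (TriangularRing F M G)ᵐᵒᵖ (RepModule β))
    (hN' : IsIndecomposableModule (TriangularRing F M G)ᵐᵒᵖ (RepModule β'))
    (hV : Module.finrank Fᵐᵒᵖ V = Module.finrank Fᵐᵒᵖ V')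
    (hW : Module.finrank Gᵐᵒᵖ W = Module.finrank Gᵐᵒᵖ W') :
    Nonempty (RepModule β ≃ₗ[(TriangularRing F M G)ᵐᵒᵖ] RepModule β') := by
  have eV := LinearEquiv.ofFinrankEq V V' hV
  have eW := LinearEquiv.ofFinrankEq W W' hW
  rcases subsingleton_or_nontrivial V with h | h
  · exact ⟨RepModule.congr β' eV eW fun v m => by
      rw [Subsingleton.elim v 0]; simp⟩
  rcases subsingleton_or_nontrivial W with h' | h'
  · have := eW.symm.toEquiv.subsingleton
    exact ⟨RepModule.congr β' eV eW fun v m => Subsingleton.elim _ _⟩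
  have := eV.symm.toEquiv.nontrivial
  have := eW.symm.toEquiv.nontrivial
  exact (RepModule.of_finrank_mul_le hM hab hN hN').2 hV hW

/-- If `ab ≤ 3`, then the indecomposable representations have bounded dimensions. -/
theorem RepModule.finrank_le_of_indecomposable (hM : IsAlgebraicBimodule K F G M)
    (hab : Module.finrank Gᵐᵒᵖ M * Module.finrank F M ≤ 3)
    (hN : IsIndecomposableModule (TriangularRing F M G)ᵐᵒᵖ (RepModule β)) :
    Module.finrank Fᵐᵒᵖ V ≤ 9 ∧ Module.finrank Gᵐᵒᵖ W ≤ 9 := by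
  rcases subsingleton_or_nontrivial V with h | h
  · rw [RepModule.finrank_right_eq_one hN, Module.finrank_zero_of_subsingleton]; norm_num
  rcases subsingleton_or_nontrivial W with h' | h'
  · rw [RepModule.finrank_left_eq_one hN, Module.finrank_zero_of_subsingleton]; norm_num
  exact (RepModule.of_finrank_mul_le hM hab hN hN).1

/-- If `ab ≤ 3`, then indecomposable modules of finite length are determined by their composition
factors. -/
theorem satisfiesX_of_finrank_mul_le {K : Type*} {F : Type u} {M : Type v} {G : Type w} [Field K]
    [DivisionRing F] [DivisionRing G] [Algebra K F] [Algebra K G] [AddCommGroup M] [Module F M]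
    [Module Gᵐᵒᵖ M] [SMulCommClass F Gᵐᵒᵖ M] (hM : IsAlgebraicBimodule K F G M)
    (hab : Module.finrank Gᵐᵒᵖ M * Module.finrank F M ≤ 3) :
    SatisfiesX (TriangularRing F M G) := by
  intro N N' _ _ _ _ hN hN' hI hI' hmul
  have := hM.finite_right
  have hfin : ∀ (N : Type (max u v w)) [AddCommGroup N] [Module (TriangularRing F M G)ᵐᵒᵖ N],
      IsFiniteLength (TriangularRing F M G)ᵐᵒᵖ N →
      Module.Finite Fᵐᵒᵖ (peirceLeft F G M N) ∧ Module.Finite Gᵐᵒᵖ (peirceRight F G M N) := by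
    intro N _ _ hN
    have := (isFiniteLength_iff_isNoetherian_isArtinian.1 hN).1
    exact RepModule.finite_parts (Module.Finite.equiv (peirceEquiv F G M N))
  obtain ⟨h1, h2⟩ := hfin N hN
  obtain ⟨h1', h2'⟩ := hfin N' hN'
  let S := ULift.{max u v w} (LeftSimple F G M)
  let T := ULift.{max u v w} (RightSimple F G M)
  have hS : IsSimpleModule (TriangularRing F M G)ᵐᵒᵖ S :=
    IsSimpleModule.congr (ULift.moduleEquiv (R := (TriangularRing F M G)ᵐᵒᵖ))
  have hT : IsSimpleModule (TriangularRing F M G)ᵐᵒᵖ T :=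
    IsSimpleModule.congr (ULift.moduleEquiv (R := (TriangularRing F M G)ᵐᵒᵖ))
  have hc : ∀ (S : Type (max u v w)) [AddCommGroup S] [Module (TriangularRing F M G)ᵐᵒᵖ S],
      IsSimpleModule (TriangularRing F M G)ᵐᵒᵖ S →
      compositionMultiplicity (TriangularRing F M G)ᵐᵒᵖ S (RepModule (peirceMap F G M N)) =
        compositionMultiplicity (TriangularRing F M G)ᵐᵒᵖ S (RepModule (peirceMap F G M N')) := by
    intro S _ _ hS
    rw [← compositionMultiplicity_congr hN (peirceEquiv F G M N),
      ← compositionMultiplicity_congr hN' (peirceEquiv F G M N')]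
    exact hmul S hS
  obtain ⟨hV, hW⟩ := RepModule.finrank_eq_of_multiplicity (peirceMap F G M N) (peirceMap F G M N')
    (ULift.moduleEquiv : S ≃ₗ[_] _) (ULift.moduleEquiv : T ≃ₗ[_] _) (hc S hS) (hc T hT)
  obtain ⟨e⟩ := RepModule.nonempty_equiv_of_finrank_eq hM hab (hI.congr (peirceEquiv F G M N))
    (hI'.congr (peirceEquiv F G M N')) hV hW
  exact ⟨(peirceEquiv F G M N).trans (e.trans (peirceEquiv F G M N').symm)⟩

open Classical in
/-- If `ab ≤ 3`, then there are only finitely many indecomposable modules, at most one for each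
possible pair of dimensions. -/
theorem isFiniteRepresentationType_of_finrank_mul_le {K : Type*} {F : Type u} {M : Type v}
    {G : Type w} [Field K]
    [DivisionRing F] [DivisionRing G] [Algebra K F] [Algebra K G] [AddCommGroup M] [Module F M]
    [Module Gᵐᵒᵖ M] [SMulCommClass F Gᵐᵒᵖ M] (hM : IsAlgebraicBimodule K F G M)
    (hab : Module.finrank Gᵐᵒᵖ M * Module.finrank F M ≤ 3) :
    IsFiniteRepresentationType (TriangularRing F M G) := by
  have := hM.finite_right
  let P : Fin 10 × Fin 10 → ModuleCat.{max u v w} (TriangularRing F M G)ᵐᵒᵖ → Prop := fun d N =>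
    Module.Finite (TriangularRing F M G)ᵐᵒᵖ N ∧
    IsIndecomposableModule (TriangularRing F M G)ᵐᵒᵖ N ∧
    Module.finrank Fᵐᵒᵖ (peirceLeft F G M N) = d.1 ∧
    Module.finrank Gᵐᵒᵖ (peirceRight F G M N) = d.2
  let L : Fin 10 × Fin 10 → ModuleCat.{max u v w} (TriangularRing F M G)ᵐᵒᵖ := fun d =>
    if h : ∃ N, P d N then h.choose else ModuleCat.of _ PUnit
  refine ⟨10 * 10, L ∘ finProdFinEquiv.symm, fun N _ _ hN hI => ?_⟩
  have e := peirceEquiv F G M N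
  obtain ⟨h1, h2⟩ := RepModule.finite_parts (hN.equiv e)
  obtain ⟨h3, h4⟩ := RepModule.finrank_le_of_indecomposable hM hab (hI.congr e)
  let d : Fin 10 × Fin 10 := ⟨⟨Module.finrank Fᵐᵒᵖ (peirceLeft F G M N), by omega⟩,
    ⟨Module.finrank Gᵐᵒᵖ (peirceRight F G M N), by omega⟩⟩
  have hex : ∃ N, P d N := ⟨ModuleCat.of _ N, hN, hI, rfl, rfl⟩
  refine ⟨finProdFinEquiv d, ?_⟩
  have hL : (L ∘ finProdFinEquiv.symm) (finProdFinEquiv d) = hex.choose := by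
    simp only [Function.comp_apply, Equiv.symm_apply_apply, L, dif_pos hex]
  rw [hL]
  obtain ⟨hN', hI', hV, hW⟩ := hex.choose_spec
  have e' := peirceEquiv F G M hex.choose
  obtain ⟨h1', h2'⟩ := RepModule.finite_parts (hN'.equiv e')
  obtain ⟨i⟩ := RepModule.nonempty_equiv_of_finrank_eq hM hab (hI.congr e) (hI'.congr e')
    hV.symm hW.symm
  exact ⟨e.trans (i.trans e'.symm)⟩

end Algebraic

/-! ### Bilinear images do not cover a vector space -/

section Covering

open MvPolynomial

/-- More polynomials than variables satisfy a polynomial relation. -/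
theorem exists_polynomial_relation {K : Type*} [Field K] {σ τ : Type*} [Fintype σ] [Fintype τ]
    (h : Fintype.card σ < Fintype.card τ) (Q : τ → MvPolynomial σ K) :
    ∃ P : MvPolynomial τ K, P ≠ 0 ∧ ∀ x : σ → K, eval (fun t => eval x (Q t)) P = 0 := by
  have hQ : ¬ AlgebraicIndependent K Q := by
    intro hQ
    have := hQ.lift_cardinalMk_le_trdeg
    rw [MvPolynomial.trdeg_of_isDomain] at this
    simp at this
    omega
  rw [algebraicIndependent_iff] at hQ
  push Not at hQ
  obtain ⟨P, hP, hP0⟩ := hQ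
  refine ⟨P, hP0, fun x => ?_⟩
  have := congrArg (eval x) hP
  rw [map_zero] at this
  rw [← this]
  simp only [← coe_aeval_eq_eval, RingHom.coe_coe]
  exact (comp_aeval_apply Q (aeval x) P).symm

/-- Over an infinite field, finitely many images of bilinear maps `A × B → C` with
`dim A + dim B ≤ dim C` do not cover `C`: as one nonzero coordinate in `A` can be normalised to `1`,
each of them is, up to `0`, a finite union of images of affine spaces of smaller dimension under
polynomial maps. -/
theorem exists_ne_bilinear {K : Type*} [Field K] [Infinite K] {ι : Type*} [Finite ι]
    {A B : ι → Type*} {C : Type*} [∀ i, AddCommGroup (A i)] [∀ i, Module K (A i)]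
    [∀ i, AddCommGroup (B i)] [∀ i, Module K (B i)] [AddCommGroup C] [Module K C]
    [∀ i, Module.Finite K (A i)] [∀ i, Module.Finite K (B i)] [Module.Finite K C]
    (φ : ∀ i, A i →ₗ[K] B i →ₗ[K] C)
    (h : ∀ i, Module.finrank K (A i) + Module.finrank K (B i) ≤ Module.finrank K C)
    (hC : 0 < Module.finrank K C) : ∃ c, ∀ i a b, φ i a b ≠ c := by
  classical
  have := Fintype.ofFinite ι
  let bC := Module.finBasis K C
  let bA := fun i => Module.finBasis K (A i)
  let bB := fun i => Module.finBasis K (B i)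
  let I := Σ i, Fin (Module.finrank K (A i))
  let σ : I → Type := fun s =>
    {t : Fin (Module.finrank K (A s.1)) ⊕ Fin (Module.finrank K (B s.1)) // t ≠ Sum.inl s.2}
  let X' : ∀ s : I, Fin (Module.finrank K (A s.1)) ⊕ Fin (Module.finrank K (B s.1)) →
      MvPolynomial (σ s) K := fun s t => if ht : t = Sum.inl s.2 then 1 else X ⟨t, ht⟩
  let Q : ∀ s : I, Fin (Module.finrank K C) → MvPolynomial (σ s) K := fun s l =>
    ∑ k, ∑ m, MvPolynomial.C (bC.repr (φ s.1 (bA s.1 k) (bB s.1 m)) l) *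
      (X' s (Sum.inl k) * X' s (Sum.inr m))
  have hcard : ∀ s : I, Fintype.card (σ s) < Fintype.card (Fin (Module.finrank K C)) := by
    intro s
    have h1 : Fintype.card (σ s) = Module.finrank K (A s.1) + Module.finrank K (B s.1) - 1 := by
      simp only [σ]
      rw [Fintype.card_subtype_compl]
      simp
    have := h s.1
    simp only [Fintype.card_fin]
    omega
  choose P hP0 hP using fun s => exists_polynomial_relation (hcard s) (Q s)
  let P₀ := X (⟨0, hC⟩ : Fin (Module.finrank K C)) * ∏ s, P s
  have hP₀ : P₀ ≠ 0 := mul_ne_zero (X_ne_zero _) (Finset.prod_ne_zero_iff.2 fun s _ => hP0 s)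
  by_contra! hcov
  refine hP₀ (MvPolynomial.funext fun x => ?_)
  rw [map_zero, map_mul, eval_X, map_prod]
  obtain ⟨i, a, b, hab⟩ := hcov (bC.equivFun.symm x)
  have hx : ∀ l, x l = bC.repr (φ i a b) l := fun l => by
    rw [hab, ← bC.equivFun_apply, LinearEquiv.apply_symm_apply]
  by_cases ha : a = 0
  · rw [hx, ha]; simp
  obtain ⟨j, hj⟩ : ∃ j, (bA i).repr a j ≠ 0 := by
    by_contra! h0
    exact ha ((LinearEquiv.map_eq_zero_iff (bA i).repr).1 (Finsupp.ext h0))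
  refine mul_eq_zero_of_right _ (Finset.prod_eq_zero (Finset.mem_univ (⟨i, j⟩ : I)) ?_)
  let r := (bA i).repr a j
  let y : σ ⟨i, j⟩ → K := fun t =>
    Sum.elim (fun k => r⁻¹ * (bA i).repr a k) (fun m => r * (bB i).repr b m) t.1
  have hX : ∀ t, eval y (X' ⟨i, j⟩ t) =
      Sum.elim (fun k => r⁻¹ * (bA i).repr a k) (fun m => r * (bB i).repr b m) t := by
    intro t
    simp only [X']
    split_ifs with ht
    · rw [ht, map_one, Sum.elim_inl, inv_mul_cancel₀ hj]
    · rw [eval_X]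
  have key : x = fun l => eval y (Q ⟨i, j⟩ l) := by
    funext l
    rw [hx]
    simp only [Q, map_sum, map_mul, eval_C, hX, Sum.elim_inl, Sum.elim_inr]
    conv_lhs => rw [← (bA i).sum_repr a, ← (bB i).sum_repr b]
    simp only [map_sum, LinearMap.sum_apply, map_smul, LinearMap.smul_apply, Finsupp.coe_finsetSum,
      Finset.sum_apply, Finsupp.smul_apply, smul_eq_mul]
    rw [Finset.sum_comm]
    refine Finset.sum_congr rfl fun k _ => ?_
    rw [Finset.mul_sum]
    refine Finset.sum_congr rfl fun m _ => ?_
    have := mul_inv_cancel₀ hj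
    change r * r⁻¹ = 1 at this
    linear_combination (-(bA i).repr a m * (bB i).repr b k *
      (bC.repr (φ i (bA i m) (bB i k)) l)) * this
  rw [key]
  exact hP _ y

end Covering

/-! ### Vectors outside of finitely many orbits -/

theorem natCard_notMem {X : Type*} [Finite X] (s : Set X) :
    Nat.card {x // x ∉ s} = Nat.card X - Nat.card s := by
  rw [Nat.card_coe_set_eq s, ← Set.ncard_compl]
  rfl

theorem natCard_ne_zero {X : Type*} [Finite X] [Zero X] :
    Nat.card {x : X // x ≠ 0} = Nat.card X - 1 := by
  simpa using natCard_notMem ({0} : Set X)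

section Orbits

variable {K D E P ι : Type*} [Field K] [DivisionRing D] [DivisionRing E] [Algebra K D] [Algebra K E]
  [AddCommGroup P] [Module K P] [Module D P] [Module E P] [IsScalarTower K D P]
  [IsScalarTower K E P] [Module.Finite K D] [Module.Finite K E] [Module.Finite K P] [Finite ι]

/-- If `dim D + dim E ≤ dim P`, then `P` contains nonzero vectors outside of finitely many orbits
`D E p'`, respectively outside of one orbit if the base field is finite. -/
theorem exists_ne_smul_smul (h : Module.finrank K D + Module.finrank K E ≤ Module.finrank K P)
    (hK : Infinite K ∨ Subsingleton ι) (p' : ι → P) :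
    ∃ p : P, p ≠ 0 ∧ ∀ i (d : D) (e : E), d • e • p' i ≠ p := by
  have hD : 0 < Module.finrank K D := Module.finrank_pos
  have hE : 0 < Module.finrank K E := Module.finrank_pos
  rcases finite_or_infinite K with hfin | hinf
  · -- The orbit has at most `(|D| - 1) (|E| - 1)` nonzero elements.
    have hs : Subsingleton ι := hK.resolve_left (not_infinite_iff_finite.2 hfin)
    by_contra! hcon
    have := Module.finite_of_finite K (M := D)
    have := Module.finite_of_finite K (M := E)
    have := Module.finite_of_finite K (M := P)
    choose i d e hde using fun p : {p : P // p ≠ 0} => hcon p.1 p.2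
    let ψ : {p : P // p ≠ 0} → {d : D // d ≠ 0} × {e : E // e ≠ 0} := fun p =>
      (⟨d p, fun h0 => p.2 (by rw [← hde, h0, zero_smul])⟩,
        ⟨e p, fun h0 => p.2 (by rw [← hde, h0, zero_smul, smul_zero])⟩)
    have hψ : Function.Injective ψ := by
      intro p q hpq
      have h1 : d p = d q := congrArg (fun x => x.1.1) hpq
      have h2 : e p = e q := congrArg (fun x => x.2.1) hpq
      refine Subtype.ext ?_
      rw [← hde p, ← hde q, h1, h2, Subsingleton.elim (i p) (i q)]
    have hle := Nat.card_le_card_of_injective ψ hψ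
    rw [Nat.card_prod, natCard_ne_zero, natCard_ne_zero, natCard_ne_zero,
      Module.natCard_eq_pow_finrank (K := K) (V := P)] at hle
    have h1 := Nat.pow_le_pow_right (Nat.card_pos (α := K)) h
    rw [pow_add, ← Module.natCard_eq_pow_finrank, ← Module.natCard_eq_pow_finrank] at h1
    have h2 : 1 < Nat.card D := Finite.one_lt_card
    have h3 : 1 < Nat.card E := Finite.one_lt_card
    obtain ⟨x, hx⟩ := Nat.exists_eq_add_of_lt h2
    obtain ⟨y, hy⟩ := Nat.exists_eq_add_of_lt h3
    rw [hx, hy] at h1 hle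
    have h4 := h1.trans (Nat.le_add_of_sub_le hle)
    have : 1 + x + 1 - 1 = x + 1 := by omega
    have : 1 + y + 1 - 1 = y + 1 := by omega
    simp only [*] at h4
    nlinarith
  · have : SMulCommClass D K P := IsScalarTower.to_smulCommClass'
    have : SMulCommClass E K P := IsScalarTower.to_smulCommClass'
    let φ : Option ι → D →ₗ[K] E →ₗ[K] P := fun i =>
      LinearMap.mk₂ K (fun d e => d • e • i.elim 0 p') (fun _ _ _ => add_smul _ _ _)
        (fun _ _ _ => smul_assoc _ _ _) (fun _ _ _ => by rw [add_smul, smul_add])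
        (fun _ _ _ => by rw [smul_assoc, smul_comm])
    obtain ⟨p, hp⟩ := exists_ne_bilinear φ (fun _ => h) (by omega)
    refine ⟨p, fun h0 => hp none 0 0 ?_, fun i => hp (some i)⟩
    rw [map_zero, h0]

/-- If `P` is one-dimensional over `D` and at least four-dimensional over `E`, then there are
`E`-independent pairs of vectors outside of finitely many orbits of `D × Mat₂(E)`, respectively
outside of one orbit if the base field is finite. -/
theorem exists_linearIndependent_ne_smul_sum (hD : Module.finrank D P = 1)
    (hE : 4 ≤ Module.finrank E P)
    (hK : Infinite K ∨ Subsingleton ι) (p' : ι → Fin 2 → P) :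
    ∃ p : Fin 2 → P, LinearIndependent E p ∧ ∀ i (d : D) (A : Fin 2 → Fin 2 → E),
      ¬ ∀ k, p k = d • ∑ j, A k j • p' i j := by
  have : Module.Finite E P := Module.Finite.of_restrictScalars_finite K E P
  have hpE : 0 < Module.finrank K E := Module.finrank_pos
  have hDP := Module.finrank_mul_finrank K D P
  have hEP := Module.finrank_mul_finrank K E P
  rcases finite_or_infinite K with hfin | hinf
  · have hs : Subsingleton ι := hK.resolve_left (not_infinite_iff_finite.2 hfin)
    have := Module.finite_of_finite K (M := D)
    have := Module.finite_of_finite K (M := E)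
    have := Module.finite_of_finite K (M := P)
    have hnt : Nontrivial P := Module.nontrivial_of_finrank_pos (R := E) (by omega)
    obtain ⟨u, hu⟩ := exists_ne (0 : P)
    by_contra! hcon
    -- Pairs `(u, y)` with `y ∉ E u` are counted by the pairs of rows of the matrix `A`, as the
    -- first row determines the factor `d`.
    have hli : ∀ y : {y : P // y ∉ (Submodule.span E {u} : Set P)},
        LinearIndependent E ![u, y.1] := by
      intro y
      rw [LinearIndependent.pair_iff' hu]
      exact fun e he => y.2 (Submodule.mem_span_singleton.2 ⟨e, he⟩)
    choose i d A hdA using fun y => hcon _ (hli y)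
    have h0 : ∀ y, u = d y • ∑ j, A y 0 j • p' (i y) j := fun y => hdA y 0
    have h1 : ∀ y, y.1 = d y • ∑ j, A y 1 j • p' (i y) j := fun y => hdA y 1
    let ψ : {y : P // y ∉ (Submodule.span E {u} : Set P)} →
        {r : Fin 2 → E // r ≠ 0} × {r : Fin 2 → E // r ≠ 0} := fun y =>
      (⟨A y 0, fun h => hu (by rw [h0 y, h]; simp)⟩,
        ⟨A y 1, fun h => y.2 (by rw [h1 y, h]; simp)⟩)
    have hψ : Function.Injective ψ := by
      intro y z hyz
      have e1 : A y 0 = A z 0 := congrArg (fun x => x.1.1) hyz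
      have e2 : A y 1 = A z 1 := congrArg (fun x => x.2.1) hyz
      have e3 := h0 y
      rw [Subsingleton.elim (i y) (i z), e1] at e3
      have hne : ∑ j, A z 0 j • p' (i z) j ≠ 0 := fun h => hu (by rw [h0 z, h, smul_zero])
      have e4 : d y = d z := smul_left_injective D hne (e3.symm.trans (h0 z))
      refine Subtype.ext ?_
      rw [h1 y, h1 z, Subsingleton.elim (i y) (i z), e2, e4]
    have hle := Nat.card_le_card_of_injective ψ hψ
    have hspan : Nat.card (Submodule.span E {u} : Set P) = Nat.card E := by
      change Nat.card (Submodule.span E {u}) = _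
      rw [Module.natCard_eq_pow_finrank (K := E), finrank_span_singleton hu, pow_one]
    rw [Nat.card_prod, natCard_ne_zero, natCard_notMem, hspan, Nat.card_fun, Nat.card_fin,
      Module.natCard_eq_pow_finrank (K := E) (V := P)] at hle
    have h3 := Nat.pow_le_pow_right (Nat.card_pos (α := E)) hE
    have h2 : 1 < Nat.card E := Finite.one_lt_card
    have h4 := h3.trans (Nat.le_add_of_sub_le hle)
    obtain ⟨x, hx⟩ := Nat.exists_eq_add_of_lt h2
    rw [hx] at h4
    have : (1 + x + 1) ^ 2 - 1 = (x + 2) ^ 2 - 1 := by ring_nf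
    have h5 : (1 + x + 1) ^ 2 - 1 = x ^ 2 + 4 * x + 3 := by
      rw [show (1 + x + 1) ^ 2 = x ^ 2 + 4 * x + 3 + 1 by ring]; simp
    rw [h5] at h4
    nlinarith [sq_nonneg x]
  · have : SMulCommClass D K P := IsScalarTower.to_smulCommClass'
    have : SMulCommClass E K P := IsScalarTower.to_smulCommClass'
    let φ : ι → D →ₗ[K] (Fin 2 → Fin 2 → E) →ₗ[K] (Fin 2 → P) := fun i =>
      LinearMap.mk₂ K (fun d A k => d • ∑ j, A k j • p' i j)
        (fun _ _ _ => funext fun k => add_smul _ _ _)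
        (fun _ _ _ => funext fun k => smul_assoc _ _ _)
        (fun _ _ _ => funext fun k => by
          simp [add_smul, Finset.sum_add_distrib, smul_add])
        (fun c d A => funext fun k => by
          simp only [Pi.smul_apply, smul_assoc, ← Finset.smul_sum]
          rw [smul_comm])
    obtain ⟨u, hu, hgen⟩ := finrank_eq_one_iff'.1 hD
    let φ₀ : D →ₗ[K] (Fin 2 → Fin 2 → E) →ₗ[K] (Fin 2 → P) :=
      LinearMap.mk₂ K (fun d A k => A k 0 • d • u)
        (fun _ _ _ => funext fun k => by simp [add_smul, smul_add])
        (fun c d e => funext fun k => by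
          simp only [Pi.smul_apply, smul_assoc]; rw [smul_comm])
        (fun _ _ _ => funext fun k => add_smul _ _ _)
        (fun c d A => funext fun k => smul_assoc _ _ _)
    have hdim : Module.finrank K D + Module.finrank K (Fin 2 → Fin 2 → E) ≤
        Module.finrank K (Fin 2 → P) := by
      simp only [Module.finrank_pi_fintype, Finset.sum_const, Finset.card_univ, Fintype.card_fin,
        smul_eq_mul]
      rw [hD, mul_one] at hDP
      nlinarith
    obtain ⟨p, hp⟩ := exists_ne_bilinear (fun i : Option ι => i.elim φ₀ φ) (fun _ => hdim) (by
      have : 0 < Module.finrank K D := Module.finrank_pos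
      omega)
    refine ⟨p, ?_, fun i d A h => hp (some i) d A (funext h).symm⟩
    -- Dependent pairs have the form `(c₀ u, c₁ u)`, which is excluded by `φ₀`.
    have hdep : ∀ (q : P) (c : Fin 2 → E), (∀ k, p k = c k • q) → False := by
      intro q c hc
      obtain ⟨d, rfl⟩ := hgen q
      exact hp none d (fun k _ => c k) (funext fun k => (hc k).symm)
    have hp01 : p = ![p 0, p 1] := by ext k; fin_cases k <;> rfl
    rw [hp01, LinearIndependent.pair_iff' (fun h => hdep (p 1) ![0, 1] fun k => by
      fin_cases k <;> simp [h])]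
    intro e he
    exact hdep (p 0) ![1, e] fun k => by fin_cases k <;> simp [he]

end Orbits

/-! ### Representations given by matrices of functionals -/

section DualAction

variable {K F G M : Type*} [Field K] [DivisionRing F] [DivisionRing G] [Algebra K F] [Algebra K G]
  [AddCommGroup M] [Module F M] [Module Gᵐᵒᵖ M] [SMulCommClass F Gᵐᵒᵖ M]

/-- The right action of `F` on the `G`-dual of the bimodule `M`, `(h f)(m) = h(f m)`. -/
@[reducible] def dualModule (F G M : Type*) [DivisionRing F] [DivisionRing G] [AddCommGroup M]
    [Module F M] [Module Gᵐᵒᵖ M] [SMulCommClass F Gᵐᵒᵖ M] : Module Fᵐᵒᵖ (M →ₗ[Gᵐᵒᵖ] G) where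
  smul f h := h ∘ₗ
    { toFun := fun m => f.unop • m
      map_add' := smul_add _
      map_smul' := fun g m => smul_comm _ _ _ }
  one_smul h := LinearMap.ext fun m => congrArg h (one_smul F m)
  mul_smul f f' h := LinearMap.ext fun m => congrArg h (mul_smul f'.unop f.unop m)
  smul_zero f := rfl
  smul_add f h h' := rfl
  add_smul f f' h := LinearMap.ext fun m => by
    change h ((f.unop + f'.unop) • m) = h (f.unop • m) + h (f'.unop • m)
    rw [add_smul, map_add]
  zero_smul h := LinearMap.ext fun m => by
    change h ((0 : F) • m) = 0
    rw [zero_smul, map_zero]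

attribute [local instance] dualModule

theorem dualModule_smul_apply (f : Fᵐᵒᵖ) (h : M →ₗ[Gᵐᵒᵖ] G) (m : M) : (f • h) m = h (f.unop • m) :=
  rfl

theorem IsAlgebraicBimodule.isScalarTower_dual (hM : IsAlgebraicBimodule K F G M) :
    IsScalarTower K Fᵐᵒᵖ (M →ₗ[Gᵐᵒᵖ] G) := ⟨fun k f h => LinearMap.ext fun m => by
  have h1 : (k • f).unop = algebraMap K F k * f.unop := by rw [unop_smul, Algebra.smul_def]
  rw [dualModule_smul_apply, h1, mul_smul, hM.central, map_smul, LinearMap.smul_apply,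
    dualModule_smul_apply, Algebra.smul_def, Algebra.commutes]
  rfl⟩

theorem finrank_dual [Module.Finite Gᵐᵒᵖ M] :
    Module.finrank G (M →ₗ[Gᵐᵒᵖ] G) = Module.finrank Gᵐᵒᵖ M := by
  rw [← ((Module.finBasis Gᵐᵒᵖ M).constr G (M' := G)).finrank_eq]
  simp

theorem IsAlgebraicBimodule.finite_dual (hM : IsAlgebraicBimodule K F G M) :
    Module.Finite K (M →ₗ[Gᵐᵒᵖ] G) := by
  have := hM.finite_right
  have := hM.finite_G
  have := Module.Finite.equiv ((Module.finBasis Gᵐᵒᵖ M).constr G (M' := G))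
  exact Module.Finite.trans G _

theorem IsAlgebraicBimodule.finrank_dual_left (hM : IsAlgebraicBimodule K F G M) :
    Module.finrank Fᵐᵒᵖ (M →ₗ[Gᵐᵒᵖ] G) = Module.finrank F M := by
  have := hM.finite_right
  have := hM.finite_F
  have := hM.isScalarTower_dual
  have h1 := Module.finrank_mul_finrank K Fᵐᵒᵖ (M →ₗ[Gᵐᵒᵖ] G)
  have h2 := Module.finrank_mul_finrank K G (M →ₗ[Gᵐᵒᵖ] G)
  rw [finrank_dual, ← hM.finrank_mul_finrank, ← h1,
    ← (MulOpposite.opLinearEquiv K : F ≃ₗ[K] Fᵐᵒᵖ).finrank_eq] at h2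
  exact (Nat.eq_of_mul_eq_mul_left Module.finrank_pos h2).symm

end DualAction

section Matrices

variable {F G M : Type*} [DivisionRing F] [DivisionRing G]
  [AddCommGroup M] [Module F M] [Module Gᵐᵒᵖ M] [SMulCommClass F Gᵐᵒᵖ M]
  {x y : Type*} [Fintype x] [Fintype y]

/-- The representation on `V = F^x`, `W = G^y` given by a matrix of `G`-linear functionals on
`M`. -/
def BalancedMap.ofMatrix (θ : x → y → M →ₗ[Gᵐᵒᵖ] G) : BalancedMap F G M (x → F) (y → G) where
  toFun := AddMonoidHom.mk' (fun v => AddMonoidHom.mk' (fun m j => ∑ i, θ i j (v i • m))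
      fun m m' => by ext j; simp [Finset.sum_add_distrib])
    fun v v' => by ext m j; simp [add_smul, Finset.sum_add_distrib]
  balanced f v m := by ext j; simp [mul_smul]
  map_op_smul g v m := by
    ext j
    simp only [AddMonoidHom.mk'_apply, Pi.smul_apply, Finset.smul_sum]
    exact Finset.sum_congr rfl fun i _ => by rw [smul_comm, map_smul]

theorem BalancedMap.ofMatrix_apply (θ : x → y → M →ₗ[Gᵐᵒᵖ] G) (v : x → F) (m : M) (j : y) :
    (BalancedMap.ofMatrix θ).toFun v m j = ∑ i, θ i j (v i • m) := rfl

theorem finrank_op_self : Module.finrank Fᵐᵒᵖ F = 1 :=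
  finrank_eq_one 1 one_ne_zero fun f => ⟨op f, one_mul f⟩

instance finite_op_self : Module.Finite Fᵐᵒᵖ F :=
  Module.finite_of_finrank_pos (by rw [finrank_op_self]; exact one_pos)

theorem finrank_op_pi : Module.finrank Fᵐᵒᵖ (x → F) = Fintype.card x := by
  rw [Module.finrank_pi_fintype Fᵐᵒᵖ]
  simp [finrank_op_self]

theorem LinearMap.apply_eq_sum_mul [DecidableEq x] {F' : Type*} [AddCommGroup F']
    [Module Fᵐᵒᵖ F'] (φ : (x → F) →ₗ[Fᵐᵒᵖ] F') (v : x → F) :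
    φ v = ∑ i, op (v i) • φ (Pi.single i 1) := by
  conv_lhs => rw [← Finset.univ_sum_single v, map_sum]
  refine Finset.sum_congr rfl fun i _ => ?_
  rw [← map_smul]
  congr 1
  ext k
  by_cases h : k = i
  · subst h; simp
  · simp [h]

/-- A homomorphism between representations given by matrices of functionals is a pair of matrices
`A` over `F` and `B` over `G` with `B θ = θ' A`. -/
theorem RepModule.exists_matrices {x' y' : Type*} [Fintype x'] [Fintype y']
    {θ : x → y → M →ₗ[Gᵐᵒᵖ] G} {θ' : x' → y' → M →ₗ[Gᵐᵒᵖ] G}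
    (e : RepModule (BalancedMap.ofMatrix θ : BalancedMap F G M (x → F) (y → G))
      →ₗ[(TriangularRing F M G)ᵐᵒᵖ]
      RepModule (BalancedMap.ofMatrix θ' : BalancedMap F G M (x' → F) (y' → G))) :
    ∃ (A : x → x' → F) (B : y → y' → G),
      (∀ v i, leftMap e v i = ∑ k, A k i * v k) ∧ (∀ w l, rightMap e w l = ∑ j, B j l * w j) ∧
      ∀ k l m, ∑ j, B j l * θ k j m = ∑ i, θ' i l (A k i • m) := by
  classical
  have hB : ∀ w l, rightMap e w l = ∑ j, rightMap e (Pi.single j 1) l * w j := fun w l => by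
    rw [LinearMap.apply_eq_sum_mul (rightMap e), Finset.sum_apply]; rfl
  refine ⟨fun k i => leftMap e (Pi.single k 1) i, fun j l => rightMap e (Pi.single j 1) l,
    fun v i => ?_, hB, fun k l m => ?_⟩
  · rw [LinearMap.apply_eq_sum_mul (leftMap e), Finset.sum_apply]; rfl
  · have h := congrFun (rightMap_apply e (Pi.single k 1) m) l
    rw [BalancedMap.ofMatrix_apply, hB] at h
    rw [← h]
    refine Finset.sum_congr rfl fun j _ => ?_
    rw [BalancedMap.ofMatrix_apply, Finset.sum_eq_single k]
    · simp
    · intro i _ hi; simp [hi]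
    · simp

theorem RepModule.leftMap_injective {V W V' W' : Type*}
    [AddCommGroup V] [Module Fᵐᵒᵖ V] [AddCommGroup W] [Module Gᵐᵒᵖ W]
    [AddCommGroup V'] [Module Fᵐᵒᵖ V'] [AddCommGroup W'] [Module Gᵐᵒᵖ W']
    {β : BalancedMap F G M V W} {β' : BalancedMap F G M V' W'}
    (e : RepModule β ≃ₗ[(TriangularRing F M G)ᵐᵒᵖ] RepModule β') :
    Function.Injective (leftMap e.toLinearMap) := by
  rw [injective_iff_map_eq_zero]
  intro v hv
  have h := map_eq e.toLinearMap (mk v 0)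
  rw [fst_mk, hv, snd_mk, map_zero] at h
  exact congrArg fst ((LinearEquiv.map_eq_zero_iff e).1 h)

theorem RepModule.rightMap_injective {V W V' W' : Type*}
    [AddCommGroup V] [Module Fᵐᵒᵖ V] [AddCommGroup W] [Module Gᵐᵒᵖ W]
    [AddCommGroup V'] [Module Fᵐᵒᵖ V'] [AddCommGroup W'] [Module Gᵐᵒᵖ W']
    {β : BalancedMap F G M V W} {β' : BalancedMap F G M V' W'}
    (e : RepModule β ≃ₗ[(TriangularRing F M G)ᵐᵒᵖ] RepModule β') :
    Function.Injective (rightMap e.toLinearMap) := by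
  rw [injective_iff_map_eq_zero]
  intro v hv
  have h := map_eq e.toLinearMap (mk 0 v)
  rw [fst_mk, map_zero, snd_mk, hv] at h
  exact congrArg snd ((LinearEquiv.map_eq_zero_iff e).1 h)

theorem eq_bot_or_eq_bot_of_isCompl {D V : Type*} [DivisionRing D] [AddCommGroup V] [Module D V]
    (h : Module.finrank D V = 1) {p q : Submodule D V} (hpq : IsCompl p q) : p = ⊥ ∨ q = ⊥ := by
  have : IsSimpleModule D V := isSimpleModule_iff_finrank_eq_one.2 h
  refine (eq_bot_or_eq_top p).imp_right fun hp => ?_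
  subst hp
  exact eq_bot_of_isCompl_top hpq.symm

theorem RepModule.isIndecomposable_of_nondegenerate {V W : Type*}
    [AddCommGroup V] [Module Fᵐᵒᵖ V] [AddCommGroup W] [Module Gᵐᵒᵖ W]
    {β : BalancedMap F G M V W} (hW : Module.finrank Gᵐᵒᵖ W = 1)
    (h : ∀ v, (∀ m, β.toFun v m = 0) → v = 0) :
    IsIndecomposableModule (TriangularRing F M G)ᵐᵒᵖ (RepModule β) := by
  have : Nontrivial W := Module.nontrivial_of_finrank_pos (R := Gᵐᵒᵖ) (by omega)
  have key : ∀ {p : Submodule (TriangularRing F M G)ᵐᵒᵖ (RepModule β)},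
      rightSub p = ⊥ → p = ⊥ := by
    intro p hp
    refine eq_bot_of_parts ((Submodule.eq_bot_iff _).2 fun v hv => h v fun m => ?_) hp
    exact (Submodule.eq_bot_iff _).1 hp _ (apply_mem hv m)
  exact ⟨inferInstanceAs (Nontrivial (V × W)), fun p q hpq =>
    (eq_bot_or_eq_bot_of_isCompl hW (isCompl_rightSub hpq)).imp key key⟩

theorem RepModule.isIndecomposable_of_spanning {V W : Type*}
    [AddCommGroup V] [Module Fᵐᵒᵖ V] [AddCommGroup W] [Module Gᵐᵒᵖ W]
    {β : BalancedMap F G M V W} (hV : Module.finrank Fᵐᵒᵖ V = 1)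
    (h : ∀ W₁ : Submodule Gᵐᵒᵖ W, (∀ v m, β.toFun v m ∈ W₁) → W₁ = ⊤) :
    IsIndecomposableModule (TriangularRing F M G)ᵐᵒᵖ (RepModule β) := by
  have : Nontrivial V := Module.nontrivial_of_finrank_pos (R := Fᵐᵒᵖ) (by omega)
  have key : ∀ {p q : Submodule (TriangularRing F M G)ᵐᵒᵖ (RepModule β)}, IsCompl p q →
      leftSub p = ⊥ → p = ⊥ := by
    intro p q hpq hp
    have hq : leftSub q = ⊤ := eq_top_of_isCompl_bot (hp ▸ (isCompl_leftSub hpq).symm)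
    have hq' := h (rightSub q) fun v m => apply_mem (hq ▸ Submodule.mem_top) m
    exact eq_bot_of_parts hp (eq_bot_of_isCompl_top (hq' ▸ isCompl_rightSub hpq))
  exact ⟨inferInstanceAs (Nontrivial (V × W)), fun p q hpq =>
    (eq_bot_or_eq_bot_of_isCompl hV (isCompl_leftSub hpq)).imp (key hpq) (key hpq.symm)⟩

end Matrices

/-! ### Large families of indecomposable representations for `ab ≥ 4` -/

section Families

attribute [local instance] dualModule

variable {K F G M : Type*} [Field K] [DivisionRing F] [DivisionRing G] [Algebra K F] [Algebra K G]
  [AddCommGroup M] [Module F M] [Module Gᵐᵒᵖ M] [SMulCommClass F Gᵐᵒᵖ M]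

/-- Row vectors of functionals that are independent over `F` give nondegenerate maps. -/
theorem RepModule.isIndecomposable_of_linearIndependent_left {x : Type*} [Fintype x]
    (θ : x → Fin 1 → M →ₗ[Gᵐᵒᵖ] G) (h : LinearIndependent Fᵐᵒᵖ fun i => θ i 0) :
    IsIndecomposableModule (TriangularRing F M G)ᵐᵒᵖ
      (RepModule (BalancedMap.ofMatrix θ : BalancedMap F G M (x → F) (Fin 1 → G))) := by
  refine RepModule.isIndecomposable_of_nondegenerate (by rw [finrank_op_pi]; rfl) fun v hv => ?_
  have := Fintype.linearIndependent_iff.1 h (fun i => op (v i)) (LinearMap.ext fun m => by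
    have := congrFun (hv m) 0
    rw [BalancedMap.ofMatrix_apply] at this
    simpa [dualModule_smul_apply] using this)
  exact funext fun i => op_injective (this i)

/-- Column vectors of functionals that are independent over `G` give spanning maps. -/
theorem RepModule.isIndecomposable_of_linearIndependent_right {y : Type*} [Fintype y]
    (θ : Fin 1 → y → M →ₗ[Gᵐᵒᵖ] G) (h : LinearIndependent G fun j => θ 0 j) :
    IsIndecomposableModule (TriangularRing F M G)ᵐᵒᵖ
      (RepModule (BalancedMap.ofMatrix θ : BalancedMap F G M (Fin 1 → F) (y → G))) := by
  classical
  refine RepModule.isIndecomposable_of_spanning (by rw [finrank_op_pi]; rfl) fun W₁ hW => ?_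
  by_contra hne
  obtain ⟨lam, h0, hle⟩ := W₁.exists_le_ker_of_lt_top (lt_top_iff_ne_top.2 hne)
  refine h0 ?_
  have hlam : ∀ w, lam w = ∑ j, op (w j) * lam (Pi.single j 1) := LinearMap.apply_eq_sum_mul lam
  have := Fintype.linearIndependent_iff.1 h (fun j => unop (lam (Pi.single j 1)))
    (LinearMap.ext fun m => by
      have h1 : lam _ = 0 := hle (hW 1 m)
      rw [hlam] at h1
      have h2 := congrArg unop h1
      simpa [BalancedMap.ofMatrix_apply] using h2)
  refine LinearMap.ext fun w => ?_
  rw [hlam, LinearMap.zero_apply]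
  exact Finset.sum_eq_zero fun j _ => by
    rw [(unop_eq_zero_iff _).1 (this j), mul_zero]

/-- If `ab ≥ 4`, then for some dimension vector finitely many modules, respectively one module if
the base field is finite, do not exhaust the indecomposable ones. -/
theorem IsAlgebraicBimodule.exists_indecomposable_not_equiv (hM : IsAlgebraicBimodule K F G M)
    (hab : 4 ≤ Module.finrank Gᵐᵒᵖ M * Module.finrank F M) :
    ∃ x y : ℕ, ∀ (n : ℕ), (Infinite K ∨ Subsingleton (Fin n)) →
      ∀ θ' : Fin n → Fin x → Fin y → M →ₗ[Gᵐᵒᵖ] G, ∃ θ : Fin x → Fin y → M →ₗ[Gᵐᵒᵖ] G,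
        IsIndecomposableModule (TriangularRing F M G)ᵐᵒᵖ
          (RepModule (BalancedMap.ofMatrix θ : BalancedMap F G M (Fin x → F) (Fin y → G))) ∧
        ∀ i, IsEmpty (RepModule (BalancedMap.ofMatrix θ : BalancedMap F G M (Fin x → F) (Fin y → G))
          ≃ₗ[(TriangularRing F M G)ᵐᵒᵖ]
          RepModule (BalancedMap.ofMatrix (θ' i) : BalancedMap F G M (Fin x → F) (Fin y → G))) := by
  have := hM.finite_F
  have := hM.finite_G
  have := hM.finite_right
  have := hM.finite_dual
  have := hM.isScalarTower_dual
  have : Module.Finite K Fᵐᵒᵖ := Module.Finite.equiv (MulOpposite.opLinearEquiv K : F ≃ₗ[K] Fᵐᵒᵖ)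
  have hG := finrank_dual (G := G) (M := M)
  have hF := hM.finrank_dual_left
  have h1 := Module.finrank_mul_finrank K Fᵐᵒᵖ (M →ₗ[Gᵐᵒᵖ] G)
  have h2 := Module.finrank_mul_finrank K G (M →ₗ[Gᵐᵒᵖ] G)
  -- The dimension vector is `(1, 1)` if `a, b ≥ 2`, `(1, 2)` if `b = 1`, and `(2, 1)` if `a = 1`.
  rcases Nat.lt_or_ge 1 (Module.finrank Gᵐᵒᵖ M) with ha | ha
  · rcases Nat.lt_or_ge 1 (Module.finrank F M) with hb | hb
    · refine ⟨1, 1, fun n hn θ' => ?_⟩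
      obtain ⟨p, hp0, hp⟩ := exists_ne_smul_smul (K := K) (D := G) (E := Fᵐᵒᵖ) (P := M →ₗ[Gᵐᵒᵖ] G)
        (by nlinarith) hn fun i => θ' i 0 0
      refine ⟨fun _ _ => p, RepModule.isIndecomposable_of_linearIndependent_left _
        (LinearIndependent.of_subsingleton 0 hp0), fun i => ⟨fun e => ?_⟩⟩
      obtain ⟨A, B, -, hB, h⟩ := RepModule.exists_matrices e.toLinearMap
      have hB0 : B 0 0 ≠ 0 := by
        intro h0
        have := RepModule.rightMap_injective e (a₁ := 1) (a₂ := 0) (by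
          ext l; rw [hB, map_zero]; simp [Subsingleton.elim l 0, h0])
        exact one_ne_zero this
      refine hp i (B 0 0)⁻¹ (op (A 0 0)) ?_
      rw [inv_smul_eq_iff₀ hB0]
      ext m
      have := h 0 0 m
      simp only [Finset.univ_unique, Fin.default_eq_zero, Finset.sum_singleton] at this
      exact this.symm
    · have hb1 : Module.finrank F M = 1 := by
        have : Module.finrank F M ≠ 0 := by rintro h; rw [h] at hab; omega
        omega
      refine ⟨1, 2, fun n hn θ' => ?_⟩
      obtain ⟨p, hpi, hp⟩ := exists_linearIndependent_ne_smul_sum (K := K) (D := Fᵐᵒᵖ) (E := G)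
        (P := M →ₗ[Gᵐᵒᵖ] G) (by rw [hF, hb1]) (by nlinarith) hn fun i => θ' i 0
      refine ⟨fun _ => p, RepModule.isIndecomposable_of_linearIndependent_right _ hpi,
        fun i => ⟨fun e => ?_⟩⟩
      obtain ⟨A, B, hA, -, h⟩ := RepModule.exists_matrices e.symm.toLinearMap
      have hA0 : op (A 0 0) ≠ 0 := by
        intro h0
        have h0 : A 0 0 = 0 := op_injective h0
        have := RepModule.leftMap_injective e.symm (a₁ := 1) (a₂ := 0) (by
          ext l; rw [hA, map_zero]; simp [Subsingleton.elim l 0, h0])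
        exact one_ne_zero this
      refine hp i (op (A 0 0))⁻¹ (fun k j => B j k) fun k => ?_
      rw [eq_inv_smul_iff₀ hA0]
      ext m
      have := h 0 k m
      simp only [Finset.univ_unique, Fin.default_eq_zero, Finset.sum_singleton] at this
      rw [LinearMap.sum_apply]
      exact this.symm
  · have ha1 : Module.finrank Gᵐᵒᵖ M = 1 := by
      have : Module.finrank Gᵐᵒᵖ M ≠ 0 := by rintro h; rw [h] at hab; omega
      omega
    refine ⟨2, 1, fun n hn θ' => ?_⟩
    obtain ⟨p, hpi, hp⟩ := exists_linearIndependent_ne_smul_sum (K := K) (D := G) (E := Fᵐᵒᵖ)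
      (P := M →ₗ[Gᵐᵒᵖ] G) (by rw [hG, ha1]) (by nlinarith) hn fun i k => θ' i k 0
    refine ⟨fun k _ => p k, RepModule.isIndecomposable_of_linearIndependent_left _ hpi,
      fun i => ⟨fun e => ?_⟩⟩
    obtain ⟨A, B, -, hB, h⟩ := RepModule.exists_matrices e.toLinearMap
    have hB0 : B 0 0 ≠ 0 := by
      intro h0
      have := RepModule.rightMap_injective e (a₁ := 1) (a₂ := 0) (by
        ext l; rw [hB, map_zero]; simp [Subsingleton.elim l 0, h0])
      exact one_ne_zero this
    refine hp i (B 0 0)⁻¹ (fun k j => op (A k j)) fun k => ?_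
    rw [eq_inv_smul_iff₀ hB0]
    ext m
    have := h k 0 m
    simp only [Finset.univ_unique, Fin.default_eq_zero, Finset.sum_singleton] at this
    rw [LinearMap.sum_apply]
    exact this

end Families

theorem ULift.isIndecomposable {A N : Type*} [Ring A] [AddCommGroup N] [Module A N]
    (h : IsIndecomposableModule A N) : IsIndecomposableModule A (ULift N) :=
  h.congr ULift.moduleEquiv.symm

section Negative

variable {K : Type*} {F : Type u} {M : Type v} {G : Type w} [Field K]
    [DivisionRing F] [DivisionRing G] [Algebra K F] [Algebra K G] [AddCommGroup M] [Module F M]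
    [Module Gᵐᵒᵖ M] [SMulCommClass F Gᵐᵒᵖ M]

/-- If `ab ≥ 4`, then two nonisomorphic indecomposable modules have the same composition factors. -/
theorem not_satisfiesX_of_le_finrank_mul (hM : IsAlgebraicBimodule K F G M)
    (hab : 4 ≤ Module.finrank Gᵐᵒᵖ M * Module.finrank F M) :
    ¬ SatisfiesX (TriangularRing F M G) := by
  intro hX
  obtain ⟨x, y, h⟩ := hM.exists_indecomposable_not_equiv hab
  obtain ⟨θ', hI', -⟩ := h 0 (Or.inr inferInstance) Fin.elim0
  obtain ⟨θ, hI, he⟩ := h 1 (Or.inr inferInstance) fun _ => θ'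
  let N := RepModule (BalancedMap.ofMatrix θ : BalancedMap F G M (Fin x → F) (Fin y → G))
  let N' := RepModule (BalancedMap.ofMatrix θ' : BalancedMap F G M (Fin x → F) (Fin y → G))
  have hN : IsFiniteLength (TriangularRing F M G)ᵐᵒᵖ N := RepModule.isFiniteLength _
  have hN' : IsFiniteLength (TriangularRing F M G)ᵐᵒᵖ N' := RepModule.isFiniteLength _
  let e : N ≃ₗ[(TriangularRing F M G)ᵐᵒᵖ] ULift.{max u v w} N := ULift.moduleEquiv.symm
  let e' : N' ≃ₗ[(TriangularRing F M G)ᵐᵒᵖ] ULift.{max u v w} N' := ULift.moduleEquiv.symm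
  obtain ⟨i⟩ := hX (ULift.{max u v w} N) (ULift.{max u v w} N')
    (e.isFiniteLength hN) (e'.isFiniteLength hN') (ULift.isIndecomposable hI)
    (ULift.isIndecomposable hI') fun S _ _ _ => by
      rw [← compositionMultiplicity_congr hN e, ← compositionMultiplicity_congr hN' e']
      exact (RepModule.compositionMultiplicity_eq (BalancedMap.ofMatrix θ) S).trans
        (RepModule.compositionMultiplicity_eq (BalancedMap.ofMatrix θ') S).symm
  exact (he 0).false (e.trans (i.trans e'.symm))

/-- If `ab ≥ 4` and the base field is infinite, then there are infinitely many indecomposable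
modules. -/
theorem not_isFiniteRepresentationType_of_infinite [Infinite K] (hM : IsAlgebraicBimodule K F G M)
    (hab : 4 ≤ Module.finrank Gᵐᵒᵖ M * Module.finrank F M) :
    ¬ IsFiniteRepresentationType (TriangularRing F M G) := by
  classical
  rintro ⟨n, L, hL⟩
  obtain ⟨x, y, h⟩ := hM.exists_indecomposable_not_equiv hab
  let P : Fin n → (Fin x → Fin y → M →ₗ[Gᵐᵒᵖ] G) → Prop := fun i θ =>
    Nonempty (RepModule (BalancedMap.ofMatrix θ : BalancedMap F G M (Fin x → F) (Fin y → G))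
      ≃ₗ[(TriangularRing F M G)ᵐᵒᵖ] L i)
  obtain ⟨θ, hI, he⟩ := h n (Or.inl inferInstance) fun i =>
    if h : ∃ θ, P i θ then h.choose else 0
  let N := RepModule (BalancedMap.ofMatrix θ : BalancedMap F G M (Fin x → F) (Fin y → G))
  have hN : IsFiniteLength (TriangularRing F M G)ᵐᵒᵖ N := RepModule.isFiniteLength _
  have := (isFiniteLength_iff_isNoetherian_isArtinian.1 hN).1
  obtain ⟨i, ⟨j⟩⟩ := hL (ULift.{max u v w} N) inferInstance (ULift.isIndecomposable hI)
  have hex : ∃ θ, P i θ := ⟨θ, ⟨ULift.moduleEquiv.symm.trans j⟩⟩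
  have hi := he i
  rw [dif_pos hex] at hi
  obtain ⟨k⟩ := hex.choose_spec
  exact hi.false (ULift.moduleEquiv.symm.trans (j.trans k.symm))

end Negative

/-! ### Decomposition of finite modules and their automorphisms -/

section FiniteModules

variable {A : Type*} [Ring A]

/-- A finite module is a finite product of indecomposable modules. -/
theorem exists_equiv_pi_of_finite {n : ℕ} (L : Fin n → ModuleCat.{v} A)
    (hL : ∀ (N : Type v) [AddCommGroup N] [Module A N], Finite N → IsIndecomposableModule A N →
      ∃ i, Nonempty (N ≃ₗ[A] L i)) (N : Type v) [AddCommGroup N] [Module A N] [hN : Finite N] :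
    ∃ (ι : Type) (_ : Finite ι) (c : ι → Fin n), Nonempty (N ≃ₗ[A] ∀ j, L (c j)) ∧
      ∀ j, IsIndecomposableModule A (L (c j)) := by
  induction hk : Nat.card N using Nat.strong_induction_on generalizing N with
  | _ k ih =>
  rcases subsingleton_or_nontrivial N with h | h
  · exact ⟨Empty, inferInstance, Empty.elim, ⟨LinearEquiv.ofSubsingleton _ _⟩, fun j => j.elim⟩
  by_cases hI : IsIndecomposableModule A N
  · obtain ⟨i, ⟨e⟩⟩ := hL N hN hI
    exact ⟨Unit, inferInstance, fun _ => i, ⟨e.trans (LinearEquiv.funUnique Unit A (L i)).symm⟩,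
      fun _ => hI.congr e⟩
  · simp only [IsIndecomposableModule, h, true_and] at hI
    push Not at hI
    obtain ⟨p, q, hpq, hp, hq⟩ := hI
    have hlt : ∀ p : Submodule A N, p ≠ ⊤ → Nat.card p < k := by
      intro p hp
      rw [← hk]
      obtain ⟨x, hx⟩ : ∃ x, x ∉ p := by
        by_contra! h
        exact hp (Submodule.eq_top_iff'.2 h)
      exact Finite.card_subtype_lt hx
    have hp' : p ≠ ⊤ := fun h => hq (eq_bot_of_isCompl_top (h ▸ hpq.symm))
    have hq' : q ≠ ⊤ := fun h => hp (eq_bot_of_isCompl_top (h ▸ hpq))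
    obtain ⟨ι, hι, c, ⟨e⟩, hc⟩ := ih _ (hlt p hp') p rfl
    obtain ⟨ι', hι', c', ⟨e'⟩, hc'⟩ := ih _ (hlt q hq') q rfl
    refine ⟨ι ⊕ ι', inferInstance, Sum.elim c c', ⟨?_⟩, fun j => ?_⟩
    · exact (Submodule.prodEquivOfIsCompl p q hpq).symm.trans ((e.prodCongr e').trans
        (LinearEquiv.sumPiEquivProdPi A ι ι' fun j => L (Sum.elim c c' j)).symm)
    · cases j with
      | inl j => exact hc j
      | inr j => exact hc' j

theorem nonempty_equiv_pi_of_card_fiber {n : ℕ} (L : Fin n → ModuleCat.{v} A) {ι ι' : Type}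
    [Finite ι] [Finite ι'] (c : ι → Fin n) (c' : ι' → Fin n)
    (h : ∀ i, Nat.card {j // c j = i} = Nat.card {j // c' j = i}) :
    Nonempty ((∀ j, L (c j)) ≃ₗ[A] ∀ j, L (c' j)) := by
  obtain ⟨e, he⟩ : ∃ e : ι ≃ ι', ∀ j, c' (e j) = c j :=
    ⟨Equiv.ofFiberEquiv fun i => (Finite.card_eq.1 (h i)).some, Equiv.ofFiberEquiv_map _⟩
  obtain rfl : c = c' ∘ e := funext fun j => (he j).symm
  exact ⟨LinearEquiv.piCongrLeft A (fun j => L (c' j)) e⟩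

/-- A product with `2k` isomorphic nonzero factors has at least `2 ^ k²` automorphisms, namely
unipotent block matrices with entries `0` and `1`. -/
theorem le_card_equiv_pi {ι : Type} [Finite ι] (L : ι → Type*) [∀ j, AddCommGroup (L j)]
    [∀ j, Module A (L j)] [∀ j, Finite (L j)] {k : ℕ} (f : Fin k ⊕ Fin k → ι)
    (hf : Function.Injective f) (Q : Type*) [AddCommGroup Q] [Module A Q] [Nontrivial Q]
    (σ : ∀ p, Q ≃ₗ[A] L (f p)) :
    2 ^ (k * k) ≤ Nat.card ((∀ j, L j) ≃ₗ[A] ∀ j, L j) := by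
  classical
  have := Fintype.ofFinite ι
  let a : Fin k ⊕ Fin k → Q →ₗ[A] ∀ j, L j := fun p =>
    LinearMap.single A L (f p) ∘ₗ (σ p).toLinearMap
  let b : Fin k ⊕ Fin k → (∀ j, L j) →ₗ[A] Q := fun p =>
    (σ p).symm.toLinearMap ∘ₗ LinearMap.proj (f p)
  have hab : ∀ p x, b p (a p x) = x := fun p x => by simp [a, b]
  have hab' : ∀ p q x, p ≠ q → b p (a q x) = 0 := fun p q x hpq => by
    simp [a, b, hf.ne hpq]
  let E : (Fin k → Fin k → Bool) → (∀ j, L j) →ₗ[A] ∀ j, L j := fun X =>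
    ∑ p, ∑ q, if X p q then a (Sum.inl p) ∘ₗ b (Sum.inr q) else 0
  have hE : ∀ X x, E X x = ∑ p, ∑ q, if X p q then a (Sum.inl p) (b (Sum.inr q) x) else 0 := by
    intro X x
    simp only [E, LinearMap.sum_apply]
    exact Finset.sum_congr rfl fun p _ => Finset.sum_congr rfl fun q _ => by split_ifs <;> rfl
  have hEE : ∀ X x, E X (E X x) = 0 := by
    intro X x
    have : ∀ q, b (Sum.inr q) (E X x) = 0 := by
      intro q
      rw [hE, map_sum]
      refine Finset.sum_eq_zero fun p _ => ?_
      rw [map_sum]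
      refine Finset.sum_eq_zero fun q' _ => ?_
      split_ifs
      · exact hab' _ _ _ Sum.inr_ne_inl
      · exact map_zero _
    rw [hE]
    simp [this]
  let U : (Fin k → Fin k → Bool) → ((∀ j, L j) ≃ₗ[A] ∀ j, L j) := fun X =>
    LinearEquiv.ofLinearMap (LinearMap.id + E X) (LinearMap.id - E X)
      (LinearMap.ext fun x => by simp [hEE]) (LinearMap.ext fun x => by simp [hEE])
  have hU : Function.Injective U := by
    intro X Y hXY
    have h : ∀ x, E X x = E Y x := fun x => by
      have h' : x + E X x = x + E Y x := congrArg (fun e => e x) hXY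
      exact add_left_cancel h'
    obtain ⟨z, hz⟩ := exists_ne (0 : Q)
    have hcoef : ∀ X p q, b (Sum.inl p) (E X (a (Sum.inr q) z)) = if X p q then z else 0 := by
      intro X p q
      rw [hE, map_sum, Finset.sum_eq_single p, map_sum, Finset.sum_eq_single q]
      · split_ifs
        · rw [hab, hab]
        · exact map_zero _
      · intro q' _ hq'
        split_ifs
        · rw [hab' _ _ _ (Sum.inr_injective.ne hq'), map_zero, map_zero]
        · exact map_zero _
      · simp
      · intro p' _ hp'
        rw [map_sum]
        refine Finset.sum_eq_zero fun q' _ => ?_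
        split_ifs
        · exact hab' _ _ _ (Sum.inl_injective.ne hp'.symm)
        · exact map_zero _
      · simp
    funext p q
    have h1 := hcoef X p q
    rw [h, hcoef] at h1
    cases hX : X p q <;> cases hY : Y p q <;> simp_all
  have hfin : Finite ((∀ j, L j) ≃ₗ[A] ∀ j, L j) :=
    Finite.of_injective (fun e x => e x) fun e e' h => LinearEquiv.ext (congrFun h)
  have := Nat.card_le_card_of_injective U hU
  simpa [Nat.card_fun, pow_mul] using this

end FiniteModules

/-! ### Counting representations over a finite field -/

section Counting

variable {F G M : Type*} [DivisionRing F] [DivisionRing G]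
  [AddCommGroup M] [Module F M] [Module Gᵐᵒᵖ M] [SMulCommClass F Gᵐᵒᵖ M]
  {x y : Type*} [Fintype x] [Fintype y]

/-- The module of the representation given by a matrix of functionals. -/
abbrev MatrixModule (θ : x → y → M →ₗ[Gᵐᵒᵖ] G) : Type _ :=
  RepModule (BalancedMap.ofMatrix θ : BalancedMap F G M (x → F) (y → G))

theorem BalancedMap.ofMatrix_injective : Function.Injective
    (BalancedMap.ofMatrix : (x → y → M →ₗ[Gᵐᵒᵖ] G) → BalancedMap F G M (x → F) (y → G)) := by
  classical
  intro θ θ' h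
  funext i j
  ext m
  have h1 : ∀ θ : x → y → M →ₗ[Gᵐᵒᵖ] G,
      (BalancedMap.ofMatrix θ : BalancedMap F G M (x → F) (y → G)).toFun (Pi.single i 1) m j =
        θ i j m := by
    intro θ
    rw [BalancedMap.ofMatrix_apply, Finset.sum_eq_single i]
    · simp
    · intro k _ hk; simp [hk]
    · simp
  rw [← h1 θ, h, h1]

/-- The components of an isomorphism determine its target. -/
theorem RepModule.eq_of_leftMap_eq {θ θ₁ θ₂ : x → y → M →ₗ[Gᵐᵒᵖ] G}
    (e₁ : MatrixModule (F := F) θ ≃ₗ[(TriangularRing F M G)ᵐᵒᵖ] MatrixModule (F := F) θ₁)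
    (e₂ : MatrixModule (F := F) θ ≃ₗ[(TriangularRing F M G)ᵐᵒᵖ] MatrixModule (F := F) θ₂)
    (hl : leftMap e₁.toLinearMap = leftMap e₂.toLinearMap)
    (hr : rightMap e₁.toLinearMap = rightMap e₂.toLinearMap) : θ₁ = θ₂ := by
  have hs : Function.Surjective (leftMap e₁.toLinearMap) :=
    LinearMap.surjective_of_injective (leftMap_injective e₁)
  have key : (BalancedMap.ofMatrix θ₁ : BalancedMap F G M (x → F) (y → G)).toFun =
      (BalancedMap.ofMatrix θ₂ : BalancedMap F G M (x → F) (y → G)).toFun := by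
    ext v m : 2
    obtain ⟨v, rfl⟩ := hs v
    rw [← rightMap_apply, hr, rightMap_apply, hl]
  refine BalancedMap.ofMatrix_injective (F := F) ?_
  cases h₁ : (BalancedMap.ofMatrix θ₁ : BalancedMap F G M (x → F) (y → G))
  cases h₂ : (BalancedMap.ofMatrix θ₂ : BalancedMap F G M (x → F) (y → G))
  rw [h₁, h₂] at key
  cases key
  rfl

/-- The isomorphism class of a representation is an orbit of `GL(V) × GL(W)`, whose stabiliser is
the automorphism group. -/
theorem RepModule.card_class_mul_card_equiv_le [Finite F] [Finite G] [Finite M]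
    (θ : x → y → M →ₗ[Gᵐᵒᵖ] G) :
    Nat.card {θ' : x → y → M →ₗ[Gᵐᵒᵖ] G // Nonempty (MatrixModule (F := F) θ
        ≃ₗ[(TriangularRing F M G)ᵐᵒᵖ] MatrixModule (F := F) θ')} *
      Nat.card (MatrixModule (F := F) θ ≃ₗ[(TriangularRing F M G)ᵐᵒᵖ] MatrixModule (F := F) θ) ≤
    Nat.card F ^ (Fintype.card x * Fintype.card x) *
      Nat.card G ^ (Fintype.card y * Fintype.card y) := by
  let i : {θ' : x → y → M →ₗ[Gᵐᵒᵖ] G // Nonempty (MatrixModule (F := F) θ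
        ≃ₗ[(TriangularRing F M G)ᵐᵒᵖ] MatrixModule (F := F) θ')} ×
      (MatrixModule (F := F) θ ≃ₗ[(TriangularRing F M G)ᵐᵒᵖ] MatrixModule (F := F) θ) →
      (x → x → F) × (y → y → G) := fun p =>
    ⟨(RepModule.exists_matrices (p.2.trans p.1.2.some).toLinearMap).choose,
      (RepModule.exists_matrices (p.2.trans p.1.2.some).toLinearMap).choose_spec.choose⟩
  have hi : Function.Injective i := by
    rintro ⟨⟨θ₁, h₁⟩, α⟩ ⟨⟨θ₂, h₂⟩, α'⟩ h
    obtain ⟨a1, b1, -⟩ :=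
      (RepModule.exists_matrices (α.trans h₁.some).toLinearMap).choose_spec.choose_spec
    obtain ⟨a2, b2, -⟩ :=
      (RepModule.exists_matrices (α'.trans h₂.some).toLinearMap).choose_spec.choose_spec
    have hA := congrArg Prod.fst h
    have hB := congrArg Prod.snd h
    have hl : leftMap (α.trans h₁.some).toLinearMap = leftMap (α'.trans h₂.some).toLinearMap :=
      LinearMap.ext fun v => funext fun k => by
        rw [a1, a2]; exact Finset.sum_congr rfl fun j _ => congrArg (fun A => A j k * v j) hA
    have hr : rightMap (α.trans h₁.some).toLinearMap = rightMap (α'.trans h₂.some).toLinearMap :=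
      LinearMap.ext fun v => funext fun k => by
        rw [b1, b2]; exact Finset.sum_congr rfl fun j _ => congrArg (fun A => A j k * v j) hB
    obtain rfl := RepModule.eq_of_leftMap_eq _ _ hl hr
    have hα : α = α' := by
      refine LinearEquiv.ext fun z => h₁.some.injective ?_
      have e1 := RepModule.map_eq (α.trans h₁.some).toLinearMap z
      have e2 := RepModule.map_eq (α'.trans h₁.some).toLinearMap z
      rw [hl, hr] at e1
      exact e1.trans e2.symm
    rw [hα]
  have h := Nat.card_le_card_of_injective i hi
  rw [Nat.card_prod, Nat.card_prod] at h
  refine h.trans (le_of_eq ?_)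
  simp [Nat.card_fun, pow_mul]

end Counting

/-- A polynomial is eventually smaller than `2 ^ k²`. -/
theorem exists_mul_add_one_pow_lt (C n : ℕ) : ∃ k, (C * k + 1) ^ n < 2 ^ (k * k) := by
  obtain ⟨j, hj⟩ : ∃ j, j = 2 * C + n + 1 := ⟨_, rfl⟩
  refine ⟨2 * j, ?_⟩
  have h1 : C * (2 * j) + 1 ≤ 2 ^ (2 * j) := by
    have h2 : j + 1 ≤ 2 ^ j := Nat.lt_two_pow_self
    calc C * (2 * j) + 1 ≤ (j + 1) * (j + 1) := by
          have : 2 * C ≤ j := by omega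
          nlinarith
      _ ≤ 2 ^ j * 2 ^ j := Nat.mul_le_mul h2 h2
      _ = 2 ^ (2 * j) := by rw [two_mul, pow_add]
  calc (C * (2 * j) + 1) ^ n ≤ (2 ^ (2 * j)) ^ n := Nat.pow_le_pow_left h1 n
    _ = 2 ^ (2 * j * n) := (pow_mul _ _ _).symm
    _ < 2 ^ (2 * j * (2 * j)) := Nat.pow_lt_pow_right (by norm_num) (by
      have : n < 2 * j := by omega
      have : 0 < 2 * j := by omega
      nlinarith)

/-! ### Infinitely many indecomposable modules over a finite field -/

/-- If there are many factors in a product, then `2k` of them are isomorphic. -/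
theorem le_card_equiv_pi_of_le_card {A : Type*} [Ring A] {n : ℕ} (L : Fin n → ModuleCat.{v} A)
    {ι : Type} [Finite ι] (c : ι → Fin n) (hc : ∀ j, Nontrivial (L (c j)))
    (hfin : ∀ j, Finite (L (c j))) {k : ℕ} (hk : 0 < k) (h : n * (2 * k) ≤ Nat.card ι)
    (hι : Nonempty ι) :
    2 ^ (k * k) ≤ Nat.card ((∀ j, L (c j)) ≃ₗ[A] ∀ j, L (c j)) := by
  classical
  have := Fintype.ofFinite ι
  have : Nonempty (Fin n) := hι.map c
  obtain ⟨i, hi⟩ := Fintype.exists_le_card_fiber_of_mul_le_card c (n := 2 * k) (by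
    rwa [Fintype.card_fin, ← Nat.card_eq_fintype_card])
  rw [← Fintype.card_subtype] at hi
  obtain ⟨f⟩ : Nonempty (Fin k ⊕ Fin k ↪ {j // c j = i}) :=
    Function.Embedding.nonempty_of_card_le (by simpa [← two_mul] using hi)
  have : Nontrivial (L i) := by
    have := hc (f (Sum.inl ⟨0, hk⟩)).1
    rwa [(f (Sum.inl ⟨0, hk⟩)).2] at this
  have hσ : ∀ p, Nonempty (L i ≃ₗ[A] L (c (f p).1)) := fun p => by
    rw [(f p).2]; exact ⟨LinearEquiv.refl A _⟩
  exact le_card_equiv_pi (fun j => L (c j)) (fun p => (f p).1)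
    (Subtype.val_injective.comp f.injective) (L i) fun p => (hσ p).some

theorem card_equiv_congr {A N N' : Type*} [Ring A] [AddCommGroup N] [Module A N] [AddCommGroup N']
    [Module A N'] (e : N ≃ₗ[A] N') : Nat.card (N ≃ₗ[A] N) = Nat.card (N' ≃ₗ[A] N') :=
  Nat.card_congr
    { toFun := fun α => e.symm.trans (α.trans e)
      invFun := fun α => e.trans (α.trans e.symm)
      left_inv := fun α => by ext; simp
      right_inv := fun α => by ext; simp }

/-- If `ab ≥ 4` and the base field is finite, then there are infinitely many indecomposable modules:
otherwise every module with a large dimension vector has many isomorphic summands, hence so many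
automorphisms that the `GL(V) × GL(W)`-orbits are too small to cover all representations when
`f x² + g y² ≤ μ x y`. -/
theorem not_isFiniteRepresentationType_of_finite {K : Type*} {F : Type u} {M : Type v}
    {G : Type w} [Field K] [Finite K]
    [DivisionRing F] [DivisionRing G] [Algebra K F] [Algebra K G] [AddCommGroup M] [Module F M]
    [Module Gᵐᵒᵖ M] [SMulCommClass F Gᵐᵒᵖ M] (hM : IsAlgebraicBimodule K F G M)
    (hab : 4 ≤ Module.finrank Gᵐᵒᵖ M * Module.finrank F M) :
    ¬ IsFiniteRepresentationType (TriangularRing F M G) := by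
  classical
  rintro ⟨n, L, hL⟩
  have := hM.finite_F
  have := hM.finite_G
  have := hM.finite_left
  have := hM.finite_right
  have := hM.finite_dual
  have : Finite F := Module.finite_of_finite K
  have : Finite G := Module.finite_of_finite K
  have : Finite M := Module.finite_of_finite F
  have : Finite (M →ₗ[Gᵐᵒᵖ] G) := Module.finite_of_finite K
  have hfm := hM.finrank_mul_finrank
  have hμ := Module.finrank_mul_finrank K G (M →ₗ[Gᵐᵒᵖ] G)
  rw [finrank_dual] at hμ
  have hf : 0 < Module.finrank K F := Module.finrank_pos
  have hFK := Module.natCard_eq_pow_finrank (K := K) (V := F)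
  have hGK := Module.natCard_eq_pow_finrank (K := K) (V := G)
  have hDK := Module.natCard_eq_pow_finrank (K := K) (V := M →ₗ[Gᵐᵒᵖ] G)
  have hK2 : 1 < Nat.card K := Finite.one_lt_card
  have hF2 : 1 < Nat.card F := Finite.one_lt_card
  have hG2 : 1 < Nat.card G := Finite.one_lt_card
  set f := Module.finrank K F
  set g := Module.finrank K G
  set μ := Module.finrank K (M →ₗ[Gᵐᵒᵖ] G)
  set a := Module.finrank Gᵐᵒᵖ M
  set b := Module.finrank F M
  have hquad : 4 * (f * g) ≤ μ * μ := by
    calc 4 * (f * g) ≤ (a * b) * (f * g) := Nat.mul_le_mul_right _ hab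
      _ = (g * a) * (f * b) := by ring
      _ = μ * μ := by rw [hfm, hμ]
  -- All finite modules in the list have at most `2 ^ D` elements.
  let D := 1 + ∑ i, Nat.card (L i)
  have hD : ∀ i, Nat.card (L i) ≤ 2 ^ D := fun i =>
    (Finset.single_le_sum (f := fun i => Nat.card (L i)) (fun _ _ => Nat.zero_le _)
      (Finset.mem_univ i)).trans ((Nat.le_add_left _ 1).trans Nat.lt_two_pow_self.le)
  let C₀ := Nat.card F + Nat.card G
  obtain ⟨k, hk⟩ := exists_mul_add_one_pow_lt (C₀ * (μ + 2 * f) * (2 * (n + 1) * D)) n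
  have hk0 : 0 < k := by
    rcases Nat.eq_zero_or_pos k with rfl | h
    · simp at hk
    · exact h
  -- The ratio `μ : 2f` minimises `f x² + g y² - μ x y` for fixed `y`; the factor `N` makes every
  -- representation a product of at least `2k (n + 1)` indecomposable modules.
  let N := 2 * (n + 1) * D * k
  have hN0 : 0 < N := by positivity
  let x := μ * N
  let y := 2 * f * N
  let B := C₀ * (x + y)
  have hB : B = C₀ * (μ + 2 * f) * (2 * (n + 1) * D) * k := by simp only [B, x, y, N]; ring
  rw [← hB] at hk
  have hyN : N ≤ x + y := by simp only [x, y]; nlinarith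
  -- Every representation of dimensions `(x, y)` is a product of modules from the list.
  have hcard : ∀ θ : Fin x → Fin y → M →ₗ[Gᵐᵒᵖ] G, Nat.card (MatrixModule (F := F) θ) =
      Nat.card F ^ x * Nat.card G ^ y := by
    intro θ
    change Nat.card ((Fin x → F) × (Fin y → G)) = _
    simp [Nat.card_prod, Nat.card_fun]
  have hdec : ∀ θ : Fin x → Fin y → M →ₗ[Gᵐᵒᵖ] G, ∃ (ι : Type) (_ : Finite ι) (c : ι → Fin n),
      Nonempty (MatrixModule (F := F) θ ≃ₗ[(TriangularRing F M G)ᵐᵒᵖ] ∀ j, L (c j)) ∧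
      Nat.card ι ≤ B ∧
      2 ^ (k * k) ≤ Nat.card (MatrixModule (F := F) θ ≃ₗ[(TriangularRing F M G)ᵐᵒᵖ]
        MatrixModule (F := F) θ) := by
    intro θ
    have hfinθ : Finite (MatrixModule (F := F) θ) :=
      inferInstanceAs (Finite ((Fin x → F) × (Fin y → G)))
    obtain ⟨ι, hι, c, ⟨e⟩, hc⟩ := exists_equiv_pi_of_finite L (fun N _ _ hN hI =>
      hL N inferInstance hI) (ULift.{max u v w} (MatrixModule (F := F) θ))
    have e' := (ULift.moduleEquiv.symm : MatrixModule (F := F) θ ≃ₗ[(TriangularRing F M G)ᵐᵒᵖ]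
      ULift.{max u v w} _).trans e
    have hfin : Finite (∀ j, L (c j)) := Finite.of_equiv _ e'.toEquiv
    have hnt : ∀ j, Nontrivial (L (c j)) := fun j => (hc j).1
    have hfj : ∀ j, Finite (L (c j)) := fun j =>
      Finite.of_surjective (fun z : ∀ j, L (c j) => z j) (Function.surjective_eval j)
    have := Fintype.ofFinite ι
    have hprod : Nat.card F ^ x * Nat.card G ^ y = ∏ j, Nat.card (L (c j)) := by
      rw [← hcard θ, Nat.card_congr e'.toEquiv, Nat.card_pi]
    have hlow : 2 ^ Nat.card ι ≤ ∏ j, Nat.card (L (c j)) := by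
      rw [Nat.card_eq_fintype_card, ← Finset.card_univ, ← Finset.prod_const]
      exact Finset.prod_le_prod' fun j _ => Finite.one_lt_card
    have hupp : ∏ j, Nat.card (L (c j)) ≤ 2 ^ (D * Nat.card ι) := by
      rw [pow_mul, Nat.card_eq_fintype_card, ← Finset.card_univ, ← Finset.prod_const]
      exact Finset.prod_le_prod' fun j _ => hD _
    have h1 : Nat.card ι ≤ B := by
      refine (Nat.pow_le_pow_iff_right (a := 2) (by norm_num)).1 ?_
      calc 2 ^ Nat.card ι ≤ Nat.card F ^ x * Nat.card G ^ y := hlow.trans_eq hprod.symm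
        _ ≤ (2 ^ C₀) ^ x * (2 ^ C₀) ^ y := by
          gcongr
          · exact (Nat.le_add_right _ _).trans Nat.lt_two_pow_self.le
          · exact (Nat.le_add_left _ _).trans Nat.lt_two_pow_self.le
        _ = 2 ^ B := by rw [← pow_add, ← pow_mul]
    have h2 : N ≤ D * Nat.card ι := by
      refine hyN.trans ((Nat.pow_le_pow_iff_right (a := 2) (by norm_num)).1 ?_)
      calc 2 ^ (x + y) = 2 ^ x * 2 ^ y := pow_add _ _ _
        _ ≤ Nat.card F ^ x * Nat.card G ^ y := by gcongr <;> omega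
        _ ≤ 2 ^ (D * Nat.card ι) := hprod.trans_le hupp
    have h3 : (n + 1) * (2 * k) ≤ Nat.card ι := by
      have hD0 : 0 < D := by positivity
      refine Nat.le_of_mul_le_mul_left (le_trans (le_of_eq ?_) h2) hD0
      simp only [N]; ring
    refine ⟨ι, hι, c, ⟨e'⟩, h1, ?_⟩
    rw [card_equiv_congr e']
    refine le_card_equiv_pi_of_le_card L c hnt hfj hk0 (le_trans (by gcongr; omega) h3) ?_
    rw [← Finite.card_pos_iff]
    exact lt_of_lt_of_le (by positivity) h3
  choose ι hι c hc hle haut using hdec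
  -- Isomorphism classes are counted by the multiplicities of the indecomposable summands.
  let m : (Fin x → Fin y → M →ₗ[Gᵐᵒᵖ] G) → Fin n → Fin (B + 1) := fun θ i =>
    ⟨Nat.card {j // c θ j = i}, Nat.lt_succ_of_le ((Finite.card_subtype_le _).trans (hle θ))⟩
  have := Fintype.ofFinite (Fin x → Fin y → M →ₗ[Gᵐᵒᵖ] G)
  let T := Nat.card F ^ (x * x) * Nat.card G ^ (y * y)
  have hfib : ∀ i ∈ Finset.univ.image m, (Finset.univ.filter fun θ => m θ = i).card ≤
      T / 2 ^ (k * k) := by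
    intro i hi
    obtain ⟨θ₀, -, rfl⟩ := Finset.mem_image.1 hi
    rw [Nat.le_div_iff_mul_le (by positivity)]
    have h1 := RepModule.card_class_mul_card_equiv_le (F := F) θ₀
    simp only [Fintype.card_fin] at h1
    refine le_trans (Nat.mul_le_mul ?_ (haut θ₀)) h1
    rw [← Fintype.card_subtype, ← Nat.card_eq_fintype_card]
    refine Finite.card_le_of_embedding (Subtype.impEmbedding _ _ fun θ hθ => ?_)
    have h2 := nonempty_equiv_pi_of_card_fiber L (c θ₀) (c θ) fun i =>
      (congrArg Fin.val (congrFun hθ i)).symm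
    exact ⟨(hc θ₀).some.trans (h2.some.trans (hc θ).some.symm)⟩
  have h1 := Finset.card_le_mul_card_image Finset.univ (T / 2 ^ (k * k)) hfib
  have h2 : (Finset.univ.image m).card ≤ (B + 1) ^ n :=
    (Finset.card_le_univ _).trans_eq (by simp)
  -- This is the inequality `f x² + g y² ≤ μ x y`.
  have hT : T ≤ (Finset.univ : Finset (Fin x → Fin y → M →ₗ[Gᵐᵒᵖ] G)).card := by
    rw [Finset.card_univ, ← Nat.card_eq_fintype_card]
    simp only [Nat.card_fun, Nat.card_fin, T]
    rw [hFK, hGK, hDK, ← pow_mul, ← pow_mul, ← pow_mul, ← pow_mul, ← pow_add]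
    refine Nat.pow_le_pow_right (by omega) ?_
    have h3 : f * (N * N) * (4 * (f * g)) ≤ f * (N * N) * (μ * μ) := Nat.mul_le_mul_left _ hquad
    simp only [x, y]
    nlinarith
  have hT0 : 0 < T := by positivity
  have h3 : T * 2 ^ (k * k) ≤ T * (B + 1) ^ n := by
    calc T * 2 ^ (k * k) ≤ (T / 2 ^ (k * k) * (B + 1) ^ n) * 2 ^ (k * k) := by
          gcongr
          exact hT.trans (h1.trans (Nat.mul_le_mul_left _ h2))
      _ = (T / 2 ^ (k * k) * 2 ^ (k * k)) * (B + 1) ^ n := by ring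
      _ ≤ T * (B + 1) ^ n := by
          gcongr
          exact Nat.div_mul_le_self _ _
  exact absurd (Nat.le_of_mul_le_mul_left h3 hT0) (not_le.2 hk)

/-! ### The equivalences -/

/-- If `ab ≥ 4`, then there are infinitely many indecomposable modules. -/
theorem not_isFiniteRepresentationType_of_le_finrank_mul {K : Type*} {F : Type u} {M : Type v}
    {G : Type w} [Field K]
    [DivisionRing F] [DivisionRing G] [Algebra K F] [Algebra K G] [AddCommGroup M] [Module F M]
    [Module Gᵐᵒᵖ M] [SMulCommClass F Gᵐᵒᵖ M] (hM : IsAlgebraicBimodule K F G M)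
    (hab : 4 ≤ Module.finrank Gᵐᵒᵖ M * Module.finrank F M) :
    ¬ IsFiniteRepresentationType (TriangularRing F M G) := by
  rcases finite_or_infinite K with h | h
  · exact not_isFiniteRepresentationType_of_finite hM hab
  · exact not_isFiniteRepresentationType_of_infinite hM hab

theorem proposition4p7 {K F G M : Type*} [Field K] [DivisionRing F] [DivisionRing G]
    [Algebra K F] [Algebra K G] [AddCommGroup M] [Module F M] [Module Gᵐᵒᵖ M]
    [SMulCommClass F Gᵐᵒᵖ M] (hM : IsAlgebraicBimodule K F G M) :
    (SatisfiesX (TriangularRing F M G) ↔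
      Module.finrank Gᵐᵒᵖ M * Module.finrank F M ≤ 3) ∧
    (Module.finrank Gᵐᵒᵖ M * Module.finrank F M ≤ 3 ↔
      IsFiniteRepresentationType (TriangularRing F M G)) := by
  refine ⟨⟨fun h => ?_, satisfiesX_of_finrank_mul_le hM⟩,
    isFiniteRepresentationType_of_finrank_mul_le hM, fun h => ?_⟩
  · by_contra! hab
    exact not_satisfiesX_of_le_finrank_mul hM hab h
  · by_contra! hab
    exact not_isFiniteRepresentationType_of_le_finrank_mul hM hab h
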